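/- **Theorem (Initialization $\ell_{2,\infty}$ error).** Let $\mathcal T\in\mathbb R^{p_1\times p_2\times p_3}$ be a nonzero tensor whose mode-$k$ matricization $\mathbf T_k=\mathcal M_k(\mathcal T)\in\mathbb R^{p_k\times p_{-k}}$, $p_{-k}=\prod_{j\ne k}p_j$, has rank $r_k$ for $k=1,2,3$, and let the columns of $\mathbf U_k\in\mathbb R^{p_k\times r_k}$ be leading left singular vectors of $\mathbf T_k$. Write $p=\max_k p_k$, $p_{\min}=\min_k p_k$, $r=\max_k r_k$, $r_{\min}=\min_k r_k$, and let $\lambda_{\min}(\mathbf M)$ be the smallest nonzero singular value of $\mathbf M$, $\|\mathbf M\|$ its spectral norm, $\|\mathbf M\|_{2,\infty}$ the largest Euclidean norm of a row of $\mathbf M$, and $$\lambda=\min_k\lambda_{\min}(\mathbf T_k),\qquad \kappa=\max_k\frac{\|\mathbf T_k\|}{\lambda_{\min}(\mathbf T_k)},\qquad \mu_0=\max_k\sqrt{p_k/r_k}\,\|\mathbf U_k\|_{2,\infty}.$$ Observe $\widehat{\mathcal T}=\mathcal T+\mathcal Z$, where the entries of $\mathcal Z$ are independent and subgaussian with variance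 proxy at most $\sigma^2$, $\sigma>0$, that is, $\mathbb E e^{t\mathcal Z_{ijl}}\le e^{\sigma^2t^2/2}$ for all $t\in\mathbb R$ (so in particular they have mean zero). For a square matrix let $\Gamma$ set its diagonal to zero. Let the columns of $\widehat{\mathbf U}_k^S\in\mathbb R^{p_k\times r_k}$ be leading (orthonormal) eigenvectors of $\Gamma(\mathcal M_k(\widehat{\mathcal T})\mathcal M_k(\widehat{\mathcal T})^\top)$, and for $1\le m\le p_k$ let the columns of $\widetilde{\mathbf U}_k^{(S,k-m)}\in\mathbb R^{p_k\times r_k}$ be leading (orthonormal) eigenvectors of $\Gamma\big((\mathbf T_k+\mathbf Z_k^{k-m})(\mathbf T_k+\mathbf Z_k^{k-m})^\top\big)$, where $\mathbf Z_k^{k-m}$ is $\mathcal M_k(\mathcal Z)$ with its $m$-th row replaced by zero. For all constants $C_1,C_2,C_3,C_4>0$ there are constants $C>0$ and $P_0\in\mathbb N$, depending only on $C_1,\dots,C_4$, such that the following holds whenever $$\frac{\lambda}{\sigma}\ge C_1\frac{\kappa\sqrt{\log p}\;p}{p_{\min}^{1/4}},\qquad \mu_0^2r\le C_2\,p_{\min}^{1/2},\qquad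 \kappa^2\le C_3\,p_{\min}^{1/4},\qquad r\le C_4\,r_{\min}.$$ With probability at least $1-Cp^{-20}$, simultaneously for all $k=1,2,3$ and for every choice of the leading eigenvectors: 1. there is an orthogonal $\mathbf W_k^S\in\mathbb O(r_k)$ minimizing $\|\widehat{\mathbf U}_k^S-\mathbf U_k\mathbf W\|_F$ over $\mathbf W\in\mathbb O(r_k)$ (a matrix sign of $\mathbf U_k^\top\widehat{\mathbf U}_k^S$) such that $$\|\widehat{\mathbf U}_k^S-\mathbf U_k\mathbf W_k^S\|_{2,\infty}\le C\left(\frac{\kappa\mu_0\sqrt{r_k\log p}}{\lambda/\sigma}+\frac{\mu_0\sqrt{r_kp_{-k}}\,\log p}{(\lambda/\sigma)^2}+\kappa^2\mu_0^2\frac{r_k}{p_k}\right);$$ 2. if $p_k\ge P_0$, then $$\max_{1\le m\le p_k}\big\|\widehat{\mathbf U}_k^S(\widehat{\mathbf U}_k^S)^\top-\widetilde{\mathbf U}_k^{(S,k-m)}(\widetilde{\mathbf U}_k^{(S,k-m)})^\top\big\|\le C\left(\frac{\kappa\mu_0\sqrt{r_k\log p}}{\lambda/\sigma}+\frac{\mu_0\sqrt{r_kp_{-k}}\,\log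 p}{(\lambda/\sigma)^2}\right).$$ -/

import Mathlib

open MeasureTheory ProbabilityTheory

noncomputable section

namespace TensorInit

/-- Real order-three tensors of size `p 0 × p 1 × p 2`, as functions of a multi-index. -/
abbrev Tensor (p : Fin 3 → ℕ) : Type := ((k : Fin 3) → Fin (p k)) → ℝ

/-- Indices of the columns of the mode-`k` matricization: an index for each of the two other
modes. There are `p_{-k}` of them; their order plays no role. -/
abbrev ColIdx (p : Fin 3 → ℕ) (k : Fin 3) : Type := (j : Fin 2) → Fin (p (k.succAbove j))

/-- The mode-`k` matricization of a tensor, a `p_k × p_{-k}` matrix. -/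
def matricize {p : Fin 3 → ℕ} (k : Fin 3) (T : Tensor p) :
    Matrix (Fin (p k)) (ColIdx p k) ℝ :=
  Matrix.of fun a b => T (k.insertNth a b)

/-- `p_{-k}`, the product of the two other dimensions. -/
def prodOther (p : Fin 3 → ℕ) (k : Fin 3) : ℕ := ∏ j ∈ Finset.univ.erase k, p j

/-- The largest of the three entries. -/
def maxDim (p : Fin 3 → ℕ) : ℕ := Finset.univ.sup' Finset.univ_nonempty p

/-- The smallest of the three entries. -/
def minDim (p : Fin 3 → ℕ) : ℕ := Finset.univ.inf' Finset.univ_nonempty p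

section

open scoped Matrix.Norms.L2Operator

/-- The spectral norm of a real matrix. -/
def specNorm {m n : Type*} [Fintype m] [DecidableEq m] [Fintype n] [DecidableEq n]
    (M : Matrix m n ℝ) : ℝ := ‖M‖

end

/-- The norm `‖M‖_{2,∞}`: the largest Euclidean norm of a row. -/
def twoInfNorm {m n : Type*} [Fintype m] [Fintype n] (M : Matrix m n ℝ) : ℝ :=
  ⨆ i, Real.sqrt (∑ j, M i j ^ 2)

/-- The Frobenius norm. -/
def frobNorm {m n : Type*} [Fintype m] [Fintype n] (M : Matrix m n ℝ) : ℝ :=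
  Real.sqrt (∑ i, ∑ j, M i j ^ 2)

/-- The smallest nonzero singular value. Mathlib lists the singular values in decreasing order,
starting at the index `0`; exactly the first `M.rank` of them are nonzero. -/
def minSingularValue {m n : Type*} [Fintype m] [DecidableEq m] [Fintype n] [DecidableEq n]
    (M : Matrix m n ℝ) : ℝ :=
  (Matrix.toEuclideanLin M).singularValues (M.rank - 1)

/-- `λ_min(T)`: the smallest nonzero singular value over the three matricizations. -/
def tensorLambda {p : Fin 3 → ℕ} (T : Tensor p) : ℝ :=
  ⨅ k : Fin 3, minSingularValue (matricize k T)

/-- The condition number `κ` of a tensor. -/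
def tensorKappa {p : Fin 3 → ℕ} (T : Tensor p) : ℝ :=
  ⨆ k : Fin 3, specNorm (matricize k T) / minSingularValue (matricize k T)

/-- The hollowing operator `Γ`, which sets the diagonal of a square matrix to zero. -/
def hollow {n : ℕ} (M : Matrix (Fin n) (Fin n) ℝ) : Matrix (Fin n) (Fin n) ℝ :=
  Matrix.of fun i j => if i = j then 0 else M i j

/-- The columns of `U` are `r` leading eigenvectors of the symmetric matrix `M`: they are
orthonormal, they are eigenvectors, with eigenvalues `d`, and on the orthogonal complement of
their span the quadratic form of `M` is at most each of the `d i`. -/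
def IsLeadingEigenvectors {n r : ℕ} (M : Matrix (Fin n) (Fin n) ℝ)
    (U : Matrix (Fin n) (Fin r) ℝ) : Prop :=
  U.transpose * U = 1 ∧ ∃ d : Fin r → ℝ, M * U = U * Matrix.diagonal d ∧
    ∀ x : Fin n → ℝ, U.transpose.mulVec x = 0 →
      ∀ i, dotProduct x (M.mulVec x) ≤ d i * dotProduct x x

/-- The columns of `U` are `r` leading left singular vectors of `M`. -/
def IsLeadingLeftSingular {n r : ℕ} {c : Type*} [Fintype c] (M : Matrix (Fin n) c ℝ)
    (U : Matrix (Fin n) (Fin r) ℝ) : Prop :=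
  IsLeadingEigenvectors (M * M.transpose) U

/-- The incoherence parameter of a tensor with singular vector matrices `U k`. -/
def incoherence {p r : Fin 3 → ℕ} (U : (k : Fin 3) → Matrix (Fin (p k)) (Fin (r k)) ℝ) : ℝ :=
  ⨆ k : Fin 3, Real.sqrt ((p k : ℝ) / (r k : ℝ)) * twoInfNorm (U k)

/-- `V` is a diagonal-deletion estimate of the mode-`k` singular vectors from the tensor `Y`. -/
def IsDiagDeletion {p : Fin 3 → ℕ} {s : ℕ} (k : Fin 3) (Y : Tensor p)
    (V : Matrix (Fin (p k)) (Fin s) ℝ) : Prop :=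
  IsLeadingEigenvectors (hollow (matricize k Y * (matricize k Y).transpose)) V

/-- The tensor `Z` with the entries in the `m`-th row of its mode-`k` matricization
replaced by zero. -/
def leaveOut {p : Fin 3 → ℕ} (k : Fin 3) (m : Fin (p k)) (Z : Tensor p) : Tensor p :=
  fun i => if i k = m then 0 else Z i

/-- `W` is the matrix sign of `Uᵀ V`: an orthogonal matrix for which `U W` is nearest to `V`
in Frobenius norm. -/
def IsAligning {n r : ℕ} (U V : Matrix (Fin n) (Fin r) ℝ) (W : Matrix (Fin r) (Fin r) ℝ) : Prop :=
  W ∈ Matrix.orthogonalGroup (Fin r) ℝ ∧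
    ∀ W' ∈ Matrix.orthogonalGroup (Fin r) ℝ, frobNorm (V - U * W) ≤ frobNorm (V - U * W')

end TensorInit

end

/-!
Fix a mode and write `T` for the matricized signal, `Z` for the matricized noise and `L` for the
smallest nonzero singular value of `T`. The hollowed Gram matrix `gram T Z` is `T Tᵀ` perturbed by
three terms: the deleted diagonal, of norm at most `κ² μ₀² (r / p) L²` by incoherence
(`IsSignal.norm_diagonal_le`); the cross terms of signal and noise, of order `‖T‖ σ √p`; and the
hollowed Gram matrix of the noise. The point of the hollowing is that the last one has norm of order
`√p σ ‖Z‖` only: decoupling (`sum_blocks_eq`) makes it four times an average of bilinear forms in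
two disjoint, hence independent, blocks of rows of `Z`, and a net argument applies to each
(`measure_norm_hollow_le`). Under the signal strength condition the sum of the three is at most `L²
/ 10` as soon as the dimension exceeds a constant, and Weyl's inequalities then open a spectral gap
(`IsSignal.isGapEigenvectors`).

For a bound row by row, the eigenvector equation expresses the `m`-th row of the component of the
estimate `V` orthogonal to the true singular vectors `U` through the `m`-th row of the perturbation
(`IsSignal.vn_row_compl_le`). All terms but one carry the norm of the `m`-th row of `U` or come from
the deleted diagonal; the remaining one is `noiseRow T Z m ᵥ* V`, in which `V` depends on the `m`-th
row of the noise. Replacing `V` by the leave-one-out eigenvectors `V'` removes the dependence. The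
two Gram matrices differ by a matrix of rank two, so that the Davis–Kahan theorem bounds
`‖V Vᵀ - V' V'ᵀ‖` by `noiseRow T Z m ᵥ* V'` and the norm of the `m`-th row of `V'`, which is at most
twice that of `U` since `V'` sees no noise in that row (`IsSignal.norm_sub_dropRow_le`,
`IsSignal.vn_row_sub_le`). Given the other rows, `noiseRow T Z m ᵥ* V'` is subgaussian of
scale at most `√r ‖T + Z‖ σ` (`exists_event_noiseRow`).

The bounds are wanted for every choice of the eigenvectors, and eigenvectors need not depend
measurably on the matrix. Both issues disappear because the spectral projection is unique and
Lipschitz on the set of matrices with a given gap, so that it extends to a continuous function of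
all matrices (`exists_continuous_projection`), to which the tail bound is applied.

Finally `V` is compared with `U W`, where `W` is the matrix sign of `Uᵀ V`, obtained from a polar
decomposition; `‖Uᵀ V - W‖` is quadratic in the spectral error (`exists_isAligning_norm_sub_le`). In
a mode of bounded dimension the last term of the error bound is bounded below, and the trivial bound
on the rows suffices (`exists_isAligning_vn_row_le`).
-/

namespace TensorInit

set_option linter.unusedSectionVars false

open scoped Matrix.Norms.L2Operator
open Matrix

/-! ### Euclidean vector norms and matrix norms -/

/-- The Euclidean norm of a real vector given by its coordinates. -/
noncomputable def vn {m : Type*} [Fintype m] (x : m → ℝ) : ℝ :=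
  ‖(WithLp.toLp 2 x : EuclideanSpace ℝ m)‖

section VecNorm

variable {m n l : Type*} [Fintype m] [Fintype n] [Fintype l]

theorem vn_nonneg (x : m → ℝ) : 0 ≤ vn x := norm_nonneg _

theorem vn_eq_sqrt (x : m → ℝ) : vn x = √(∑ i, x i ^ 2) := by
  simp [vn, EuclideanSpace.norm_eq]

theorem vn_sq (x : m → ℝ) : vn x ^ 2 = x ⬝ᵥ x := by
  rw [vn_eq_sqrt, Real.sq_sqrt (Finset.sum_nonneg fun i _ => sq_nonneg _)]
  simp [dotProduct, sq]

theorem vn_sq_eq_sum (x : m → ℝ) : vn x ^ 2 = ∑ i, x i ^ 2 := by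
  rw [vn_eq_sqrt, Real.sq_sqrt (Finset.sum_nonneg fun i _ => sq_nonneg _)]

theorem vn_zero : vn (0 : m → ℝ) = 0 := by simp [vn]

theorem vn_add_le (x y : m → ℝ) : vn (x + y) ≤ vn x + vn y := norm_add_le _ _

theorem vn_sub_le (x y : m → ℝ) : vn (x - y) ≤ vn x + vn y := norm_sub_le _ _

theorem vn_neg (x : m → ℝ) : vn (-x) = vn x := norm_neg (WithLp.toLp 2 x)

theorem vn_smul (c : ℝ) (x : m → ℝ) : vn (c • x) = |c| * vn x := by
  exact norm_smul c (WithLp.toLp 2 x : EuclideanSpace ℝ m)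

theorem vn_pos {x : m → ℝ} (hx : x ≠ 0) : 0 < vn x := by
  rw [vn, norm_pos_iff]
  simpa using hx

theorem dotProduct_le_vn (x y : m → ℝ) : x ⬝ᵥ y ≤ vn x * vn y := by
  have h := real_inner_le_norm (WithLp.toLp 2 y : EuclideanSpace ℝ m) (WithLp.toLp 2 x)
  rw [EuclideanSpace.inner_toLp_toLp] at h
  simpa [vn, mul_comm] using h

theorem abs_apply_le_vn (x : m → ℝ) (i : m) : |x i| ≤ vn x := by
  rw [vn_eq_sqrt, ← Real.sqrt_sq_eq_abs]
  exact Real.sqrt_le_sqrt (Finset.single_le_sum (f := fun i => x i ^ 2)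
    (fun i _ => sq_nonneg _) (Finset.mem_univ i))

theorem vn_le_of_abs_le {x y : m → ℝ} (h : ∀ i, |x i| ≤ |y i|) : vn x ≤ vn y := by
  rw [vn_eq_sqrt, vn_eq_sqrt]
  exact Real.sqrt_le_sqrt (Finset.sum_le_sum fun i _ => sq_le_sq.mpr (h i))

variable [DecidableEq m] [DecidableEq n]

theorem vn_single (i : m) :
    vn (Pi.single i 1 : m → ℝ) = 1 := by
  rw [vn_eq_sqrt, Finset.sum_eq_single i] <;> simp +contextual

theorem vn_mulVec_le (A : Matrix m n ℝ) (x : n → ℝ) : vn (A *ᵥ x) ≤ ‖A‖ * vn x := by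
  have h := Matrix.l2_opNorm_mulVec A (WithLp.toLp 2 x)
  simpa [vn] using h

theorem norm_transpose (A : Matrix m n ℝ) : ‖Aᵀ‖ = ‖A‖ := by
  rw [← Matrix.conjTranspose_eq_transpose_of_trivial, Matrix.l2_opNorm_conjTranspose]

theorem vn_vecMul_le (x : m → ℝ) (A : Matrix m n ℝ) : vn (x ᵥ* A) ≤ vn x * ‖A‖ := by
  rw [← Matrix.mulVec_transpose, mul_comm, ← norm_transpose A]
  exact vn_mulVec_le _ _

theorem norm_le_of_vn_mulVec_le {A : Matrix m n ℝ} {K : ℝ} (hK : 0 ≤ K)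
    (h : ∀ x, vn (A *ᵥ x) ≤ K * vn x) : ‖A‖ ≤ K := by
  rw [Matrix.l2_opNorm_def]
  refine ContinuousLinearMap.opNorm_le_bound _ hK fun x => ?_
  exact h x.ofLp

theorem abs_apply_le_norm (A : Matrix m n ℝ) (i : m) (j : n) : |A i j| ≤ ‖A‖ := by
  have h1 := abs_apply_le_vn (A *ᵥ Pi.single j 1) i
  have h2 := vn_mulVec_le A (Pi.single j 1)
  rw [vn_single, mul_one] at h2
  simpa using h1.trans h2

theorem vn_row_le_norm (A : Matrix m n ℝ) (i : m) : vn (A.row i) ≤ ‖A‖ := by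
  have h2 := vn_vecMul_le (Pi.single i 1) A
  rw [vn_single, one_mul, Matrix.single_one_vecMul] at h2
  exact h2

theorem norm_diagonal_le {d : m → ℝ} {K : ℝ} (hK : 0 ≤ K) (h : ∀ i, |d i| ≤ K) :
    ‖(Matrix.diagonal d : Matrix m m ℝ)‖ ≤ K := by
  rw [Matrix.l2_opNorm_diagonal]
  exact (pi_norm_le_iff_of_nonneg hK).mpr h

theorem vn_mulVec_of_orthonormal {A : Matrix m n ℝ} (h : Aᵀ * A = 1) (x : n → ℝ) :
    vn (A *ᵥ x) = vn x := by
  have : vn (A *ᵥ x) ^ 2 = vn x ^ 2 := by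
    rw [vn_sq, vn_sq, Matrix.dotProduct_mulVec, Matrix.vecMul_mulVec, h, Matrix.vecMul_one]
  exact (pow_left_inj₀ (vn_nonneg _) (vn_nonneg _) two_ne_zero).mp this

theorem norm_le_one_of_orthonormal {A : Matrix m n ℝ} (h : Aᵀ * A = 1) : ‖A‖ ≤ 1 :=
  norm_le_of_vn_mulVec_le zero_le_one fun x => by rw [vn_mulVec_of_orthonormal h, one_mul]

end VecNorm

section Frobenius

variable {m n l : Type*} [Fintype m] [Fintype n] [Fintype l]

theorem frobNorm_sq (A : Matrix m n ℝ) : frobNorm A ^ 2 = ∑ i, vn (A.row i) ^ 2 := by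
  rw [frobNorm, Real.sq_sqrt (by positivity)]
  simp only [vn_sq_eq_sum, Matrix.row_apply]

theorem frobNorm_nonneg (A : Matrix m n ℝ) : 0 ≤ frobNorm A := Real.sqrt_nonneg _

theorem frobNorm_neg {k l : Type*} [Fintype k] [Fintype l] (A : Matrix k l ℝ) :
    frobNorm (-A) = frobNorm A := by
  simp only [frobNorm, Matrix.neg_apply, neg_sq]

theorem frobNorm_transpose (A : Matrix m n ℝ) : frobNorm Aᵀ = frobNorm A := by
  simp only [frobNorm, Matrix.transpose_apply]
  rw [Finset.sum_comm]

theorem frobNorm_sq_eq_trace (A : Matrix m n ℝ) : frobNorm A ^ 2 = (Aᵀ * A).trace := by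
  rw [← frobNorm_transpose, frobNorm_sq]
  simp only [vn_sq_eq_sum, Matrix.row_apply, Matrix.trace, Matrix.mul_apply, Matrix.diag_apply,
    Matrix.transpose_apply]
  simp only [sq]

theorem frobNorm_eq_norm (A : Matrix m n ℝ) :
    frobNorm A = ‖(WithLp.toLp 2 fun ij : m × n => A ij.1 ij.2 : EuclideanSpace ℝ (m × n))‖ := by
  rw [EuclideanSpace.norm_eq, frobNorm, Fintype.sum_prod_type]
  simp

theorem frobNorm_add_le (A B : Matrix m n ℝ) : frobNorm (A + B) ≤ frobNorm A + frobNorm B := by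
  simp only [frobNorm_eq_norm]
  exact norm_add_le (WithLp.toLp 2 fun ij : m × n => A ij.1 ij.2 : EuclideanSpace ℝ (m × n))
    (WithLp.toLp 2 fun ij : m × n => B ij.1 ij.2)

theorem frobNorm_vecMulVec (x : m → ℝ) (y : n → ℝ) :
    frobNorm (Matrix.vecMulVec x y) = vn x * vn y := by
  rw [frobNorm, vn_eq_sqrt, vn_eq_sqrt, ← Real.sqrt_mul (Finset.sum_nonneg fun i _ => sq_nonneg _),
    Finset.sum_mul_sum]
  simp [Matrix.vecMulVec_apply, mul_pow]

variable [DecidableEq m] [DecidableEq n]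

theorem norm_le_frobNorm (A : Matrix m n ℝ) : ‖A‖ ≤ frobNorm A := by
  refine norm_le_of_vn_mulVec_le (frobNorm_nonneg _) fun x => ?_
  refine le_of_sq_le_sq ?_ (mul_nonneg (frobNorm_nonneg _) (vn_nonneg _))
  rw [mul_pow, frobNorm_sq, vn_sq_eq_sum, Finset.sum_mul]
  refine Finset.sum_le_sum fun i _ => ?_
  rw [← mul_pow]
  refine sq_le_sq.mpr ?_
  rw [abs_of_nonneg (mul_nonneg (vn_nonneg _) (vn_nonneg _)), abs_le]
  constructor
  · have := dotProduct_le_vn (-(A.row i)) x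
    rw [vn_neg, neg_dotProduct] at this
    exact neg_le.mp this
  · exact dotProduct_le_vn _ _

theorem frobNorm_mul_le [DecidableEq l] (A : Matrix m n ℝ) (B : Matrix n l ℝ) :
    frobNorm (A * B) ≤ frobNorm A * ‖B‖ := by
  refine le_of_sq_le_sq ?_ (mul_nonneg (frobNorm_nonneg _) (norm_nonneg _))
  rw [mul_pow, frobNorm_sq, frobNorm_sq, Finset.sum_mul]
  refine Finset.sum_le_sum fun i _ => ?_
  rw [← mul_pow]
  exact pow_le_pow_left₀ (vn_nonneg _) (vn_vecMul_le (A.row i) B) 2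

theorem frobNorm_sq_of_orthonormal {A : Matrix m n ℝ} (h : Aᵀ * A = 1) :
    frobNorm A ^ 2 = Fintype.card n := by
  rw [frobNorm_sq_eq_trace, h, Matrix.trace_one]

end Frobenius

/-! ### Leading eigenvectors and spectral gaps -/

/-- The columns of `V` are orthonormal eigenvectors of `M` with eigenvalues at least `a`, and on
the orthogonal complement of their span the quadratic form of `M` is at most `b`. -/
def IsGapEigenvectors {n r : ℕ} (M : Matrix (Fin n) (Fin n) ℝ) (V : Matrix (Fin n) (Fin r) ℝ)
    (a b : ℝ) : Prop :=
  Vᵀ * V = 1 ∧ ∃ d : Fin r → ℝ, M * V = V * Matrix.diagonal d ∧ (∀ i, a ≤ d i) ∧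
    ∀ x : Fin n → ℝ, Vᵀ *ᵥ x = 0 → x ⬝ᵥ (M *ᵥ x) ≤ b * (x ⬝ᵥ x)

theorem IsGapEigenvectors.mono_left {n r : ℕ} {M : Matrix (Fin n) (Fin n) ℝ}
    {V : Matrix (Fin n) (Fin r) ℝ} {a a' b : ℝ}
    (h : IsGapEigenvectors M V a b) (ha : a' ≤ a) : IsGapEigenvectors M V a' b := by
  obtain ⟨h1, d, h2, h3, h4⟩ := h
  exact ⟨h1, d, h2, fun i => ha.trans (h3 i), h4⟩

theorem IsGapEigenvectors.mono_right {n r : ℕ} {M : Matrix (Fin n) (Fin n) ℝ}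
    {V : Matrix (Fin n) (Fin r) ℝ} {a b b' : ℝ}
    (h : IsGapEigenvectors M V a b) (hb : b ≤ b') : IsGapEigenvectors M V a b' := by
  obtain ⟨h1, d, h2, h3, h4⟩ := h
  refine ⟨h1, d, h2, h3, fun x hx => (h4 x hx).trans (mul_le_mul_of_nonneg_right hb ?_)⟩
  rw [← vn_sq]; positivity

theorem exists_ne_zero_mulVec_eq_zero {α β : Type*} [Fintype α] [Fintype β]
    (h : Fintype.card α < Fintype.card β) (B : Matrix α β ℝ) : ∃ z : β → ℝ, z ≠ 0 ∧ B *ᵥ z = 0 := by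
  have := LinearMap.ker_ne_bot_of_finrank_lt (f := B.mulVecLin) (by simpa using h)
  obtain ⟨z, hz, hz0⟩ := Submodule.exists_mem_ne_zero_of_ne_bot this
  exact ⟨z, hz0, by simpa using hz⟩

theorem dotProduct_mulVec_le {n : ℕ} (E : Matrix (Fin n) (Fin n) ℝ) (x : Fin n → ℝ) :
    |x ⬝ᵥ (E *ᵥ x)| ≤ ‖E‖ * (x ⬝ᵥ x) := by
  have h (x y : Fin n → ℝ) : x ⬝ᵥ (E *ᵥ y) ≤ vn x * (‖E‖ * vn y) :=
    (dotProduct_le_vn _ _).trans (mul_le_mul_of_nonneg_left (vn_mulVec_le _ _) (vn_nonneg _))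
  rw [← vn_sq, abs_le]
  have h1 := h x x
  have h2 := h (-x) x
  rw [vn_neg, neg_dotProduct] at h2
  constructor <;> nlinarith

theorem dotProduct_self_pos {m : Type*} [Fintype m] {x : m → ℝ} (hx : x ≠ 0) : 0 < x ⬝ᵥ x := by
  rw [← vn_sq]
  exact pow_pos (vn_pos hx) 2

section Gap

variable {n r : ℕ}

theorem dotProduct_mulVec_of_transpose_mulVec_eq_zero {m l : Type*} [Fintype m] [Fintype l]
    {V : Matrix m l ℝ} {x : m → ℝ} (hx : Vᵀ *ᵥ x = 0) (c : l → ℝ) : x ⬝ᵥ (V *ᵥ c) = 0 := by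
  rw [Matrix.dotProduct_mulVec, ← Matrix.mulVec_transpose, hx, zero_dotProduct]

theorem dotProduct_mulVec_orthonormal {m l : Type*} [Fintype m] [Fintype l] [DecidableEq l]
    {V : Matrix m l ℝ} (hV : Vᵀ * V = 1) (c e : l → ℝ) : (V *ᵥ c) ⬝ᵥ (V *ᵥ e) = c ⬝ᵥ e := by
  rw [Matrix.dotProduct_mulVec, Matrix.vecMul_mulVec, hV, Matrix.vecMul_one]

/-- Weyl's inequalities at the gap: if `A` is at least `ℓ` on the range of `U` and nonpositive on
its orthogonal complement, then a perturbation of `A` by at most `e` has its leading eigenvalues at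
least `ℓ - e` and the others at most `e`. -/
theorem IsLeadingEigenvectors.isGapEigenvectors {M A : Matrix (Fin n) (Fin n) ℝ}
    {U V : Matrix (Fin n) (Fin r) ℝ} {ℓ e : ℝ} (hV : IsLeadingEigenvectors M V)
    (hM : Mᵀ = M) (hU : Uᵀ * U = 1)
    (hA : ∀ z, ℓ * (z ⬝ᵥ z) ≤ (U *ᵥ z) ⬝ᵥ (A *ᵥ (U *ᵥ z)))
    (hA0 : ∀ x, Uᵀ *ᵥ x = 0 → x ⬝ᵥ (A *ᵥ x) ≤ 0) (he : ‖M - A‖ ≤ e) :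
    IsGapEigenvectors M V (ℓ - e) e := by
  obtain ⟨hVV, d, hd, hlead⟩ := hV
  have hMform (x : Fin n → ℝ) : |x ⬝ᵥ (M *ᵥ x) - x ⬝ᵥ (A *ᵥ x)| ≤ e * (x ⬝ᵥ x) := by
    rw [← dotProduct_sub, ← Matrix.sub_mulVec]
    refine (dotProduct_mulVec_le _ _).trans (mul_le_mul_of_nonneg_right he ?_)
    rw [← vn_sq]; positivity
  have hMV (c : Fin r → ℝ) : M *ᵥ (V *ᵥ c) = V *ᵥ (Matrix.diagonal d *ᵥ c) := by
    rw [Matrix.mulVec_mulVec, hd, Matrix.mulVec_mulVec]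
  have hcross (x y : Fin n → ℝ) : x ⬝ᵥ (M *ᵥ y) = y ⬝ᵥ (M *ᵥ x) := by
    rw [Matrix.dotProduct_mulVec, ← Matrix.mulVec_transpose, hM, dotProduct_comm]
  -- the quadratic form of `M` splits along the range of `V` and its complement
  have hsplit (c : Fin r → ℝ) (x : Fin n → ℝ) (hx : Vᵀ *ᵥ x = 0) :
      (V *ᵥ c + x) ⬝ᵥ (M *ᵥ (V *ᵥ c + x)) = c ⬝ᵥ (Matrix.diagonal d *ᵥ c) + x ⬝ᵥ (M *ᵥ x) ∧
      (V *ᵥ c + x) ⬝ᵥ (V *ᵥ c + x) = c ⬝ᵥ c + x ⬝ᵥ x := by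
    have h0 : x ⬝ᵥ (M *ᵥ (V *ᵥ c)) = 0 := by
      rw [hMV]; exact dotProduct_mulVec_of_transpose_mulVec_eq_zero hx _
    have h1 : x ⬝ᵥ (V *ᵥ c) = 0 := dotProduct_mulVec_of_transpose_mulVec_eq_zero hx _
    constructor
    · rw [Matrix.mulVec_add, add_dotProduct, dotProduct_add, dotProduct_add, hcross (V *ᵥ c) x, h0,
        hMV, dotProduct_mulVec_orthonormal hVV]
      ring
    · rw [add_dotProduct, dotProduct_add, dotProduct_add, dotProduct_comm _ x, h1,
        dotProduct_mulVec_orthonormal hVV]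
      ring
  refine ⟨hVV, d, hd, fun i => ?_, fun x hx => ?_⟩
  · -- a vector in the range of `U` orthogonal to all leading eigenvectors but the `i`-th
    obtain ⟨z, hz0, hz⟩ := exists_ne_zero_mulVec_eq_zero
      (α := {j : Fin r // j ≠ i}) (β := Fin r) (Fintype.card_subtype_lt (x := i) (by simp))
      ((Vᵀ * U).submatrix Subtype.val id)
    set y := U *ᵥ z with hy
    set c : Fin r → ℝ := Vᵀ *ᵥ y with hc
    have hcj (j : Fin r) (hj : j ≠ i) : c j = 0 := by
      have := congrFun hz ⟨j, hj⟩
      rw [hc, hy, Matrix.mulVec_mulVec]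
      exact this
    have hx : Vᵀ *ᵥ (y - V *ᵥ c) = 0 := by
      rw [Matrix.mulVec_sub, Matrix.mulVec_mulVec _ Vᵀ V, hVV, Matrix.one_mulVec, sub_self]
    obtain ⟨h1, h2⟩ := hsplit c _ hx
    rw [add_sub_cancel] at h1 h2
    have h3 := hlead _ hx i
    have h4 : c ⬝ᵥ (Matrix.diagonal d *ᵥ c) = d i * (c ⬝ᵥ c) := by
      rw [dotProduct, dotProduct, Finset.sum_eq_single i, Finset.sum_eq_single i,
        Matrix.mulVec_diagonal]
      · ring
      · intro j _ hj; simp [hcj j hj]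
      · simp
      · intro j _ hj; simp [hcj j hj]
      · simp
    have h5 := abs_le.mp (hMform y)
    have h6 : ℓ * (z ⬝ᵥ z) ≤ y ⬝ᵥ (A *ᵥ y) := hA z
    have h7 : y ⬝ᵥ y = z ⬝ᵥ z := dotProduct_mulVec_orthonormal hU z z
    have h8 := dotProduct_self_pos hz0
    rw [← h7] at h8
    have : (ℓ - e) * (y ⬝ᵥ y) ≤ d i * (y ⬝ᵥ y) := by
      rw [← h7] at h6
      have h9 : d i * (y ⬝ᵥ y) =
          d i * (c ⬝ᵥ c) + d i * ((y - V *ᵥ c) ⬝ᵥ (y - V *ᵥ c)) := by rw [h2]; ring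
      linarith [h5.1]
    exact le_of_mul_le_mul_right this h8
  · by_cases hx0 : x = 0
    · simp [hx0]
    -- a vector orthogonal to `U` in the span of `x` and the leading eigenvectors
    obtain ⟨z, hz0, hz⟩ := exists_ne_zero_mulVec_eq_zero (α := Fin r) (β := Fin r ⊕ Unit)
      (by simp) (Matrix.fromCols (Uᵀ * V) (Matrix.replicateCol Unit (Uᵀ *ᵥ x)))
    set c : Fin r → ℝ := fun i => z (Sum.inl i) with hc
    set t : ℝ := z (Sum.inr ()) with ht
    have hUy : Uᵀ *ᵥ (V *ᵥ c + t • x) = 0 := by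
      rw [Matrix.fromCols_mulVec] at hz
      rw [Matrix.mulVec_add, Matrix.mulVec_mulVec, Matrix.mulVec_smul, ← hz]
      congr 1
      ext i
      simp [Matrix.mulVec, dotProduct, Matrix.replicateCol, ht, mul_comm]
    have htx : Vᵀ *ᵥ (t • x) = 0 := by rw [Matrix.mulVec_smul, hx, smul_zero]
    obtain ⟨h1, h2⟩ := hsplit c _ htx
    have h3 := abs_le.mp (hMform (V *ᵥ c + t • x))
    have h4 := hA0 _ hUy
    have hX := dotProduct_self_pos hx0
    have h5 : (x ⬝ᵥ (M *ᵥ x)) * (c ⬝ᵥ c) ≤ (c ⬝ᵥ (Matrix.diagonal d *ᵥ c)) * (x ⬝ᵥ x) := by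
      have e1 : c ⬝ᵥ c = ∑ i, c i * c i := rfl
      have e2 : c ⬝ᵥ (Matrix.diagonal d *ᵥ c) = ∑ i, c i * (Matrix.diagonal d *ᵥ c) i := rfl
      rw [e1, e2, Finset.mul_sum, Finset.sum_mul]
      refine Finset.sum_le_sum fun i _ => ?_
      rw [Matrix.mulVec_diagonal]
      have := mul_le_mul_of_nonneg_right (hlead x hx i) (mul_self_nonneg (c i))
      linarith
    have h6 : 0 < c ⬝ᵥ c + t ^ 2 * (x ⬝ᵥ x) := by
      by_cases hc0 : c = 0
      · have : t ≠ 0 := by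
          intro h
          apply hz0
          ext i
          rcases i with i | i
          · exact congrFun hc0 i
          · exact h
        have : 0 < t ^ 2 := by positivity
        rw [hc0]; simp only [dotProduct_zero, zero_add]; positivity
      · have := dotProduct_self_pos hc0
        positivity
    have e1 : (t • x) ⬝ᵥ (M *ᵥ (t • x)) = t ^ 2 * (x ⬝ᵥ (M *ᵥ x)) := by
      rw [Matrix.mulVec_smul, smul_dotProduct, dotProduct_smul, smul_eq_mul, smul_eq_mul]; ring
    have e2 : (t • x) ⬝ᵥ (t • x) = t ^ 2 * (x ⬝ᵥ x) := by
      rw [smul_dotProduct, dotProduct_smul, smul_eq_mul, smul_eq_mul]; ring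
    rw [e1] at h1
    rw [e2] at h2
    rw [h1, h2] at h3
    have : (x ⬝ᵥ (M *ᵥ x)) * (c ⬝ᵥ c + t ^ 2 * (x ⬝ᵥ x)) ≤
        (e * (x ⬝ᵥ x)) * (c ⬝ᵥ c + t ^ 2 * (x ⬝ᵥ x)) := by
      have h7 : c ⬝ᵥ (Matrix.diagonal d *ᵥ c) + t ^ 2 * (x ⬝ᵥ (M *ᵥ x)) ≤
        e * (c ⬝ᵥ c + t ^ 2 * (x ⬝ᵥ x)) := by linarith
      have h8 := mul_le_mul_of_nonneg_right h7 hX.le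
      nlinarith
    exact le_of_mul_le_mul_right this h6

/-- The Davis–Kahan argument for a single eigenvector `w` of a matrix `M'`: its component
orthogonal to the leading eigenvectors of `M`. -/
theorem IsGapEigenvectors.mul_vn_sub_le {M M' : Matrix (Fin n) (Fin n) ℝ}
    {V : Matrix (Fin n) (Fin r) ℝ} {a b c d : ℝ} (hV : IsGapEigenvectors M V c b)
    {w : Fin n → ℝ} (hw : M' *ᵥ w = d • w) (hd : a ≤ d) :
    (a - b) * vn (w - V *ᵥ (Vᵀ *ᵥ w)) ≤ vn ((M' - M) *ᵥ w) := by
  obtain ⟨hVV, D, hD, -, hb⟩ := hV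
  set x := w - V *ᵥ (Vᵀ *ᵥ w) with hxdef
  have hx : Vᵀ *ᵥ x = 0 := by
    rw [hxdef, Matrix.mulVec_sub, Matrix.mulVec_mulVec, hVV, Matrix.one_mulVec, sub_self]
  have h1 : x ⬝ᵥ w = x ⬝ᵥ x := by
    conv_rhs => rw [hxdef]
    rw [← hxdef, dotProduct_sub, dotProduct_mulVec_of_transpose_mulVec_eq_zero hx, sub_zero]
  have h2 : x ⬝ᵥ (M *ᵥ x) = x ⬝ᵥ (M *ᵥ w) := by
    conv_lhs => rw [hxdef]
    rw [← hxdef, Matrix.mulVec_sub, dotProduct_sub, Matrix.mulVec_mulVec _ M V, hD,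
      ← Matrix.mulVec_mulVec, dotProduct_mulVec_of_transpose_mulVec_eq_zero hx, sub_zero]
  have h3 : x ⬝ᵥ ((M' - M) *ᵥ w) = d * (x ⬝ᵥ x) - x ⬝ᵥ (M *ᵥ x) := by
    rw [Matrix.sub_mulVec, dotProduct_sub, hw, dotProduct_smul, h1, h2, smul_eq_mul]
  have h4 := hb x hx
  have h5 := dotProduct_le_vn x ((M' - M) *ᵥ w)
  have h6 := vn_sq x
  rcases (vn_nonneg x).eq_or_lt with h0 | h0
  · rw [← h0, mul_zero]; exact vn_nonneg _
  · refine le_of_mul_le_mul_right ?_ h0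
    rw [← h6] at h3 h4
    nlinarith [sq_nonneg (vn x)]

/-- The Davis–Kahan theorem for spectral projections, in Frobenius norm. -/
theorem IsGapEigenvectors.frobNorm_sub_le {M M' : Matrix (Fin n) (Fin n) ℝ}
    {V V' : Matrix (Fin n) (Fin r) ℝ} {a a' b b' : ℝ} (hV : IsGapEigenvectors M V a' b)
    (hV' : IsGapEigenvectors M' V' a b') (hab : b < a) :
    (a - b) * frobNorm (V * Vᵀ - V' * V'ᵀ) ≤ 2 * frobNorm ((M' - M) * V') := by
  set X := V' - V * (Vᵀ * V') with hX
  have hXle : (a - b) * frobNorm X ≤ frobNorm ((M' - M) * V') := by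
    obtain ⟨-, d, hd, hda, -⟩ := hV'
    refine le_of_sq_le_sq ?_ (frobNorm_nonneg _)
    rw [mul_pow, ← frobNorm_transpose X, ← frobNorm_transpose ((M' - M) * V'), frobNorm_sq,
      frobNorm_sq, Finset.mul_sum]
    refine Finset.sum_le_sum fun j _ => ?_
    rw [← mul_pow]
    have hcol : M' *ᵥ (V'.col j) = d j • V'.col j := by
      ext i
      have := congrFun (congrFun hd i) j
      rw [Matrix.mul_diagonal] at this
      simp only [Pi.smul_apply, smul_eq_mul, Matrix.col_apply]
      rw [mul_comm, ← this]
      rfl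
    have := hV.mul_vn_sub_le hcol (hda j)
    refine pow_le_pow_left₀ (mul_nonneg (by linarith) (vn_nonneg _)) ?_ 2
    exact this
  have hsq : frobNorm (V * Vᵀ - V' * V'ᵀ) ^ 2 = 2 * frobNorm X ^ 2 := by
    have hVV := hV.1
    have hVV' := hV'.1
    have t1 : (V * Vᵀ).trace = r := by rw [Matrix.trace_mul_comm, hVV]; simp
    have t2 : (V' * V'ᵀ).trace = r := by rw [Matrix.trace_mul_comm, hVV']; simp
    have p1 : V * Vᵀ * (V * Vᵀ) = V * Vᵀ := by
      rw [Matrix.mul_assoc, ← Matrix.mul_assoc Vᵀ, hVV, Matrix.one_mul]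
    have p2 : V' * V'ᵀ * (V' * V'ᵀ) = V' * V'ᵀ := by
      rw [Matrix.mul_assoc, ← Matrix.mul_assoc V'ᵀ, hVV', Matrix.one_mul]
    have e1 : frobNorm (V * Vᵀ - V' * V'ᵀ) ^ 2 = 2 * r - 2 * (V * Vᵀ * (V' * V'ᵀ)).trace := by
      rw [frobNorm_sq_eq_trace]
      have : (V * Vᵀ - V' * V'ᵀ)ᵀ * (V * Vᵀ - V' * V'ᵀ)
          = V * Vᵀ - V * Vᵀ * (V' * V'ᵀ) - V' * V'ᵀ * (V * Vᵀ) + V' * V'ᵀ := by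
        rw [Matrix.transpose_sub, Matrix.transpose_mul, Matrix.transpose_mul,
          Matrix.transpose_transpose, Matrix.transpose_transpose, sub_mul, mul_sub, mul_sub, p1, p2]
        abel
      rw [this, Matrix.trace_add, Matrix.trace_sub, Matrix.trace_sub, t1, t2,
        Matrix.trace_mul_comm (V' * V'ᵀ)]
      ring
    have e2 : frobNorm X ^ 2 = r - (V * Vᵀ * (V' * V'ᵀ)).trace := by
      rw [frobNorm_sq_eq_trace]
      have : Xᵀ * X = 1 - V'ᵀ * (V * Vᵀ * V') := by
        rw [hX, Matrix.transpose_sub, Matrix.transpose_mul, Matrix.transpose_mul,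
          Matrix.transpose_transpose, Matrix.sub_mul, Matrix.mul_sub, Matrix.mul_sub, hVV']
        have : V'ᵀ * V * Vᵀ * (V * (Vᵀ * V')) = V'ᵀ * V * (Vᵀ * V) * (Vᵀ * V') := by
          simp only [Matrix.mul_assoc]
        rw [this, hVV]
        simp only [Matrix.mul_assoc, Matrix.mul_one]
        abel
      rw [this, Matrix.trace_sub, Matrix.trace_mul_comm V'ᵀ, Matrix.mul_assoc (V * Vᵀ)]
      simp
    rw [e1, e2]; ring
  have h2 : frobNorm (V * Vᵀ - V' * V'ᵀ) ≤ 2 * frobNorm X := by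
    refine le_of_sq_le_sq ?_ (by have := frobNorm_nonneg X; positivity)
    rw [hsq]; nlinarith [sq_nonneg (frobNorm X)]
  nlinarith [sub_pos.mpr hab]

/-- The spectral theorem, with the eigenvalues in decreasing order. -/
theorem exists_isLeadingEigenvectors {M : Matrix (Fin n) (Fin n) ℝ} (hM : Mᵀ = M) (hr : r ≤ n) :
    ∃ V : Matrix (Fin n) (Fin r) ℝ, IsLeadingEigenvectors M V := by
  have hH : M.IsHermitian := by
    rw [Matrix.IsHermitian, Matrix.conjTranspose_eq_transpose_of_trivial, hM]
  have hS : (Matrix.toEuclideanLin M).IsSymmetric := Matrix.isSymmetric_toEuclideanLin_iff.mpr hH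
  have hn : Module.finrank ℝ (EuclideanSpace ℝ (Fin n)) = n := finrank_euclideanSpace_fin
  set b := hS.eigenvectorBasis hn with hb
  set e := hS.eigenvalues hn with he
  have hanti : Antitone e := hS.eigenvalues_antitone hn
  have hap (k : Fin n) : M *ᵥ (b k).ofLp = e k • (b k).ofLp :=
    congrArg WithLp.ofLp (hS.apply_eigenvectorBasis hn k)
  have hinner (x y : EuclideanSpace ℝ (Fin n)) : inner ℝ x y = x.ofLp ⬝ᵥ y.ofLp := by
    rw [EuclideanSpace.inner_eq_star_dotProduct, dotProduct_comm]; rfl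
  let V : Matrix (Fin n) (Fin r) ℝ := Matrix.of fun i j => b (Fin.castLE hr j) i
  refine ⟨V, ?_, fun j => e (Fin.castLE hr j), ?_, fun x hx i => ?_⟩
  · ext i j
    have h1 : (Vᵀ * V) i j = inner ℝ (b (Fin.castLE hr i)) (b (Fin.castLE hr j)) := by
      rw [hinner]; rfl
    rw [h1, orthonormal_iff_ite.mp b.orthonormal, Matrix.one_apply]
    simp [Fin.castLE_inj]
  · ext i j
    rw [Matrix.mul_diagonal]
    have := congrFun (hap (Fin.castLE hr j)) i
    rw [Pi.smul_apply, smul_eq_mul, mul_comm] at this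
    exact this
  · set y : EuclideanSpace ℝ (Fin n) := WithLp.toLp 2 x with hy
    have h1 : x ⬝ᵥ x = ∑ k, inner ℝ y (b k) * inner ℝ (b k) y := by
      rw [b.sum_inner_mul_inner, hinner]
    have h2 : x ⬝ᵥ (M *ᵥ x) = ∑ k, inner ℝ y (b k) * inner ℝ (b k) (WithLp.toLp 2 (M *ᵥ x)) := by
      rw [b.sum_inner_mul_inner, hinner]
    have h3 (k : Fin n) : inner ℝ (b k) (WithLp.toLp 2 (M *ᵥ x)) = e k * inner ℝ (b k) y := by
      rw [hinner, hinner]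
      change (b k).ofLp ⬝ᵥ (M *ᵥ x) = e k * ((b k).ofLp ⬝ᵥ x)
      rw [Matrix.dotProduct_mulVec, ← Matrix.mulVec_transpose, hM, hap, smul_dotProduct,
        smul_eq_mul]
    rw [h1, h2, Finset.mul_sum]
    refine Finset.sum_le_sum fun k _ => ?_
    rw [h3, real_inner_comm y (b k)]
    by_cases hk : (k : ℕ) < r
    · have h4 : inner ℝ (b k) y = 0 := by
        rw [hinner]
        exact congrFun hx ⟨k, hk⟩
      rw [real_inner_comm, h4]; simp
    · have h5 : e k ≤ e (Fin.castLE hr i) := by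
        refine hanti ?_
        rw [Fin.le_def, Fin.val_castLE]
        have := i.2
        omega
      have h6 := mul_self_nonneg (inner ℝ y (b k))
      nlinarith

end Gap

/-! ### Orthogonal alignment of two frames -/

section Align

variable {n r : ℕ}

/-- The minimum over the compact orthogonal group is attained. -/
theorem exists_isAligning (U V : Matrix (Fin n) (Fin r) ℝ) : ∃ W, IsAligning U V W := by
  have hK : IsCompact {W : Matrix (Fin r) (Fin r) ℝ | W ∈ Matrix.orthogonalGroup (Fin r) ℝ} := by
    have hcomp : IsCompact {W : Matrix (Fin r) (Fin r) ℝ | ∀ i j, W i j ∈ Set.Icc (-1 : ℝ) 1} := by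
      have h : IsCompact {W : Fin r → Fin r → ℝ | ∀ i j, W i j ∈ Set.Icc (-1 : ℝ) 1} := by
        convert isCompact_univ_pi fun _ : Fin r =>
          isCompact_univ_pi fun _ : Fin r => isCompact_Icc (a := (-1 : ℝ)) (b := 1) using 1
        ext W
        simp only [Set.mem_ofPred_eq, Set.mem_pi, Set.mem_univ, true_imp_iff]
      exact h
    refine hcomp.of_isClosed_subset ?_ fun W hW i j => ?_
    · have : {W : Matrix (Fin r) (Fin r) ℝ | W ∈ Matrix.orthogonalGroup (Fin r) ℝ} =
          {W | W * Wᵀ = 1} := by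
        ext W
        simp only [Set.mem_ofPred_eq, Matrix.mem_orthogonalGroup_iff]
      rw [this]
      exact isClosed_eq (by fun_prop) continuous_const
    · have h1 : Wᵀ * W = 1 := by
        have := (Matrix.mem_orthogonalGroup_iff' (Fin r) ℝ).mp hW
        exact this
      exact abs_le.mp ((abs_apply_le_norm W i j).trans (norm_le_one_of_orthonormal h1))
  have hcont : Continuous fun W : Matrix (Fin r) (Fin r) ℝ => frobNorm (V - U * W) := by
    unfold frobNorm
    fun_prop
  obtain ⟨W, hW, hmin⟩ := hK.exists_isMinOn ⟨1, one_mem (Matrix.orthogonalGroup (Fin r) ℝ)⟩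
    hcont.continuousOn
  exact ⟨W, hW, fun W' hW' => hmin hW'⟩

/-- The polar decomposition of a square matrix that nearly preserves lengths; the positive factor is
given in diagonalised form. -/
theorem exists_polar {S : Matrix (Fin r) (Fin r) ℝ} {s : ℝ} (hs : s < 1)
    (hlow : ∀ x, (1 - s) * (x ⬝ᵥ x) ≤ (S *ᵥ x) ⬝ᵥ (S *ᵥ x))
    (hup : ∀ x, (S *ᵥ x) ⬝ᵥ (S *ᵥ x) ≤ x ⬝ᵥ x) :
    ∃ (W O : Matrix (Fin r) (Fin r) ℝ) (h : Fin r → ℝ), Wᵀ * W = 1 ∧ Oᵀ * O = 1 ∧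
      (∀ i, 1 - s ≤ h i ∧ h i ≤ 1) ∧ S = W * O * Matrix.diagonal h * Oᵀ := by
  have hH : (Sᵀ * S).IsHermitian := by
    rw [← Matrix.conjTranspose_eq_transpose_of_trivial]
    exact Matrix.isHermitian_conjTranspose_mul_self S
  set O : Matrix (Fin r) (Fin r) ℝ := (hH.eigenvectorUnitary : Matrix (Fin r) (Fin r) ℝ) with hO
  set d : Fin r → ℝ := hH.eigenvalues with hd
  have hOO : Oᵀ * O = 1 := by
    have := Matrix.mem_unitaryGroup_iff'.mp hH.eigenvectorUnitary.2
    exact this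
  have hOO' : O * Oᵀ = 1 := mul_eq_one_comm.mp hOO
  have hspec : Sᵀ * S = O * Matrix.diagonal d * Oᵀ := by
    have := hH.spectral_theorem
    rw [Unitary.conjStarAlgAut_apply] at this
    exact this
  have hB : (S * O)ᵀ * (S * O) = Matrix.diagonal d := by
    rw [Matrix.transpose_mul, Matrix.mul_assoc, ← Matrix.mul_assoc Sᵀ, hspec]
    rw [Matrix.mul_assoc _ Oᵀ O, hOO, Matrix.mul_one, ← Matrix.mul_assoc, hOO, Matrix.one_mul]
  have hdi (i : Fin r) : 1 - s ≤ d i ∧ d i ≤ 1 := by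
    have e1 : (S *ᵥ (O *ᵥ Pi.single i 1)) ⬝ᵥ (S *ᵥ (O *ᵥ Pi.single i 1)) = d i := by
      rw [Matrix.mulVec_mulVec, Matrix.dotProduct_mulVec, Matrix.vecMul_mulVec, hB]
      simp
    have e2 : (O *ᵥ Pi.single i 1) ⬝ᵥ (O *ᵥ Pi.single i 1) = 1 := by
      rw [dotProduct_mulVec_orthonormal hOO]; simp
    have h1 := hlow (O *ᵥ Pi.single i 1)
    have h2 := hup (O *ᵥ Pi.single i 1)
    rw [e1, e2] at h1 h2
    exact ⟨by linarith, h2⟩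
  have hpos (i : Fin r) : 0 < √(d i) := Real.sqrt_pos.mpr (by linarith [(hdi i).1])
  have hsq (i : Fin r) : √(d i) * √(d i) = d i :=
    Real.mul_self_sqrt (by linarith [(hdi i).1])
  refine ⟨S * O * Matrix.diagonal (fun i => (√(d i))⁻¹) * Oᵀ, O, fun i => √(d i), ?_, hOO,
    fun i => ⟨?_, ?_⟩, ?_⟩
  · have : (S * O * Matrix.diagonal (fun i => (√(d i))⁻¹) * Oᵀ)ᵀ *
        (S * O * Matrix.diagonal (fun i => (√(d i))⁻¹) * Oᵀ) =
        O * (Matrix.diagonal (fun i => (√(d i))⁻¹) * ((S * O)ᵀ * (S * O)) *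
          Matrix.diagonal (fun i => (√(d i))⁻¹)) * Oᵀ := by
      simp only [Matrix.transpose_mul, Matrix.diagonal_transpose, Matrix.transpose_transpose,
        Matrix.mul_assoc]
    rw [this, hB, Matrix.diagonal_mul_diagonal, Matrix.diagonal_mul_diagonal]
    have : (fun i => (√(d i))⁻¹ * d i * (√(d i))⁻¹) = fun _ => (1 : ℝ) := by
      funext i
      have := (hpos i).ne'
      conv_lhs => rw [← hsq i]
      simp only [Real.sqrt_mul_self (Real.sqrt_nonneg _)]
      field_simp
    rw [this, Matrix.diagonal_one, Matrix.mul_one, hOO']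
  · refine Real.le_sqrt_of_sq_le ?_
    have h1 : 0 < 1 - s := by linarith
    have h2 : 1 - s ≤ 1 := (hdi i).1.trans (hdi i).2
    nlinarith [(hdi i).1]
  · exact Real.sqrt_le_one.mpr (hdi i).2
  · have : S * O * Matrix.diagonal (fun i => (√(d i))⁻¹) * Oᵀ * O *
        Matrix.diagonal (fun i => √(d i)) * Oᵀ =
        S * O * (Matrix.diagonal (fun i => (√(d i))⁻¹) * (Oᵀ * O) *
        Matrix.diagonal (fun i => √(d i))) * Oᵀ := by simp only [Matrix.mul_assoc]
    rw [this, hOO, Matrix.mul_one, Matrix.diagonal_mul_diagonal]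
    have : (fun i => (√(d i))⁻¹ * √(d i)) = fun _ => (1 : ℝ) := by
      funext i
      exact inv_mul_cancel₀ (hpos i).ne'
    rw [this, Matrix.diagonal_one, Matrix.mul_one, Matrix.mul_assoc, hOO', Matrix.mul_one]

theorem frobNorm_sub_mul_sq {U V : Matrix (Fin n) (Fin r) ℝ} (hU : Uᵀ * U = 1) (hV : Vᵀ * V = 1)
    {W : Matrix (Fin r) (Fin r) ℝ} (hW : Wᵀ * W = 1) :
    frobNorm (V - U * W) ^ 2 = 2 * r - 2 * (Wᵀ * (Uᵀ * V)).trace := by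
  rw [frobNorm_sq_eq_trace]
  have : (V - U * W)ᵀ * (V - U * W) =
      Vᵀ * V - (Wᵀ * (Uᵀ * V))ᵀ - Wᵀ * (Uᵀ * V) + Wᵀ * (Uᵀ * U) * W := by
    simp only [Matrix.transpose_sub, Matrix.transpose_mul, Matrix.transpose_transpose,
      Matrix.sub_mul, Matrix.mul_sub, Matrix.mul_assoc]
    abel
  rw [this, hU, hV, Matrix.mul_one, hW]
  simp only [Matrix.trace_add, Matrix.trace_sub, Matrix.trace_transpose, Matrix.trace_one,
    Fintype.card_fin]
  ring

/-- With `X = V - U (Uᵀ V)`, the squared singular values of `Uᵀ V` lie between `1 - ‖X‖ ^ 2` and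
`1`. Its polar factor `W` is thus within `‖X‖ ^ 2` of it, and aligns `U` with `V`, because it
maximises `trace (Wᵀ (Uᵀ V))` over orthogonal matrices. -/
theorem exists_isAligning_norm_sub_le {U V : Matrix (Fin n) (Fin r) ℝ} (hU : Uᵀ * U = 1)
    (hV : Vᵀ * V = 1) (hs : ‖V - U * (Uᵀ * V)‖ < 1) :
    ∃ W, IsAligning U V W ∧ ‖Uᵀ * V - W‖ ≤ ‖V - U * (Uᵀ * V)‖ ^ 2 := by
  set X := V - U * (Uᵀ * V) with hX
  have hpyth (x : Fin r → ℝ) : x ⬝ᵥ x =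
      ((Uᵀ * V) *ᵥ x) ⬝ᵥ ((Uᵀ * V) *ᵥ x) + (X *ᵥ x) ⬝ᵥ (X *ᵥ x) := by
    have hx : Uᵀ *ᵥ (X *ᵥ x) = 0 := by
      rw [hX, Matrix.mulVec_mulVec, Matrix.mul_sub, ← Matrix.mul_assoc, hU, Matrix.one_mul,
        sub_self, Matrix.zero_mulVec]
    have h1 : V *ᵥ x = U *ᵥ ((Uᵀ * V) *ᵥ x) + X *ᵥ x := by
      rw [hX, Matrix.sub_mulVec, Matrix.mulVec_mulVec]; abel
    rw [← dotProduct_mulVec_orthonormal hV x x, h1, add_dotProduct, dotProduct_add, dotProduct_add,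
      dotProduct_comm _ (X *ᵥ x), dotProduct_mulVec_of_transpose_mulVec_eq_zero hx,
      dotProduct_mulVec_orthonormal hU]
    ring
  have hXx (x : Fin r → ℝ) : (X *ᵥ x) ⬝ᵥ (X *ᵥ x) ≤ ‖X‖ ^ 2 * (x ⬝ᵥ x) := by
    rw [← vn_sq, ← vn_sq, ← mul_pow]
    exact pow_le_pow_left₀ (vn_nonneg _) (vn_mulVec_le X x) 2
  have hXx0 (x : Fin r → ℝ) : 0 ≤ (X *ᵥ x) ⬝ᵥ (X *ᵥ x) := by rw [← vn_sq]; positivity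
  obtain ⟨W, O, h, hW, hO, hh, hS⟩ := exists_polar (S := Uᵀ * V) (s := ‖X‖ ^ 2)
    (by nlinarith [norm_nonneg X])
    (fun x => by linarith [hpyth x, hXx x]) (fun x => by linarith [hpyth x, hXx0 x])
  have hOO' : O * Oᵀ = 1 := mul_eq_one_comm.mp hO
  refine ⟨W, ⟨(Matrix.mem_orthogonalGroup_iff' (Fin r) ℝ).mpr hW, fun W' hW' => ?_⟩, ?_⟩
  · have hW'1 : W'ᵀ * W' = 1 := (Matrix.mem_orthogonalGroup_iff' (Fin r) ℝ).mp hW'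
    have hW'2 : W' * W'ᵀ = 1 := mul_eq_one_comm.mp hW'1
    refine le_of_sq_le_sq ?_ (frobNorm_nonneg _)
    rw [frobNorm_sub_mul_sq hU hV hW, frobNorm_sub_mul_sq hU hV hW'1]
    have key (Y : Matrix (Fin r) (Fin r) ℝ) :
        (Yᵀ * (Uᵀ * V)).trace = ∑ i, (Oᵀ * Yᵀ * W * O) i i * h i := by
      rw [hS]
      have : Yᵀ * (W * O * Matrix.diagonal h * Oᵀ) = Yᵀ * W * O * Matrix.diagonal h * Oᵀ := by
        simp only [Matrix.mul_assoc]
      rw [this, Matrix.trace_mul_comm]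
      have : Oᵀ * (Yᵀ * W * O * Matrix.diagonal h) = Oᵀ * Yᵀ * W * O * Matrix.diagonal h := by
        simp only [Matrix.mul_assoc]
      rw [this, Matrix.trace]
      simp [Matrix.mul_diagonal]
    have hQ : (Oᵀ * W'ᵀ * W * O)ᵀ * (Oᵀ * W'ᵀ * W * O) = 1 := by
      have : (Oᵀ * W'ᵀ * W * O)ᵀ * (Oᵀ * W'ᵀ * W * O) =
          Oᵀ * (Wᵀ * (W' * (O * Oᵀ) * W'ᵀ) * W) * O := by
        simp only [Matrix.transpose_mul, Matrix.transpose_transpose, Matrix.mul_assoc]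
      rw [this, hOO', Matrix.mul_one, hW'2, Matrix.mul_one, hW, Matrix.mul_one, hO]
    have h1 : (Wᵀ * (Uᵀ * V)).trace = ∑ i, h i := by
      rw [key, Matrix.mul_assoc Oᵀ, hW, Matrix.mul_one, hO]
      simp
    have h2 : (W'ᵀ * (Uᵀ * V)).trace ≤ ∑ i, h i := by
      rw [key]
      refine Finset.sum_le_sum fun i _ => ?_
      have h3 := (le_abs_self _).trans
        ((abs_apply_le_norm (Oᵀ * W'ᵀ * W * O) i i).trans (norm_le_one_of_orthonormal hQ))
      have h4 : 0 ≤ h i := by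
        have := (hh i).1
        nlinarith [norm_nonneg X]
      nlinarith
    linarith
  · have hWO : W = W * O * Matrix.diagonal (fun _ => 1) * Oᵀ := by
      rw [Matrix.diagonal_one, Matrix.mul_one, Matrix.mul_assoc, hOO', Matrix.mul_one]
    have : Uᵀ * V - W = W * (O * Matrix.diagonal (fun i => h i - 1) * Oᵀ) := by
      conv_lhs => rw [hWO, hS]
      rw [← Matrix.sub_mul, ← Matrix.mul_sub, Matrix.diagonal_sub]
      simp only [Matrix.mul_assoc]
    rw [this]
    have hOn := norm_le_one_of_orthonormal hO
    have hWn := norm_le_one_of_orthonormal hW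
    have hdn : ‖(Matrix.diagonal (fun i => h i - 1) : Matrix (Fin r) (Fin r) ℝ)‖ ≤ ‖X‖ ^ 2 :=
      norm_diagonal_le (by positivity) fun i => by
        rw [abs_le]; constructor <;> [linarith [(hh i).1]; nlinarith [(hh i).2, norm_nonneg X]]
    have hOt : ‖Oᵀ‖ ≤ 1 := by rw [norm_transpose]; exact hOn
    calc ‖W * (O * Matrix.diagonal (fun i => h i - 1) * Oᵀ)‖
        ≤ ‖W‖ * (‖O‖ *
            ‖(Matrix.diagonal (fun i => h i - 1) : Matrix (Fin r) (Fin r) ℝ)‖ * ‖Oᵀ‖) := by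
          refine (Matrix.l2_opNorm_mul _ _).trans (mul_le_mul_of_nonneg_left ?_ (norm_nonneg _))
          refine (Matrix.l2_opNorm_mul _ _).trans (mul_le_mul_of_nonneg_right ?_ (norm_nonneg _))
          exact Matrix.l2_opNorm_mul _ _
      _ ≤ 1 * (1 * ‖X‖ ^ 2 * 1) := by gcongr
      _ = ‖X‖ ^ 2 := by ring

end Align

/-! ### Signal plus noise: the hollowed Gram matrix -/

section Hollow

variable {n : ℕ}

theorem hollow_eq_sub (M : Matrix (Fin n) (Fin n) ℝ) : hollow M = M - Matrix.diagonal M.diag := by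
  ext i j
  by_cases h : i = j
  · subst h; simp [hollow]
  · simp [hollow, h]

theorem hollow_add (M N : Matrix (Fin n) (Fin n) ℝ) : hollow (M + N) = hollow M + hollow N := by
  ext i j
  by_cases h : i = j <;> simp [hollow, h]

theorem hollow_transpose (M : Matrix (Fin n) (Fin n) ℝ) : (hollow M)ᵀ = hollow Mᵀ := by
  ext i j
  by_cases h : i = j
  · simp [hollow, h]
  · simp [hollow, h, Ne.symm h]

theorem norm_hollow_le (M : Matrix (Fin n) (Fin n) ℝ) : ‖hollow M‖ ≤ 2 * ‖M‖ := by
  rw [hollow_eq_sub]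
  have : ‖(Matrix.diagonal M.diag : Matrix (Fin n) (Fin n) ℝ)‖ ≤ ‖M‖ :=
    norm_diagonal_le (norm_nonneg _) fun i => abs_apply_le_norm M i i
  linarith [norm_sub_le M (Matrix.diagonal M.diag)]

theorem vn_row_hollow_le (M : Matrix (Fin n) (Fin n) ℝ) (i : Fin n) :
    vn ((hollow M).row i) ≤ vn (M.row i) := by
  refine vn_le_of_abs_le fun j => ?_
  simp only [Matrix.row_apply, hollow, Matrix.of_apply]
  split_ifs <;> simp

end Hollow

/-- The orthonormal columns of `U` span the column space of the signal matrix `T`, on which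
`T * Tᵀ` is at least `L ^ 2`: the nonzero singular values of `T` are at least `L`. -/
structure IsSignal {n r : ℕ} {c : Type*} [Fintype c] (T : Matrix (Fin n) c ℝ)
    (U : Matrix (Fin n) (Fin r) ℝ) (L : ℝ) : Prop where
  orthonormal : Uᵀ * U = 1
  proj_mul : U * (Uᵀ * T) = T
  le_form : ∀ z, L ^ 2 * (z ⬝ᵥ z) ≤ (U *ᵥ z) ⬝ᵥ ((T * Tᵀ) *ᵥ (U *ᵥ z))

/-- The hollowed Gram matrix of the noisy signal. -/
def gram {n : ℕ} {c : Type*} [Fintype c] (T Z : Matrix (Fin n) c ℝ) : Matrix (Fin n) (Fin n) ℝ :=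
  hollow ((T + Z) * (T + Z)ᵀ)

/-- The noise `Z` is small compared with the signal strength: `D`, `τ` and `γ` bound the deleted
diagonal, the cross term and the hollowed Gram matrix of the noise. -/
structure SmallNoise {n : ℕ} {c : Type*} [Fintype c] [DecidableEq c] (T Z : Matrix (Fin n) c ℝ)
    (D τ γ : ℝ) : Prop where
  diag_le : ‖(Matrix.diagonal (T * Tᵀ).diag : Matrix (Fin n) (Fin n) ℝ)‖ ≤ D
  cross_le : ‖T * Zᵀ‖ ≤ τ
  noise_le : ‖hollow (Z * Zᵀ)‖ ≤ γ

section Rows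

variable {n r : ℕ} {c : Type*} [Fintype c] [DecidableEq c] {T Z : Matrix (Fin n) c ℝ}
  {U V : Matrix (Fin n) (Fin r) ℝ} {L D τ γ : ℝ}

theorem gram_transpose (T Z : Matrix (Fin n) c ℝ) : (gram T Z)ᵀ = gram T Z := by
  rw [gram, hollow_transpose, Matrix.transpose_mul, Matrix.transpose_transpose]

theorem gram_sub (T Z : Matrix (Fin n) c ℝ) : gram T Z - T * Tᵀ =
    hollow (T * Zᵀ) + hollow (Z * (T + Z)ᵀ) - Matrix.diagonal (T * Tᵀ).diag := by
  have : (T + Z) * (T + Z)ᵀ = T * Tᵀ + T * Zᵀ + Z * (T + Z)ᵀ := by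
    rw [Matrix.add_mul, Matrix.transpose_add, Matrix.mul_add]
  rw [gram, this, hollow_add, hollow_add, hollow_eq_sub (T * Tᵀ)]
  abel

theorem SmallNoise.norm_hollow_mul_le (h : SmallNoise T Z D τ γ) :
    ‖hollow (Z * (T + Z)ᵀ)‖ ≤ 2 * τ + γ := by
  rw [Matrix.transpose_add, Matrix.mul_add, hollow_add]
  refine (norm_add_le _ _).trans (add_le_add ?_ h.noise_le)
  refine (norm_hollow_le _).trans ?_
  rw [← norm_transpose, Matrix.transpose_mul, Matrix.transpose_transpose]
  linarith [h.cross_le]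

theorem SmallNoise.norm_gram_sub_le (h : SmallNoise T Z D τ γ) :
    ‖gram T Z - T * Tᵀ‖ ≤ D + 4 * τ + γ := by
  rw [gram_sub]
  have h1 := norm_sub_le (hollow (T * Zᵀ) + hollow (Z * (T + Z)ᵀ))
    (Matrix.diagonal (T * Tᵀ).diag : Matrix (Fin n) (Fin n) ℝ)
  have h2 := norm_add_le (hollow (T * Zᵀ)) (hollow (Z * (T + Z)ᵀ))
  have h3 := norm_hollow_le (T * Zᵀ)
  linarith [h.norm_hollow_mul_le, h.cross_le, h.diag_le]

theorem IsSignal.isGapEigenvectors (hT : IsSignal T U L) (h : SmallNoise T Z D τ γ)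
    (hV : IsLeadingEigenvectors (gram T Z) V) :
    IsGapEigenvectors (gram T Z) V (L ^ 2 - (D + 4 * τ + γ)) (D + 4 * τ + γ) := by
  refine hV.isGapEigenvectors (gram_transpose T Z) hT.orthonormal hT.le_form (fun x hx => ?_)
    h.norm_gram_sub_le
  have : Tᵀ *ᵥ x = 0 := by
    rw [← hT.proj_mul, Matrix.transpose_mul, ← Matrix.mulVec_mulVec, hx, Matrix.mulVec_zero]
  rw [← Matrix.mulVec_mulVec, this, Matrix.mulVec_zero, dotProduct_zero]

theorem vn_vecMul_of_norm_le_one {m l : Type*} [Fintype m] [Fintype l] [DecidableEq m]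
    [DecidableEq l] {A : Matrix m l ℝ} (hA : ‖A‖ ≤ 1) (x : m → ℝ) : vn (x ᵥ* A) ≤ vn x :=
  (vn_vecMul_le x A).trans (mul_le_of_le_one_right (vn_nonneg _) hA)

theorem row_mul {m l k : Type*} [Fintype m] (A : Matrix k m ℝ) (B : Matrix m l ℝ)
    (i : k) : (A * B).row i = A.row i ᵥ* B := rfl

theorem norm_mul_le_of_norm_le_one {m l k : Type*} [Fintype m] [Fintype l] [DecidableEq m]
    [DecidableEq l] [Fintype k] [DecidableEq k] {A : Matrix m l ℝ} (hA : ‖A‖ ≤ 1)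
    (B : Matrix l k ℝ) :
    ‖A * B‖ ≤ ‖B‖ :=
  (Matrix.l2_opNorm_mul A B).trans (mul_le_of_le_one_left (norm_nonneg _) hA)

theorem IsSignal.compl_mul_diagonal (hT : IsSignal T U L) {d : Fin r → ℝ}
    (hd : gram T Z * V = V * Matrix.diagonal d) :
    (V - U * (Uᵀ * V)) * Matrix.diagonal d =
      (gram T Z - T * Tᵀ) * V - U * (Uᵀ * ((gram T Z - T * Tᵀ) * V)) := by
  have h1 : U * (Uᵀ * (T * Tᵀ * V)) = T * Tᵀ * V := by
    calc U * (Uᵀ * (T * Tᵀ * V)) = U * (Uᵀ * T) * (Tᵀ * V) := by simp only [Matrix.mul_assoc]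
      _ = T * Tᵀ * V := by rw [hT.proj_mul, Matrix.mul_assoc]
  calc (V - U * (Uᵀ * V)) * Matrix.diagonal d
      = V * Matrix.diagonal d - U * (Uᵀ * (V * Matrix.diagonal d)) := by
        simp only [Matrix.sub_mul, Matrix.mul_assoc]
    _ = gram T Z * V - U * (Uᵀ * (gram T Z * V)) := by rw [hd]
    _ = _ := by
        rw [Matrix.sub_mul, Matrix.mul_sub, Matrix.mul_sub, h1]; abel

/-- The spectral norm of the component of the estimated singular vectors orthogonal to `U`. -/
theorem IsSignal.norm_compl_le (hT : IsSignal T U L) (hL : 0 < L) (h : SmallNoise T Z D τ γ) {b : ℝ}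
    (hV : IsGapEigenvectors (gram T Z) V (L ^ 2 / 2) b) :
    ‖V - U * (Uᵀ * V)‖ ≤ 2 / L ^ 2 * (D + 4 * τ + γ) := by
  obtain ⟨hVV, d, hd, hda, -⟩ := hV
  have hL2 : 0 < L ^ 2 := by positivity
  have hpos (i : Fin r) : 0 < d i := by linarith [hda i]
  set F := (gram T Z - T * Tᵀ) * V with hF
  have h1 := hT.compl_mul_diagonal hd
  have h2 : V - U * (Uᵀ * V) = (F - U * (Uᵀ * F)) * Matrix.diagonal (fun i => (d i)⁻¹) := by
    rw [← h1, Matrix.mul_assoc, Matrix.diagonal_mul_diagonal]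
    have : (fun i => d i * (d i)⁻¹) = fun _ => (1 : ℝ) := by
      funext i; exact mul_inv_cancel₀ (hpos i).ne'
    rw [this, Matrix.diagonal_one, Matrix.mul_one]
  have h3 : ‖F - U * (Uᵀ * F)‖ ≤ ‖F‖ := by
    refine norm_le_of_vn_mulVec_le (norm_nonneg _) fun x => ?_
    refine le_trans ?_ (vn_mulVec_le F x)
    set y := F *ᵥ x with hy
    have e : (F - U * (Uᵀ * F)) *ᵥ x = y - U *ᵥ (Uᵀ *ᵥ y) := by
      rw [Matrix.sub_mulVec, hy, Matrix.mulVec_mulVec, Matrix.mulVec_mulVec, Matrix.mul_assoc]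
    rw [e]
    refine le_of_sq_le_sq ?_ (vn_nonneg _)
    rw [vn_sq, vn_sq]
    have hx : Uᵀ *ᵥ (y - U *ᵥ (Uᵀ *ᵥ y)) = 0 := by
      rw [Matrix.mulVec_sub, Matrix.mulVec_mulVec _ Uᵀ U, hT.orthonormal, Matrix.one_mulVec,
        sub_self]
    have e2 : y ⬝ᵥ y = (y - U *ᵥ (Uᵀ *ᵥ y)) ⬝ᵥ (y - U *ᵥ (Uᵀ *ᵥ y))
        + (U *ᵥ (Uᵀ *ᵥ y)) ⬝ᵥ (U *ᵥ (Uᵀ *ᵥ y)) := by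
      have e3 := dotProduct_mulVec_of_transpose_mulVec_eq_zero hx (Uᵀ *ᵥ y)
      rw [sub_dotProduct] at e3
      rw [sub_dotProduct, dotProduct_sub, dotProduct_sub, dotProduct_comm (U *ᵥ (Uᵀ *ᵥ y)) y]
      linarith
    rw [e2]
    have : 0 ≤ (U *ᵥ (Uᵀ *ᵥ y)) ⬝ᵥ (U *ᵥ (Uᵀ *ᵥ y)) := by rw [← vn_sq]; positivity
    linarith
  have h4 : ‖F‖ ≤ D + 4 * τ + γ :=
    (Matrix.l2_opNorm_mul _ _).trans ((mul_le_of_le_one_right (norm_nonneg _)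
      (norm_le_one_of_orthonormal hVV)).trans h.norm_gram_sub_le)
  have h5 : ‖(Matrix.diagonal (fun i => (d i)⁻¹) : Matrix (Fin r) (Fin r) ℝ)‖ ≤ 2 / L ^ 2 := by
    refine norm_diagonal_le (by positivity) fun i => ?_
    rw [abs_of_pos (inv_pos.mpr (hpos i)), inv_le_comm₀ (hpos i) (by positivity), inv_div]
    exact hda i
  rw [h2]
  refine (Matrix.l2_opNorm_mul _ _).trans ?_
  rw [mul_comm]
  exact mul_le_mul h5 (h3.trans h4) (norm_nonneg _) (by positivity)

/-- One row of the component of the estimated singular vectors orthogonal to `U`. All the noise of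
that row sits in the term `vn (_ ᵥ* V)`. -/
theorem IsSignal.vn_row_compl_le (hT : IsSignal T U L) (hL : 0 < L) (h : SmallNoise T Z D τ γ)
    {b : ℝ} (hV : IsGapEigenvectors (gram T Z) V (L ^ 2 / 2) b) (m : Fin n) :
    L ^ 2 / 2 * vn ((V - U * (Uᵀ * V)).row m) ≤
      vn (U.row m) * τ + vn ((hollow (Z * (T + Z)ᵀ)).row m ᵥ* V) + D * vn (V.row m) +
        vn (U.row m) * (D + 4 * τ + γ) := by
  obtain ⟨hVV, d, hd, hda, -⟩ := hV
  have hV1 := norm_le_one_of_orthonormal hVV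
  have hU1 := norm_le_one_of_orthonormal hT.orthonormal
  have hL2 : 0 < L ^ 2 := by positivity
  set Y := V - U * (Uᵀ * V) with hY
  have hYd := hT.compl_mul_diagonal hd
  rw [← hY] at hYd
  set E := gram T Z - T * Tᵀ with hE
  have h1 : L ^ 2 / 2 * vn (Y.row m) ≤ vn ((Y * Matrix.diagonal d).row m) := by
    rw [← abs_of_pos (show 0 < L ^ 2 / 2 by positivity), ← vn_smul]
    refine vn_le_of_abs_le fun i => ?_
    have e : (Y * Matrix.diagonal d).row m i = d i * Y.row m i := by
      simp only [Matrix.row_apply, Matrix.mul_diagonal]; ring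
    rw [e, Pi.smul_apply, smul_eq_mul, abs_mul, abs_mul]
    refine mul_le_mul_of_nonneg_right ?_ (abs_nonneg _)
    rw [abs_of_pos (show 0 < L ^ 2 / 2 by positivity)]
    exact (hda i).trans (le_abs_self _)
  have h2 : (Y * Matrix.diagonal d).row m = (hollow (T * Zᵀ)).row m ᵥ* V +
      (hollow (Z * (T + Z)ᵀ)).row m ᵥ* V - (T * Tᵀ) m m • V.row m -
        U.row m ᵥ* (Uᵀ * (E * V)) := by
    rw [hYd]
    have e1 : (E * V).row m = (hollow (T * Zᵀ)).row m ᵥ* V +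
      (hollow (Z * (T + Z)ᵀ)).row m ᵥ* V - (T * Tᵀ) m m • V.row m := by
      have e2 : E * V = hollow (T * Zᵀ) * V + hollow (Z * (T + Z)ᵀ) * V -
          Matrix.diagonal (T * Tᵀ).diag * V := by
        rw [hE, gram_sub, Matrix.sub_mul, Matrix.add_mul]
      rw [e2]
      ext i
      simp only [Matrix.row_apply, Matrix.sub_apply, Matrix.add_apply, Matrix.diagonal_mul,
        Pi.sub_apply, Pi.add_apply, Pi.smul_apply, smul_eq_mul, Matrix.diag_apply]
      rfl
    rw [← e1, ← row_mul]
    rfl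
  have t1 : vn ((hollow (T * Zᵀ)).row m ᵥ* V) ≤ vn (U.row m) * τ := by
    refine (vn_vecMul_of_norm_le_one hV1 _).trans ((vn_row_hollow_le _ m).trans ?_)
    have : T * Zᵀ = U * (Uᵀ * (T * Zᵀ)) := by
      conv_lhs => rw [← hT.proj_mul]
      simp only [Matrix.mul_assoc]
    rw [this, row_mul]
    refine (vn_vecMul_le _ _).trans (mul_le_mul_of_nonneg_left ?_ (vn_nonneg _))
    exact (norm_mul_le_of_norm_le_one (by rw [norm_transpose]; exact hU1) _).trans h.cross_le
  have t2 : vn ((T * Tᵀ) m m • V.row m) ≤ D * vn (V.row m) := by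
    rw [vn_smul]
    refine mul_le_mul_of_nonneg_right ?_ (vn_nonneg _)
    have := abs_apply_le_norm (Matrix.diagonal (T * Tᵀ).diag : Matrix (Fin n) (Fin n) ℝ) m m
    rw [Matrix.diagonal_apply_eq] at this
    exact this.trans h.diag_le
  have t3 : vn (U.row m ᵥ* (Uᵀ * (E * V))) ≤ vn (U.row m) * (D + 4 * τ + γ) := by
    refine (vn_vecMul_le _ _).trans (mul_le_mul_of_nonneg_left ?_ (vn_nonneg _))
    refine (norm_mul_le_of_norm_le_one (by rw [norm_transpose]; exact hU1) _).trans ?_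
    exact (Matrix.l2_opNorm_mul _ _).trans ((mul_le_of_le_one_right (norm_nonneg _)
      hV1).trans h.norm_gram_sub_le)
  rw [h2] at h1
  set a1 := (hollow (T * Zᵀ)).row m ᵥ* V
  set a2 := (hollow (Z * (T + Z)ᵀ)).row m ᵥ* V
  set a3 := (T * Tᵀ) m m • V.row m
  set a4 := U.row m ᵥ* (Uᵀ * (E * V))
  linarith [vn_sub_le (a1 + a2 - a3) a4, vn_sub_le (a1 + a2) a3, vn_add_le a1 a2]

end Rows

/-! ### Leave-one-out comparison -/

/-- The matrix `Z` with its `m`-th row replaced by zero. -/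
def dropRow {n : ℕ} {c : Type*} (m : Fin n) (Z : Matrix (Fin n) c ℝ) : Matrix (Fin n) c ℝ :=
  Matrix.of fun i j => if i = m then 0 else Z i j

/-- The part of the `m`-th row of the hollowed Gram matrix that involves the `m`-th row of the
noise: its `i`-th entry is `⟨Z_m, T_i + Z_i⟩`, and its `m`-th entry is zero. -/
def noiseRow {n : ℕ} {c : Type*} [Fintype c] (T Z : Matrix (Fin n) c ℝ) (m : Fin n) : Fin n → ℝ :=
  (hollow (Z * (T + Z)ᵀ)).row m

section LeaveOneOut

variable {n r : ℕ} {c : Type*} [Fintype c] [DecidableEq c] {T Z : Matrix (Fin n) c ℝ}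
  {U V V' : Matrix (Fin n) (Fin r) ℝ} {L D τ γ : ℝ}

theorem dropRow_eq_mul (m : Fin n) (Z : Matrix (Fin n) c ℝ) :
    dropRow m Z = Matrix.diagonal (fun i => if i = m then (0 : ℝ) else 1) * Z := by
  ext i j
  rw [Matrix.diagonal_mul]
  simp [dropRow]

theorem norm_dropDiagonal_le (m : Fin n) :
    ‖(Matrix.diagonal (fun i => if i = m then (0 : ℝ) else 1) : Matrix (Fin n) (Fin n) ℝ)‖ ≤ 1 :=
  norm_diagonal_le zero_le_one fun i => by split_ifs <;> simp

theorem SmallNoise.dropRow (h : SmallNoise T Z D τ γ) (m : Fin n) :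
    SmallNoise T (dropRow m Z) D τ γ := by
  have hQ := norm_dropDiagonal_le m
  set Q : Matrix (Fin n) (Fin n) ℝ :=
    Matrix.diagonal (fun i => if i = m then (0 : ℝ) else 1) with hQd
  have hQt : Qᵀ = Q := Matrix.diagonal_transpose _
  refine ⟨h.diag_le, ?_, ?_⟩
  · rw [dropRow_eq_mul, Matrix.transpose_mul, hQt, ← Matrix.mul_assoc]
    exact (Matrix.l2_opNorm_mul _ _).trans
      ((mul_le_of_le_one_right (norm_nonneg _) hQ).trans h.cross_le)
  · have : hollow (TensorInit.dropRow m Z * (TensorInit.dropRow m Z)ᵀ) =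
        Q * (hollow (Z * Zᵀ) * Q) := by
      rw [dropRow_eq_mul, Matrix.transpose_mul, hQt]
      have e : Q * Z * (Zᵀ * Q) = Q * (Z * Zᵀ * Q) := by simp only [Matrix.mul_assoc]
      rw [e]
      ext i j
      rw [Matrix.diagonal_mul, Matrix.mul_diagonal]
      by_cases hij : i = j
      · simp [hollow, hij]
      · simp only [hollow, Matrix.of_apply, hij, if_false]
        rw [Matrix.diagonal_mul, Matrix.mul_diagonal]
    rw [this]
    refine (norm_mul_le_of_norm_le_one hQ _).trans ?_
    exact (Matrix.l2_opNorm_mul _ _).trans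
      ((mul_le_of_le_one_right (norm_nonneg _) hQ).trans h.noise_le)

theorem noiseRow_dropRow (T Z : Matrix (Fin n) c ℝ) (m : Fin n) :
    noiseRow T (dropRow m Z) m = 0 := by
  ext i
  simp [noiseRow, hollow, dropRow, Matrix.mul_apply]

theorem SmallNoise.vn_noiseRow_le (h : SmallNoise T Z D τ γ) (m : Fin n) :
    vn (noiseRow T Z m) ≤ 2 * τ + γ :=
  (vn_row_le_norm _ m).trans h.norm_hollow_mul_le

/-- Restoring the `m`-th row of the noise is a perturbation of rank two. -/
theorem gram_sub_gram_dropRow (T Z : Matrix (Fin n) c ℝ) (m : Fin n) :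
    gram T (dropRow m Z) - gram T Z = -(Matrix.vecMulVec (Pi.single m 1) (noiseRow T Z m) +
      Matrix.vecMulVec (noiseRow T Z m) (Pi.single m 1)) := by
  ext i j
  simp only [gram, noiseRow, Matrix.sub_apply, Matrix.neg_apply, Matrix.add_apply,
    Matrix.vecMulVec_apply, hollow, Matrix.of_apply, Matrix.row_apply, Matrix.mul_apply,
    Matrix.transpose_apply, dropRow, Pi.single_apply]
  by_cases hij : i = j
  · subst hij
    by_cases him : i = m
    · subst him; simp
    · simp [him]
  · by_cases him : i = m
    · subst him
      simp only [if_neg hij, if_neg (Ne.symm hij), if_true, add_zero, one_mul,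
        mul_zero, ← Finset.sum_sub_distrib, ← Finset.sum_neg_distrib]
      exact Finset.sum_congr rfl fun x _ => by ring
    · by_cases hjm : j = m
      · subst hjm
        simp only [if_neg hij, if_neg (Ne.symm hij), if_true, add_zero, mul_one,
          zero_mul, zero_add, ← Finset.sum_sub_distrib, ← Finset.sum_neg_distrib]
        exact Finset.sum_congr rfl fun x _ => by ring
      · simp [hij, him, hjm]

theorem vn_vecMul_mul_transpose (hV : Vᵀ * V = 1) (x : Fin n → ℝ) :
    vn (x ᵥ* (V * Vᵀ)) = vn (x ᵥ* V) := by
  rw [← Matrix.vecMul_vecMul, Matrix.vecMul_transpose, vn_mulVec_of_orthonormal hV]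

theorem vn_row_le_compl (hU : Uᵀ * U = 1) (hV : Vᵀ * V = 1) (m : Fin n) :
    vn (V.row m) ≤ vn ((V - U * (Uᵀ * V)).row m) + vn (U.row m) := by
  have e : V.row m = (V - U * (Uᵀ * V)).row m + U.row m ᵥ* (Uᵀ * V) := by
    rw [← row_mul]
    ext i
    simp [Matrix.row_apply]
  rw [e]
  refine (vn_add_le _ _).trans ?_
  refine add_le_add le_rfl (vn_vecMul_of_norm_le_one ?_ _)
  exact (norm_mul_le_of_norm_le_one (by rw [norm_transpose]; exact norm_le_one_of_orthonormal hU)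
    _).trans (norm_le_one_of_orthonormal hV)

/-- The leave-one-out singular vectors are as incoherent in the row left out as the true ones. -/
theorem IsSignal.vn_row_dropRow_le (hT : IsSignal T U L) (hL : 0 < L) (h : SmallNoise T Z D τ γ)
    (hsmall : D + 4 * τ + γ ≤ L ^ 2 / 10) (m : Fin n)
    (hV : IsLeadingEigenvectors (gram T (dropRow m Z)) V) :
    vn (V.row m) ≤ 2 * vn (U.row m) := by
  have hL2 : 0 < L ^ 2 := by positivity
  have h' := h.dropRow m
  have h1 := hT.vn_row_compl_le hL h' ((hT.isGapEigenvectors h' hV).mono_left (by linarith)) m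
  have h0 : (hollow (dropRow m Z * (T + dropRow m Z)ᵀ)).row m = 0 := noiseRow_dropRow T Z m
  rw [h0, Matrix.zero_vecMul, vn_zero, add_zero] at h1
  have h2 := vn_row_le_compl hT.orthonormal hV.1 m
  have hD : 0 ≤ D := (norm_nonneg _).trans h.diag_le
  have hτ : 0 ≤ τ := (norm_nonneg _).trans h.cross_le
  have hγ : 0 ≤ γ := (norm_nonneg _).trans h.noise_le
  set y := vn ((V - U * (Uᵀ * V)).row m)
  set u := vn (U.row m)
  set w := vn (V.row m)
  have hu : 0 ≤ u := vn_nonneg _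
  have hw : 0 ≤ w := vn_nonneg _
  have a1 : u * τ ≤ u * (L ^ 2 / 40) := mul_le_mul_of_nonneg_left (by linarith) hu
  have a2 : D * w ≤ L ^ 2 / 10 * w := mul_le_mul_of_nonneg_right (by linarith) hw
  have a3 : u * (D + 4 * τ + γ) ≤ u * (L ^ 2 / 10) := mul_le_mul_of_nonneg_left hsmall hu
  have a4 : L ^ 2 * (y / 2) ≤ L ^ 2 * (u / 40 + w / 10 + u / 10) := by linarith
  have a5 := le_of_mul_le_mul_left a4 hL2
  linarith

/-- Leaving out one row of the noise moves the spectral projection only a little. -/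
theorem IsSignal.norm_sub_dropRow_le (hT : IsSignal T U L) (hL : 0 < L) (h : SmallNoise T Z D τ γ)
    (hsmall : D + 4 * τ + γ ≤ L ^ 2 / 10) (m : Fin n)
    (hV : IsLeadingEigenvectors (gram T Z) V)
    (hV' : IsLeadingEigenvectors (gram T (dropRow m Z)) V') :
    ‖V * Vᵀ - V' * V'ᵀ‖ ≤ 5 / (2 * L ^ 2) *
      (vn (noiseRow T Z m ᵥ* V') + 2 * vn (U.row m) * (2 * τ + γ)) := by
  have hL2 : 0 < L ^ 2 := by positivity
  have h' := h.dropRow m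
  have g1 := hT.isGapEigenvectors h hV
  have g2 := hT.isGapEigenvectors h' hV'
  have h1 := g1.frobNorm_sub_le g2 (by linarith)
  have h2 : frobNorm ((gram T (dropRow m Z) - gram T Z) * V') ≤
      vn (noiseRow T Z m ᵥ* V') + vn (noiseRow T Z m) * vn (V'.row m) := by
    rw [gram_sub_gram_dropRow, Matrix.neg_mul, Matrix.add_mul, Matrix.vecMulVec_mul,
      Matrix.vecMulVec_mul, Matrix.single_one_vecMul]
    rw [frobNorm_neg]
    refine (frobNorm_add_le _ _).trans ?_
    rw [frobNorm_vecMulVec, frobNorm_vecMulVec, vn_single, one_mul]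
  have h3 := hT.vn_row_dropRow_le hL h hsmall m hV'
  have h4 := h.vn_noiseRow_le m
  have h5 := norm_le_frobNorm (V * Vᵀ - V' * V'ᵀ)
  set w := vn (noiseRow T Z m ᵥ* V')
  set u := vn (U.row m)
  set N := ‖V * Vᵀ - V' * V'ᵀ‖
  set F := frobNorm (V * Vᵀ - V' * V'ᵀ)
  have hF : 0 ≤ F := frobNorm_nonneg _
  have h6 : vn (noiseRow T Z m) * vn (V'.row m) ≤ (2 * τ + γ) * (2 * u) :=
    mul_le_mul h4 h3 (vn_nonneg _) ((vn_nonneg _).trans h4)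
  have h7 : (4 / 5 * L ^ 2) * F ≤ 2 * (w + 2 * u * (2 * τ + γ)) := by
    have : (4 / 5 * L ^ 2) * F ≤ (L ^ 2 - (D + 4 * τ + γ) - (D + 4 * τ + γ)) * F :=
      mul_le_mul_of_nonneg_right (by linarith) hF
    linarith
  have h8 : N * (L ^ 2 * 2) ≤ 5 * (w + 2 * u * (2 * τ + γ)) := by nlinarith
  rw [div_mul_eq_mul_div, le_div_iff₀ (by positivity)]
  linarith

/-- The row-wise error of the estimated singular vectors, in terms of the leave-one-out quantity
`vn (noiseRow T Z m ᵥ* V')`. -/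
theorem IsSignal.vn_row_sub_le (hT : IsSignal T U L) (hL : 0 < L) (h : SmallNoise T Z D τ γ)
    (hsmall : D + 4 * τ + γ ≤ L ^ 2 / 10) (m : Fin n)
    (hV : IsLeadingEigenvectors (gram T Z) V)
    (hV' : IsLeadingEigenvectors (gram T (dropRow m Z)) V')
    {W : Matrix (Fin r) (Fin r) ℝ} (hW : ‖Uᵀ * V - W‖ ≤ ‖V - U * (Uᵀ * V)‖ ^ 2) :
    vn ((V - U * W).row m) ≤ 8 / L ^ 2 *
      (vn (U.row m) * (4 * τ + γ) + vn (noiseRow T Z m ᵥ* V') + D) := by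
  have hL2 : 0 < L ^ 2 := by positivity
  have g1 := (hT.isGapEigenvectors h hV).mono_left (a' := L ^ 2 / 2) (by linarith)
  have h1 := hT.vn_row_compl_le hL h g1 m
  have h2 := hT.norm_compl_le hL h g1
  have h3 := hT.norm_sub_dropRow_le hL h hsmall m hV hV'
  have h4 := h.vn_noiseRow_le m
  change _ ≤ _ + vn (noiseRow T Z m ᵥ* V) + _ + _ at h1
  have hVV := hV.1
  have hVV' := hV'.1
  have hD : 0 ≤ D := (norm_nonneg _).trans h.diag_le
  have hτ : 0 ≤ τ := (norm_nonneg _).trans h.cross_le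
  have hγ : 0 ≤ γ := (norm_nonneg _).trans h.noise_le
  have hu1 : vn (U.row m) ≤ 1 :=
    (vn_row_le_norm U m).trans (norm_le_one_of_orthonormal hT.orthonormal)
  have hv1 : vn (V.row m) ≤ 1 := (vn_row_le_norm V m).trans (norm_le_one_of_orthonormal hVV)
  -- passing from `V` to the leave-one-out eigenvectors `V'` in the noise term
  have h5 : vn (noiseRow T Z m ᵥ* V) ≤ vn (noiseRow T Z m ᵥ* V') +
      (2 * τ + γ) * ‖V * Vᵀ - V' * V'ᵀ‖ := by
    have e1 : vn (noiseRow T Z m ᵥ* V) = vn (noiseRow T Z m ᵥ* (V * Vᵀ)) := by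
      rw [vn_vecMul_mul_transpose hVV]
    have e2 : vn (noiseRow T Z m ᵥ* V') = vn (noiseRow T Z m ᵥ* (V' * V'ᵀ)) := by
      rw [vn_vecMul_mul_transpose hVV']
    have e3 : noiseRow T Z m ᵥ* (V * Vᵀ) = noiseRow T Z m ᵥ* (V' * V'ᵀ) +
        noiseRow T Z m ᵥ* (V * Vᵀ - V' * V'ᵀ) := by
      rw [← Matrix.vecMul_add, add_sub_cancel]
    rw [e1, e2, e3]
    refine (vn_add_le _ _).trans (add_le_add le_rfl ?_)
    exact (vn_vecMul_le _ _).trans (mul_le_mul_of_nonneg_right h4 (norm_nonneg _))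
  have h6 : vn ((V - U * W).row m) ≤ vn ((V - U * (Uᵀ * V)).row m) +
      vn (U.row m) * ‖Uᵀ * V - W‖ := by
    have e : (V - U * W).row m = (V - U * (Uᵀ * V)).row m + U.row m ᵥ* (Uᵀ * V - W) := by
      rw [← row_mul, Matrix.mul_sub]
      ext i
      simp [Matrix.row_apply]
    rw [e]
    exact (vn_add_le _ _).trans (add_le_add le_rfl (vn_vecMul_le _ _))
  set X := ‖V - U * (Uᵀ * V)‖ with hX
  have hX0 : 0 ≤ X := norm_nonneg _
  set y := vn ((V - U * (Uᵀ * V)).row m)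
  set u := vn (U.row m)
  set w := vn (noiseRow T Z m ᵥ* V')
  set N := ‖V * Vᵀ - V' * V'ᵀ‖
  have hu : 0 ≤ u := vn_nonneg _
  have hw : 0 ≤ w := vn_nonneg _
  rw [div_mul_eq_mul_div, le_div_iff₀ (by positivity)] at h2 h3 ⊢
  have hX1 : X ≤ 1 := by
    have : X * L ^ 2 ≤ 1 * L ^ 2 := by linarith
    exact le_of_mul_le_mul_right this hL2
  have h7 : u * ‖Uᵀ * V - W‖ ≤ u * X :=
    mul_le_mul_of_nonneg_left (hW.trans (by nlinarith)) hu
  have h8 : u * X * L ^ 2 ≤ u * (2 * (D + 4 * τ + γ)) := by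
    rw [mul_assoc]; exact mul_le_mul_of_nonneg_left h2 hu
  have h9 : (2 * τ + γ) * N ≤ w + 2 * u * (2 * τ + γ) := by
    have a1 : (2 * τ + γ) * N ≤ L ^ 2 / 10 * N :=
      mul_le_mul_of_nonneg_right (by linarith) (norm_nonneg _)
    have a2 : 0 ≤ 2 * u * (2 * τ + γ) := by positivity
    linarith
  have h10 : D * vn (V.row m) ≤ D := mul_le_of_le_one_right hD hv1
  have h11 : u * D ≤ D := mul_le_of_le_one_left hD hu1
  have h12 : 0 ≤ u * γ := by positivity
  have h13 : 0 ≤ u * τ := by positivity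
  have h14 : vn ((V - U * W).row m) * L ^ 2 ≤ y * L ^ 2 + u * X * L ^ 2 := by
    have : vn ((V - U * W).row m) ≤ y + u * X := by linarith
    calc _ ≤ (y + u * X) * L ^ 2 := mul_le_mul_of_nonneg_right this hL2.le
      _ = _ := by ring
  nlinarith

end LeaveOneOut

/-! ### Nets and subgaussian tails -/

section Net

/-- A `1/2`-net of the Euclidean unit ball, contained in it, with at most `5 ^ dim` points. -/
theorem exists_net (m : Type*) [Fintype m] : ∃ N : Finset (m → ℝ),
    N.card ≤ 5 ^ Fintype.card m ∧ (∀ x ∈ N, vn x ≤ 1) ∧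
      ∀ x, vn x ≤ 1 → ∃ y ∈ N, vn (x - y) ≤ 1 / 2 := by
  classical
  let Sep : Finset (EuclideanSpace ℝ m) → Prop := fun s =>
    (∀ c ∈ s, ‖c‖ ≤ 2) ∧ ∀ c ∈ s, ∀ d ∈ s, c ≠ d → 1 ≤ ‖c - d‖
  have hcard (s : Finset (EuclideanSpace ℝ m)) (hs : Sep s) : s.card ≤ 5 ^ Fintype.card m := by
    simpa using Besicovitch.card_le_of_separated s hs.1 hs.2
  -- a separated set of maximal cardinality
  obtain ⟨s, hs, hmax⟩ : ∃ s, Sep s ∧ ∀ t, Sep t → t.card ≤ s.card := by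
    let Q : ℕ → Prop := fun k => ∃ s, Sep s ∧ s.card = k
    have h0 : Q 0 := ⟨∅, ⟨by simp, by simp⟩, rfl⟩
    obtain ⟨s, hs, hk⟩ := Nat.findGreatest_spec (P := Q) (Nat.zero_le (5 ^ Fintype.card m)) h0
    refine ⟨s, hs, fun t ht => ?_⟩
    rw [hk]
    exact Nat.le_findGreatest (hcard t ht) ⟨t, ht, rfl⟩
  refine ⟨s.image fun c => (1 / 2 : ℝ) • c.ofLp, Finset.card_image_le.trans (hcard s hs), ?_, ?_⟩
  · intro x hx
    obtain ⟨c, hc, rfl⟩ := Finset.mem_image.mp hx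
    have h2 : vn c.ofLp = ‖c‖ := rfl
    rw [vn_smul, h2, abs_of_pos (by norm_num)]
    linarith [hs.1 c hc]
  · intro x hx
    set y : EuclideanSpace ℝ m := WithLp.toLp 2 ((2 : ℝ) • x) with hy
    have hyn : ‖y‖ ≤ 2 := by
      have : ‖y‖ = vn ((2 : ℝ) • x) := rfl
      rw [this, vn_smul, abs_of_pos (by norm_num)]
      linarith
    obtain ⟨c, hc, hcy⟩ : ∃ c ∈ s, ‖y - c‖ < 1 := by
      by_contra! hcon
      have hys : y ∉ s := fun h => by simpa using (hcon y h).trans_lt' zero_lt_one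
      have : Sep (insert y s) := by
        constructor
        · intro c hc
          rcases Finset.mem_insert.mp hc with rfl | hc
          · exact hyn
          · exact hs.1 c hc
        · intro c hc d hd hcd
          rcases Finset.mem_insert.mp hc with rfl | hc <;>
            rcases Finset.mem_insert.mp hd with rfl | hd
          · exact absurd rfl hcd
          · exact hcon d hd
          · rw [norm_sub_rev]; exact hcon c hc
          · exact hs.2 c hc d hd hcd
      have := hmax _ this
      rw [Finset.card_insert_of_notMem hys] at this
      omega
    refine ⟨(1 / 2 : ℝ) • c.ofLp, Finset.mem_image_of_mem _ hc, ?_⟩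
    have : x - (1 / 2 : ℝ) • c.ofLp = (1 / 2 : ℝ) • (y - c).ofLp := by
      rw [WithLp.ofLp_sub, smul_sub, hy, smul_smul]
      norm_num
    have h2 : vn (y - c).ofLp = ‖y - c‖ := rfl
    rw [this, vn_smul, h2, abs_of_pos (by norm_num)]
    linarith

theorem vn_normalize_le {m : Type*} [Fintype m] {v : m → ℝ} (hv : v ≠ 0) :
    vn ((vn v)⁻¹ • v) ≤ 1 := by
  rw [vn_smul, abs_of_pos (inv_pos.mpr (vn_pos hv)), inv_mul_cancel₀ (vn_pos hv).ne']

/-- The spectral norm is controlled by the values of the bilinear form on two `1/2`-nets. -/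
theorem norm_le_of_net {m l : Type*} [Fintype m] [Fintype l] [DecidableEq m] [DecidableEq l]
    {N : Finset (m → ℝ)} {N' : Finset (l → ℝ)}
    (hN : ∀ x, vn x ≤ 1 → ∃ y ∈ N, vn (x - y) ≤ 1 / 2)
    (hN' : ∀ x, vn x ≤ 1 → ∃ y ∈ N', vn (x - y) ≤ 1 / 2)
    {M : Matrix m l ℝ} {K : ℝ} (hK : 0 ≤ K)
    (h : ∀ x ∈ N, ∀ y ∈ N', x ⬝ᵥ (M *ᵥ y) ≤ K) : ‖M‖ ≤ 4 * K := by
  have h1 (y) (hy : y ∈ N') : vn (M *ᵥ y) ≤ 2 * K := by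
    set v := M *ᵥ y with hv
    by_cases hv0 : v = 0
    · rw [hv0, vn_zero]; positivity
    obtain ⟨x, hx, hxd⟩ := hN _ (vn_normalize_le hv0)
    have e1 : ((vn v)⁻¹ • v) ⬝ᵥ v = vn v := by
      rw [smul_dotProduct, ← vn_sq, smul_eq_mul, sq, ← mul_assoc,
        inv_mul_cancel₀ (vn_pos hv0).ne', one_mul]
    have e2 := dotProduct_le_vn ((vn v)⁻¹ • v - x) v
    rw [sub_dotProduct, e1] at e2
    have e3 := mul_le_mul_of_nonneg_right hxd (vn_nonneg v)
    linarith [h x hx y hy]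
  have h2 : ‖M‖ ≤ 2 * K + 1 / 2 * ‖M‖ := by
    refine norm_le_of_vn_mulVec_le (by positivity) fun v => ?_
    by_cases hv0 : v = 0
    · simp [hv0, vn_zero]
    have hpos := vn_pos hv0
    obtain ⟨y, hy, hyd⟩ := hN' _ (vn_normalize_le hv0)
    have e1 : M *ᵥ v = vn v • (M *ᵥ y + M *ᵥ ((vn v)⁻¹ • v - y)) := by
      rw [← Matrix.mulVec_add, add_sub_cancel, ← Matrix.mulVec_smul, smul_smul,
        mul_inv_cancel₀ hpos.ne', one_smul]
    rw [e1, vn_smul, abs_of_pos hpos, mul_comm]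
    refine mul_le_mul_of_nonneg_right ((vn_add_le _ _).trans (add_le_add (h1 y hy) ?_)) hpos.le
    refine (vn_mulVec_le _ _).trans ?_
    rw [mul_comm]
    exact mul_le_mul_of_nonneg_right hyd (norm_nonneg _)
  linarith

end Net

section Tail

variable {Ω : Type*} [MeasurableSpace Ω] {P : Measure Ω} [IsProbabilityMeasure P]
  {ι : Type*} [Fintype ι] [DecidableEq ι] {Z : ι → Ω → ℝ} {σ : ℝ}

theorem measure_lt_dotProduct_le (hσ : 0 < σ) (hind : iIndepFun Z P)
    (hsub : ∀ i, HasSubgaussianMGF (Z i) (Real.toNNReal (σ ^ 2)) P) (β : ι → ℝ) {s : ℝ}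
    (hs : 0 ≤ s) :
    P {ω | s * σ * vn β < β ⬝ᵥ fun i => Z i ω} ≤ ENNReal.ofReal (Real.exp (-s ^ 2 / 2)) := by
  by_cases hβ : β = 0
  · simp [hβ, vn_zero]
  have hsum := HasSubgaussianMGF.sum_of_iIndepFun (X := fun i ω => β i * Z i ω)
    (hind.comp (fun i x => β i * x) fun i => measurable_const_mul _) (s := Finset.univ)
    fun i _ => (hsub i).const_mul (β i)
  have hpos := vn_pos hβ
  have h1 := hsum.measure_ge_le (ε := s * σ * vn β) (by positivity)
  have h2 : -(s * σ * vn β) ^ 2 / (2 * ((∑ i, NNReal.mk (β i ^ 2) (sq_nonneg _) *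
      Real.toNNReal (σ ^ 2) : NNReal) : ℝ)) = -s ^ 2 / 2 := by
    have : ((∑ i, NNReal.mk (β i ^ 2) (sq_nonneg _) * Real.toNNReal (σ ^ 2) : NNReal) : ℝ) =
        vn β ^ 2 * σ ^ 2 := by
      rw [vn_sq_eq_sum, NNReal.coe_sum, Finset.sum_mul]
      refine Finset.sum_congr rfl fun i _ => ?_
      rw [NNReal.coe_mul, Real.coe_toNNReal _ (sq_nonneg σ)]
      rfl
    rw [this]
    field_simp
  replace h1 : P.real {ω | s * σ * vn β ≤ ∑ i, β i * Z i ω} ≤ Real.exp (-s ^ 2 / 2) := by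
    rw [← h2]; exact h1
  rw [← ofReal_measureReal]
  refine ENNReal.ofReal_le_ofReal (le_trans (measureReal_mono ?_) h1)
  intro ω hω
  change s * σ * vn β < ∑ i, β i * Z i ω at hω
  exact hω.le

/-- A self-normalised tail bound: the coefficients `b` may depend on the noise outside the block
`S`, as the noise in the block is independent of it. -/
theorem measure_lt_dotProduct_le_of_block (hσ : 0 < σ) (hmeas : ∀ i, Measurable (Z i))
    (hind : iIndepFun Z P)
    (hsub : ∀ i, HasSubgaussianMGF (Z i) (Real.toNNReal (σ ^ 2)) P) (S : Finset ι)
    {b : (ι → ℝ) → ι → ℝ} (hb : Measurable b) (hbS : ∀ z, ∀ i ∉ S, b z i = 0)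
    (hdep : ∀ z z', (∀ i ∉ S, z i = z' i) → b z = b z') {s : ℝ} (hs : 0 ≤ s) :
    P {ω | s * σ * vn (b fun i => Z i ω) < (b fun i => Z i ω) ⬝ᵥ fun i => Z i ω} ≤
      ENNReal.ofReal (Real.exp (-s ^ 2 / 2)) := by
  let X : Ω → S → ℝ := fun ω i => Z i ω
  let Y : Ω → (Sᶜ : Finset ι) → ℝ := fun ω i => Z i ω
  have hX : Measurable X := measurable_pi_lambda _ fun i => hmeas i
  have hY : Measurable Y := measurable_pi_lambda _ fun i => hmeas i
  have hXY : IndepFun Y X P := hind.indepFun_finset Sᶜ S disjoint_compl_left hmeas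
  let g : (((Sᶜ : Finset ι) → ℝ) × (S → ℝ)) → ι → ℝ := fun q i =>
    if h : i ∈ S then q.2 ⟨i, h⟩ else q.1 ⟨i, Finset.mem_compl.mpr h⟩
  have hg : Measurable g := by
    refine measurable_pi_lambda _ fun i => ?_
    by_cases h : i ∈ S
    · simp only [g, h, dite_true]
      exact (measurable_pi_apply _).comp measurable_snd
    · simp only [g, h, dite_false]
      exact (measurable_pi_apply _).comp measurable_fst
  have hgZ (ω : Ω) : g (Y ω, X ω) = fun i => Z i ω := by
    funext i
    by_cases h : i ∈ S <;> simp [g, h, X, Y]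
  let A : Set (((Sᶜ : Finset ι) → ℝ) × (S → ℝ)) :=
    {q | s * σ * vn (b (g q)) < b (g q) ⬝ᵥ g q}
  have hvn : Measurable (vn : (ι → ℝ) → ℝ) := by
    have : (vn : (ι → ℝ) → ℝ) = fun x => √(∑ i, x i ^ 2) := funext vn_eq_sqrt
    rw [this]
    fun_prop
  have hbg : Measurable fun q => b (g q) := hb.comp hg
  have hA : MeasurableSet A := by
    refine measurableSet_lt ((hvn.comp hbg).const_mul _) ?_
    simp only [dotProduct]
    refine Finset.measurable_sum _ fun i _ => ?_
    exact ((measurable_pi_apply i).comp hbg).mul ((measurable_pi_apply i).comp hg)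
  have hpre : {ω | s * σ * vn (b fun i => Z i ω) < (b fun i => Z i ω) ⬝ᵥ fun i => Z i ω} =
      (fun ω => (Y ω, X ω)) ⁻¹' A := by
    ext ω
    change _ ↔ s * σ * vn (b (g (Y ω, X ω))) < b (g (Y ω, X ω)) ⬝ᵥ g (Y ω, X ω)
    rw [hgZ]
    rfl
  rw [hpre, ← Measure.map_apply (hY.prodMk hX) hA, hXY.map_prod_eq_prod_map_map hY.aemeasurable
    hX.aemeasurable, Measure.prod_apply hA]
  have : IsProbabilityMeasure (P.map Y) := Measure.isProbabilityMeasure_map hY.aemeasurable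
  calc ∫⁻ y, (P.map X) (Prod.mk y ⁻¹' A) ∂(P.map Y)
      ≤ ∫⁻ _, ENNReal.ofReal (Real.exp (-s ^ 2 / 2)) ∂(P.map Y) := by
        refine lintegral_mono fun y => ?_
        rw [Measure.map_apply hX (measurable_prodMk_left hA)]
        set β := b (g (y, 0)) with hβ
        have hbeta (x) : b (g (y, x)) = β := by
          refine hdep _ _ fun i hi => ?_
          simp [g, hi]
        refine le_trans (measure_mono ?_) (measure_lt_dotProduct_le hσ hind hsub β hs)
        intro ω hω
        change s * σ * vn (b (g (y, X ω))) < b (g (y, X ω)) ⬝ᵥ g (y, X ω) at hω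
        rw [hbeta] at hω
        change s * σ * vn β < β ⬝ᵥ fun i => Z i ω
        refine hω.trans_eq (Finset.sum_congr rfl fun i _ => ?_)
        by_cases hi : i ∈ S
        · simp [g, hi, X]
        · rw [hβ, hbS _ i hi, zero_mul, zero_mul]
    _ = ENNReal.ofReal (Real.exp (-s ^ 2 / 2)) := by simp

end Tail

/-! ### Concentration of the noise matrix -/

/-- The Davis–Kahan bound makes the spectral projection a Lipschitz function on the set of matrices
with a given gap; it therefore extends to a continuous function of all matrices, and no measurable
choice of eigenvectors is needed. -/
theorem exists_continuous_projection (n r : ℕ) {a b : ℝ} (hab : b < a) :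
    ∃ Φ : Matrix (Fin n) (Fin n) ℝ → Matrix (Fin n) (Fin n) ℝ, Continuous Φ ∧
      ∀ (G : Matrix (Fin n) (Fin n) ℝ) (V : Matrix (Fin n) (Fin r) ℝ),
        IsGapEigenvectors G V a b → Φ G = V * Vᵀ := by
  classical
  let S : Set (Fin n → Fin n → ℝ) :=
    {G | ∃ V : Matrix (Fin n) (Fin r) ℝ, IsGapEigenvectors (Matrix.of G) V a b}
  let f : (Fin n → Fin n → ℝ) → Fin n × Fin n → ℝ := fun G ij =>
    if h : ∃ V : Matrix (Fin n) (Fin r) ℝ, IsGapEigenvectors (Matrix.of G) V a b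
    then (h.choose * h.chooseᵀ) ij.1 ij.2 else 0
  have hpos : 0 < a - b := sub_pos.mpr hab
  have key (G G' : Fin n → Fin n → ℝ) (V V' : Matrix (Fin n) (Fin r) ℝ)
      (hV : IsGapEigenvectors (Matrix.of G) V a b) (hV' : IsGapEigenvectors (Matrix.of G') V' a b)
      (i j : Fin n) : |(V * Vᵀ) i j - (V' * V'ᵀ) i j| ≤ 2 * n / (a - b) * dist G G' := by
    have h1 := hV.frobNorm_sub_le hV' hab
    have h2 := (abs_apply_le_norm (V * Vᵀ - V' * V'ᵀ) i j).trans (norm_le_frobNorm _)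
    have h3 := frobNorm_mul_le (Matrix.of G' - Matrix.of G) V'
    have h4 := mul_le_mul_of_nonneg_left (norm_le_one_of_orthonormal hV'.1)
      (frobNorm_nonneg (Matrix.of G' - Matrix.of G))
    have h5 : frobNorm (Matrix.of G' - Matrix.of G) ≤ n * dist G G' := by
      rw [frobNorm]
      refine Real.sqrt_le_iff.mpr ⟨by positivity, ?_⟩
      calc ∑ i, ∑ j, (Matrix.of G' - Matrix.of G) i j ^ 2
          ≤ ∑ _i : Fin n, ∑ _j : Fin n, dist G G' ^ 2 := by
            refine Finset.sum_le_sum fun i _ => Finset.sum_le_sum fun j _ => ?_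
            rw [← sq_abs]
            refine pow_le_pow_left₀ (abs_nonneg _) ?_ 2
            have := (dist_le_pi_dist (G i) (G' i) j).trans (dist_le_pi_dist G G' i)
            rw [dist_comm, Real.dist_eq] at this
            exact this
        _ = (n * dist G G') ^ 2 := by simp; ring
    rw [Matrix.sub_apply] at h2
    rw [div_mul_eq_mul_div, le_div_iff₀ hpos]
    nlinarith
  have hf (G : Fin n → Fin n → ℝ) (V : Matrix (Fin n) (Fin r) ℝ)
      (hV : IsGapEigenvectors (Matrix.of G) V a b) (ij : Fin n × Fin n) :
      f G ij = (V * Vᵀ) ij.1 ij.2 := by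
    have h : ∃ V : Matrix (Fin n) (Fin r) ℝ, IsGapEigenvectors (Matrix.of G) V a b := ⟨V, hV⟩
    have h1 := key G G _ V h.choose_spec hV ij.1 ij.2
    rw [dist_self, mul_zero, abs_nonpos_iff, sub_eq_zero] at h1
    simp only [f, h, dite_true]
    exact h1
  have hlip : LipschitzOnWith (Real.toNNReal (2 * n / (a - b))) f S := by
    refine LipschitzOnWith.of_dist_le_mul fun G hG G' hG' => ?_
    obtain ⟨V, hV⟩ := hG
    obtain ⟨V', hV'⟩ := hG'
    rw [Real.coe_toNNReal _ (by positivity)]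
    refine (dist_pi_le_iff (by positivity)).mpr fun ij => ?_
    rw [hf G V hV, hf G' V' hV', Real.dist_eq]
    exact key G G' V V' hV hV' ij.1 ij.2
  obtain ⟨g, hg, hfg⟩ := hlip.extend_pi
  refine ⟨fun G => Matrix.of fun i j => g (fun i j => G i j) (i, j), ?_, fun G V hV => ?_⟩
  · refine continuous_matrix fun i j => ?_
    exact (continuous_apply (i, j)).comp (hg.continuous.comp
      (continuous_pi fun i => continuous_pi fun j => continuous_id.matrix_elem i j))
  · ext i j
    have h1 : (fun i j => G i j) ∈ S := ⟨V, hV⟩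
    have h2 := congrFun (hfg h1) (i, j)
    change g (fun i j => G i j) (i, j) = _
    rw [← h2]
    exact hf _ V hV (i, j)

section Events

variable {Ω : Type*} [MeasurableSpace Ω] {P : Measure Ω} [IsProbabilityMeasure P]
  {n r : ℕ} {c : Type*} [Fintype c] [DecidableEq c] {Z : Fin n × c → Ω → ℝ} {σ s : ℝ}

/-- The matrix whose entries are given as one vector, the form in which the noise appears. -/
def toMat (z : Fin n × c → ℝ) : Matrix (Fin n) c ℝ := Matrix.of fun i j => z (i, j)

theorem continuous_toMat : Continuous (toMat : (Fin n × c → ℝ) → Matrix (Fin n) c ℝ) :=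
  continuous_matrix fun i j => continuous_apply (i, j)

theorem dotProduct_toMat_mulVec (a : Fin n → ℝ) (b : c → ℝ) (z : Fin n × c → ℝ) :
    a ⬝ᵥ (toMat z *ᵥ b) = (fun ij : Fin n × c => a ij.1 * b ij.2) ⬝ᵥ z := by
  simp only [dotProduct, Matrix.mulVec, toMat, Matrix.of_apply, Fintype.sum_prod_type,
    Finset.mul_sum]
  exact Finset.sum_congr rfl fun i _ => Finset.sum_congr rfl fun j _ => by ring

theorem vn_mul_prod (a : Fin n → ℝ) (b : c → ℝ) :
    vn (fun ij : Fin n × c => a ij.1 * b ij.2) = vn a * vn b := by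
  rw [vn_eq_sqrt, vn_eq_sqrt, vn_eq_sqrt,
    ← Real.sqrt_mul (Finset.sum_nonneg fun i _ => sq_nonneg _), Finset.sum_mul_sum,
    Fintype.sum_prod_type]
  simp [mul_pow]

/-- The tail of a bilinear form in a block of rows of the noise, with coefficients that depend on
the other rows. -/
theorem measure_bilinear_le (hσ : 0 < σ) (hmeas : ∀ i, Measurable (Z i))
    (hind : iIndepFun Z P) (hsub : ∀ i, HasSubgaussianMGF (Z i) (Real.toNNReal (σ ^ 2)) P)
    (hs : 0 ≤ s) (I : Finset (Fin n)) {a : Fin n → ℝ} (ha : ∀ i ∉ I, a i = 0)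
    {b : (Fin n × c → ℝ) → c → ℝ} (hb : Continuous b)
    (hdep : ∀ z z', (∀ i ∉ I, ∀ j, z (i, j) = z' (i, j)) → b z = b z') :
    P {ω | s * σ * (vn a * vn (b fun i => Z i ω)) <
      a ⬝ᵥ (toMat (fun i => Z i ω) *ᵥ b fun i => Z i ω)} ≤
      ENNReal.ofReal (Real.exp (-s ^ 2 / 2)) := by
  have h := measure_lt_dotProduct_le_of_block hσ hmeas hind hsub (I ×ˢ (Finset.univ : Finset c))
    (b := fun z ij => a ij.1 * b z ij.2) (Continuous.measurable (by fun_prop))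
    (fun z ij hij => by
      rw [ha ij.1 (fun h => hij (Finset.mem_product.mpr ⟨h, Finset.mem_univ _⟩)), zero_mul])
    (fun z z' hz => by
      rw [hdep z z' fun i hi j => hz (i, j) fun h => hi (Finset.mem_product.mp h).1]) hs
  simp only [vn_mul_prod] at h
  simp only [dotProduct_toMat_mulVec]
  exact h

theorem measure_le_card_mul {α : Type*} (F : Finset α) {B : α → Set Ω} {q N : ℝ} (hq : 0 ≤ q)
    (hB : ∀ a ∈ F, P (B a) ≤ ENNReal.ofReal q) (hN : (F.card : ℝ) ≤ N) {A : Set Ω}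
    (hA : A ⊆ ⋃ a ∈ F, B a) : P A ≤ ENNReal.ofReal (N * q) := by
  calc P A ≤ ∑ a ∈ F, P (B a) := (measure_mono hA).trans (measure_biUnion_finset_le F B)
    _ ≤ ∑ _a ∈ F, ENNReal.ofReal q := Finset.sum_le_sum hB
    _ = ENNReal.ofReal (F.card * q) := by
        rw [Finset.sum_const, nsmul_eq_mul, ENNReal.ofReal_mul (by positivity),
          ENNReal.ofReal_natCast]
    _ ≤ ENNReal.ofReal (N * q) :=
        ENNReal.ofReal_le_ofReal (mul_le_mul_of_nonneg_right hN hq)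

/-- A union bound over finitely many inequalities `g a ≤ f a`. -/
theorem measure_lt_le_card_mul {α : Type*} (F : Finset α) {f g : α → Ω → ℝ} {q N : ℝ} (hq : 0 ≤ q)
    (hB : ∀ a ∈ F, P {ω | f a ω < g a ω} ≤ ENNReal.ofReal q) (hN : (F.card : ℝ) ≤ N) {X Y : Ω → ℝ}
    (h : ∀ ω, (∀ a ∈ F, g a ω ≤ f a ω) → Y ω ≤ X ω) :
    P {ω | X ω < Y ω} ≤ ENNReal.ofReal (N * q) := by
  refine measure_le_card_mul F hq hB hN fun ω hω => ?_
  by_contra hcon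
  simp only [Set.mem_iUnion, not_exists] at hcon
  have hω' : X ω < Y ω := hω
  refine not_le_of_gt hω' (h ω fun a ha => ?_)
  exact not_lt.mp (show ¬ f a ω < g a ω from hcon a ha)

theorem card_product_net_le {m l : Type*} [Fintype m] [Fintype l] {N : Finset (m → ℝ)}
    {N' : Finset (l → ℝ)} (hN : N.card ≤ 5 ^ Fintype.card m) (hN' : N'.card ≤ 5 ^ Fintype.card l) :
    ((N ×ˢ N').card : ℝ) ≤ 5 ^ (Fintype.card m + Fintype.card l) := by
  rw [Finset.card_product, pow_add]
  exact_mod_cast Nat.mul_le_mul hN hN'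

theorem measure_norm_noise_le (hσ : 0 < σ) (hmeas : ∀ i, Measurable (Z i))
    (hind : iIndepFun Z P) (hsub : ∀ i, HasSubgaussianMGF (Z i) (Real.toNNReal (σ ^ 2)) P)
    (hs : 0 ≤ s) :
    P {ω | 4 * (s * σ) < ‖toMat fun i => Z i ω‖} ≤
      ENNReal.ofReal (5 ^ (n + Fintype.card c) * Real.exp (-s ^ 2 / 2)) := by
  obtain ⟨N, hN, hN1, hNd⟩ := exists_net (Fin n)
  obtain ⟨N', hN', hN1', hNd'⟩ := exists_net c
  have hcard := card_product_net_le hN hN'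
  rw [Fintype.card_fin] at hcard
  refine measure_lt_le_card_mul (N ×ˢ N') (f := fun q _ => s * σ * (vn q.1 * vn q.2))
    (g := fun q ω => q.1 ⬝ᵥ (toMat (fun i => Z i ω) *ᵥ q.2)) (Real.exp_pos _).le (fun q _ => ?_)
    hcard fun ω hcon => ?_
  · exact measure_bilinear_le hσ hmeas hind hsub hs Finset.univ (a := q.1) (b := fun _ => q.2)
      (fun i hi => absurd (Finset.mem_univ i) hi) continuous_const fun _ _ _ => rfl
  · refine norm_le_of_net hNd hNd' (by positivity) fun x hx y hy => ?_
    have := hcon (x, y) (Finset.mem_product.mpr ⟨hx, hy⟩)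
    refine this.trans (mul_le_of_le_one_right (by positivity) ?_)
    exact mul_le_one₀ (hN1 x hx) (vn_nonneg _) (hN1' y hy)

theorem measure_norm_cross_le (hσ : 0 < σ) (hmeas : ∀ i, Measurable (Z i))
    (hind : iIndepFun Z P) (hsub : ∀ i, HasSubgaussianMGF (Z i) (Real.toNNReal (σ ^ 2)) P)
    (hs : 0 ≤ s) (T : Matrix (Fin n) c ℝ) :
    P {ω | 4 * (s * σ * ‖T‖) < ‖T * (toMat fun i => Z i ω)ᵀ‖} ≤
      ENNReal.ofReal (5 ^ (n + n) * Real.exp (-s ^ 2 / 2)) := by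
  obtain ⟨N, hN, hN1, hNd⟩ := exists_net (Fin n)
  have hcard := card_product_net_le hN hN
  rw [Fintype.card_fin] at hcard
  refine measure_lt_le_card_mul (N ×ˢ N) (f := fun q _ => s * σ * (vn q.2 * vn (q.1 ᵥ* T)))
    (g := fun q ω => q.2 ⬝ᵥ (toMat (fun i => Z i ω) *ᵥ (q.1 ᵥ* T))) (Real.exp_pos _).le
    (fun q _ => ?_) hcard fun ω hcon => ?_
  · exact measure_bilinear_le hσ hmeas hind hsub hs Finset.univ (a := q.2) (b := fun _ => q.1 ᵥ* T)
      (fun i hi => absurd (Finset.mem_univ i) hi) continuous_const fun _ _ _ => rfl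
  · refine norm_le_of_net hNd hNd (by positivity) fun x hx y hy => ?_
    have := hcon (x, y) (Finset.mem_product.mpr ⟨hx, hy⟩)
    have e : x ⬝ᵥ ((T * (toMat fun i => Z i ω)ᵀ) *ᵥ y) =
        y ⬝ᵥ (toMat (fun i => Z i ω) *ᵥ (x ᵥ* T)) := by
      rw [← Matrix.mulVec_mulVec, Matrix.dotProduct_mulVec, Matrix.dotProduct_mulVec y,
        Matrix.mulVec_transpose, dotProduct_comm]
    rw [e]
    refine this.trans (mul_le_mul_of_nonneg_left ?_ (by positivity))
    have h1 := vn_vecMul_le x T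
    have h2 := mul_le_mul (hN1 y hy) h1 (vn_nonneg _) zero_le_one
    have h3 := mul_le_mul_of_nonneg_right (hN1 x hx) (norm_nonneg T)
    change vn y * vn (x ᵥ* T) ≤ ‖T‖
    linarith

/-- Decoupling: the off-diagonal part of a bilinear form is four times the average of its
restrictions to `I × Iᶜ` over all sets of indices `I`. -/
theorem sum_blocks_eq (M : Matrix (Fin n) (Fin n) ℝ) (x y : Fin n → ℝ) :
    4 * ∑ I : Finset (Fin n), (fun i => if i ∈ I then x i else 0) ⬝ᵥ
      (M *ᵥ fun j => if j ∈ I then 0 else y j) = 2 ^ n * (x ⬝ᵥ (hollow M *ᵥ y)) := by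
  -- a pair of distinct indices is separated in a given order by a quarter of all sets
  have hcount (i j : Fin n) : 4 * ∑ I : Finset (Fin n),
      ((if i ∈ I then (1 : ℝ) else 0) * if j ∈ I then 0 else 1) = if i = j then 0 else 2 ^ n := by
    by_cases hij : i = j
    · subst hij
      rw [if_pos rfl, Finset.sum_eq_zero, mul_zero]
      intro I _
      by_cases hi : i ∈ I <;> simp [hi]
    · have hsub : ({i} : Finset (Fin n)) ⊆ Finset.univ.erase j := by simp [hij]
      have h1 : ∑ I : Finset (Fin n), ((if i ∈ I then (1 : ℝ) else 0) * if j ∈ I then 0 else 1) =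
          (Finset.Icc {i} (Finset.univ.erase j)).card := by
        rw [Finset.cast_card, ← Finset.sum_subset (Finset.subset_univ
          (Finset.Icc {i} (Finset.univ.erase j)))]
        · refine Finset.sum_congr rfl fun I hI => ?_
          rw [Finset.mem_Icc] at hI
          have hi : i ∈ I := hI.1 (Finset.mem_singleton_self i)
          have hj : j ∉ I := fun h => Finset.notMem_erase j _ (hI.2 h)
          simp [hi, hj]
        · intro I _ hI
          by_cases hi : i ∈ I
          · by_cases hj : j ∈ I
            · simp [hj]
            · refine absurd (Finset.mem_Icc.mpr ⟨?_, ?_⟩) hI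
              · exact Finset.singleton_subset_iff.mpr hi
              · exact Finset.subset_erase.mpr ⟨Finset.subset_univ _, hj⟩
          · simp [hi]
      have hn : 2 ≤ n := by
        have := Finset.card_le_univ ({i, j} : Finset (Fin n))
        rwa [Finset.card_pair hij, Fintype.card_fin] at this
      rw [h1, Finset.card_Icc_finset hsub, if_neg hij, Finset.card_erase_of_mem (Finset.mem_univ _),
        Finset.card_singleton, Finset.card_univ, Fintype.card_fin]
      obtain ⟨k, rfl⟩ := Nat.exists_eq_add_of_le hn
      have : 2 + k - 1 - 1 = k := by omega
      rw [this]
      push_cast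
      rw [pow_add]
      norm_num
  have h1 (I : Finset (Fin n)) : (fun i => if i ∈ I then x i else 0) ⬝ᵥ
      (M *ᵥ fun j => if j ∈ I then 0 else y j) =
      ∑ i, ∑ j, x i * M i j * y j * ((if i ∈ I then (1 : ℝ) else 0) * if j ∈ I then 0 else 1) := by
    simp only [dotProduct, Matrix.mulVec, Finset.mul_sum]
    refine Finset.sum_congr rfl fun i _ => Finset.sum_congr rfl fun j _ => ?_
    split_ifs <;> ring
  have h2 : x ⬝ᵥ (hollow M *ᵥ y) = ∑ i, ∑ j, x i * M i j * y j * if i = j then 0 else 1 := by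
    simp only [dotProduct, Matrix.mulVec, Finset.mul_sum, hollow, Matrix.of_apply]
    refine Finset.sum_congr rfl fun i _ => Finset.sum_congr rfl fun j _ => ?_
    split_ifs <;> ring
  simp only [h1, h2]
  rw [Finset.sum_comm, Finset.mul_sum, Finset.mul_sum]
  refine Finset.sum_congr rfl fun i _ => ?_
  rw [Finset.sum_comm, Finset.mul_sum, Finset.mul_sum]
  refine Finset.sum_congr rfl fun j _ => ?_
  rw [← Finset.mul_sum, mul_left_comm, hcount]
  split_ifs <;> ring

/-- After decoupling, the Gram matrix is a bilinear form in a block of rows with coefficients that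
depend on the other rows only; the factor `2 ^ n` in the probability counts the blocks. -/
theorem measure_norm_hollow_le (hσ : 0 < σ) (hmeas : ∀ i, Measurable (Z i))
    (hind : iIndepFun Z P) (hsub : ∀ i, HasSubgaussianMGF (Z i) (Real.toNNReal (σ ^ 2)) P)
    (hs : 0 ≤ s) :
    P {ω | 16 * (s * σ * ‖toMat fun i => Z i ω‖) <
      ‖hollow ((toMat fun i => Z i ω) * (toMat fun i => Z i ω)ᵀ)‖} ≤
      ENNReal.ofReal (5 ^ (n + n) * 2 ^ n * Real.exp (-s ^ 2 / 2)) := by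
  obtain ⟨N, hN, hN1, hNd⟩ := exists_net (Fin n)
  have hcard := card_product_net_le hN hN
  rw [Fintype.card_fin] at hcard
  have hcard' : (((N ×ˢ N) ×ˢ (Finset.univ : Finset (Finset (Fin n)))).card : ℝ) ≤
      5 ^ (n + n) * 2 ^ n := by
    rw [Finset.card_product, Nat.cast_mul, Finset.card_univ, Fintype.card_finset, Fintype.card_fin]
    push_cast
    gcongr
  let aI : (Fin n → ℝ) → Finset (Fin n) → Fin n → ℝ := fun x I i => if i ∈ I then x i else 0
  let bI : (Fin n → ℝ) → Finset (Fin n) → Fin n → ℝ := fun y I j => if j ∈ I then 0 else y j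
  refine measure_lt_le_card_mul ((N ×ˢ N) ×ˢ Finset.univ)
    (f := fun q ω => s * σ * (vn (aI q.1.1 q.2) * vn ((toMat fun i => Z i ω)ᵀ *ᵥ bI q.1.2 q.2)))
    (g := fun q ω =>
      aI q.1.1 q.2 ⬝ᵥ (toMat (fun i => Z i ω) *ᵥ ((toMat fun i => Z i ω)ᵀ *ᵥ bI q.1.2 q.2)))
    (Real.exp_pos _).le (fun q _ => ?_) hcard' fun ω hcon => ?_
  · refine measure_bilinear_le hσ hmeas hind hsub hs q.2 (a := aI q.1.1 q.2)
      (b := fun z => (toMat z)ᵀ *ᵥ bI q.1.2 q.2) (fun i hi => if_neg hi) ?_ fun z z' hz => ?_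
    · have := continuous_toMat (n := n) (c := c)
      fun_prop
    · ext j
      simp only [Matrix.mulVec, dotProduct, Matrix.transpose_apply, toMat, Matrix.of_apply, bI]
      refine Finset.sum_congr rfl fun i _ => ?_
      split_ifs with hi
      · simp
      · rw [hz i hi j]
  · set A := toMat fun i => Z i ω with hA
    have e16 : 16 * (s * σ * ‖A‖) = 4 * (4 * (s * σ * ‖A‖)) := by ring
    rw [e16]
    refine norm_le_of_net hNd hNd (by positivity) fun x hx y hy => ?_
    have hI (I : Finset (Fin n)) : aI x I ⬝ᵥ ((A * Aᵀ) *ᵥ bI y I) ≤ s * σ * ‖A‖ := by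
      have := hcon ((x, y), I) (Finset.mem_product.mpr
        ⟨Finset.mem_product.mpr ⟨hx, hy⟩, Finset.mem_univ _⟩)
      rw [← Matrix.mulVec_mulVec]
      refine this.trans (mul_le_mul_of_nonneg_left ?_ (by positivity))
      have h1 : vn (aI x I) ≤ 1 := by
        refine (vn_le_of_abs_le fun i => ?_).trans (hN1 x hx)
        simp only [aI]; split_ifs <;> simp
      have h2 : vn (bI y I) ≤ 1 := by
        refine (vn_le_of_abs_le fun i => ?_).trans (hN1 y hy)
        simp only [bI]; split_ifs <;> simp
      have h3 := vn_mulVec_le Aᵀ (bI y I)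
      rw [norm_transpose] at h3
      have h4 : vn (Aᵀ *ᵥ bI y I) ≤ ‖A‖ := h3.trans (mul_le_of_le_one_right (norm_nonneg _) h2)
      exact (mul_le_of_le_one_left (vn_nonneg _) h1).trans h4
    have hsum := sum_blocks_eq (A * Aᵀ) x y
    have hle : ∑ I : Finset (Fin n), aI x I ⬝ᵥ ((A * Aᵀ) *ᵥ bI y I) ≤ 2 ^ n * (s * σ * ‖A‖) := by
      refine (Finset.sum_le_sum fun I _ => hI I).trans_eq ?_
      rw [Finset.sum_const, Finset.card_univ, Fintype.card_finset, Fintype.card_fin, nsmul_eq_mul]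
      push_cast; ring
    have h2n : (0 : ℝ) < 2 ^ n := by positivity
    refine le_of_mul_le_mul_left ?_ h2n
    rw [← hsum]
    change 4 * ∑ I : Finset (Fin n), aI x I ⬝ᵥ ((A * Aᵀ) *ᵥ bI y I) ≤ _
    linarith

end Events

/-! ### The leave-one-out noise terms and the exceptional event -/

section LeaveOneOutEvent

variable {Ω : Type*} [MeasurableSpace Ω] {P : Measure Ω} [IsProbabilityMeasure P]
  {n r : ℕ} {c : Type*} [Fintype c] [DecidableEq c] {Z : Fin n × c → Ω → ℝ} {σ s : ℝ}

theorem continuous_dropRow (m : Fin n) :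
    Continuous (dropRow m : Matrix (Fin n) c ℝ → Matrix (Fin n) c ℝ) := by
  refine continuous_matrix fun i j => ?_
  simp only [dropRow, Matrix.of_apply]
  split_ifs
  · exact continuous_const
  · exact continuous_id.matrix_elem i j

theorem continuous_gram (T : Matrix (Fin n) c ℝ) :
    Continuous (gram T : Matrix (Fin n) c ℝ → Matrix (Fin n) (Fin n) ℝ) := by
  refine continuous_matrix fun i j => ?_
  simp only [gram, hollow, Matrix.of_apply]
  split_ifs
  · exact continuous_const
  · exact Continuous.matrix_elem (by fun_prop) i j

theorem noiseRow_eq (T A : Matrix (Fin n) c ℝ) (m : Fin n) :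
    noiseRow T A m = (A * (dropRow m (T + A))ᵀ).row m := by
  ext i
  simp only [noiseRow, hollow, dropRow, Matrix.row_apply, Matrix.of_apply, Matrix.mul_apply,
    Matrix.transpose_apply]
  by_cases h : m = i
  · subst h; simp
  · simp [h, Ne.symm h]

/-- The projection `V * Vᵀ` does not involve the `m`-th row of the noise. Given the other rows, each
coordinate of `noiseRow T Z m ᵥ* (V * Vᵀ)` is therefore subgaussian, and the variance proxies add up
to a squared Frobenius norm, at most `r * (σ * ‖T + Z‖) ^ 2`. -/
theorem exists_event_noiseRow (hσ : 0 < σ) (hmeas : ∀ i, Measurable (Z i))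
    (hind : iIndepFun Z P) (hsub : ∀ i, HasSubgaussianMGF (Z i) (Real.toNNReal (σ ^ 2)) P)
    (hs : 0 ≤ s) (T : Matrix (Fin n) c ℝ) {a b : ℝ} (hab : b < a) :
    ∃ B : Set Ω, P B ≤ ENNReal.ofReal (2 * (n : ℝ) ^ 2 * Real.exp (-s ^ 2 / 2)) ∧
      ∀ ω ∉ B, ∀ (m : Fin n) (V : Matrix (Fin n) (Fin r) ℝ),
        IsGapEigenvectors (gram T (dropRow m (toMat fun i => Z i ω))) V a b →
        vn (noiseRow T (toMat fun i => Z i ω) m ᵥ* V) ≤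
          s * σ * (√r * ‖T + toMat fun i => Z i ω‖) := by
  obtain ⟨Φ, hΦ, hΦV⟩ := exists_continuous_projection n r hab
  -- one tail event for every row `m`, coordinate `j` and sign
  let sg : Bool → ℝ := fun e => if e then 1 else -1
  let a' : Bool → Fin n → Fin n → ℝ := fun e m => Pi.single m (sg e)
  let b' : Fin n → Fin n → (Fin n × c → ℝ) → c → ℝ := fun m j z =>
    (dropRow m (T + toMat z))ᵀ *ᵥ (Φ (gram T (dropRow m (toMat z)))).col j
  let Bad : Fin n × Fin n × Bool → Set Ω := fun q => {ω | s * σ * (vn (a' q.2.2 q.1) *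
    vn (b' q.1 q.2.1 fun i => Z i ω)) <
      a' q.2.2 q.1 ⬝ᵥ (toMat (fun i => Z i ω) *ᵥ b' q.1 q.2.1 fun i => Z i ω)}
  refine ⟨⋃ q ∈ (Finset.univ : Finset (Fin n × Fin n × Bool)), Bad q, ?_, ?_⟩
  · refine measure_le_card_mul Finset.univ (Real.exp_pos _).le (fun q _ => ?_) ?_ subset_rfl
    · refine measure_bilinear_le hσ hmeas hind hsub hs {q.1} (a := a' q.2.2 q.1)
        (b := b' q.1 q.2.1) (fun i hi => ?_) ?_ fun z z' hz => ?_
      · simp only [Finset.mem_singleton] at hi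
        simp [a', hi]
      · have h1 := continuous_toMat (n := n) (c := c)
        have h2 := continuous_dropRow (c := c) q.1
        have h3 := continuous_gram T
        have h4 : Continuous fun z : Fin n × c → ℝ => (dropRow q.1 (T + toMat z))ᵀ := by fun_prop
        have h5 : Continuous fun z : Fin n × c → ℝ => Φ (gram T (dropRow q.1 (toMat z))) := by
          fun_prop
        refine h4.matrix_mulVec (continuous_pi fun i => ?_)
        exact h5.matrix_elem i q.2.1
      · have e1 : dropRow q.1 (toMat z) = dropRow q.1 (toMat z') := by
          ext i j
          simp only [dropRow, toMat, Matrix.of_apply]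
          split_ifs with hi
          · rfl
          · exact hz i (by simpa using hi) j
        have e2 : dropRow q.1 (T + toMat z) = dropRow q.1 (T + toMat z') := by
          ext i j
          simp only [dropRow, toMat, Matrix.of_apply, Matrix.add_apply]
          split_ifs with hi
          · rfl
          · rw [hz i (by simpa using hi) j]
        simp only [b', e1, e2]
    · rw [Finset.card_univ, Fintype.card_prod, Fintype.card_prod, Fintype.card_fin,
        Fintype.card_bool]
      push_cast
      exact le_of_eq (by ring)
  · intro ω hω m V hV
    simp only [Set.mem_iUnion, not_exists] at hω
    set A := toMat fun i => Z i ω with hA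
    have hΦA := hΦV _ V hV
    set Q := V * Vᵀ with hQ
    set A' := dropRow m (T + A) with hA'
    have hj (j : Fin n) : |(noiseRow T A m ᵥ* Q) j| ≤ s * σ * vn ((Qᵀ * A').row j) := by
      have hb : b' m j (fun i => Z i ω) = (Qᵀ * A').row j := by
        simp only [b']
        rw [← hA, ← hA', hΦA, row_mul, ← Matrix.mulVec_transpose]
        rfl
      have hsgn (e : Bool) : sg e * (noiseRow T A m ᵥ* Q) j ≤ s * σ * vn ((Qᵀ * A').row j) := by
        have h1 : a' e m ⬝ᵥ (A *ᵥ b' m j fun i => Z i ω) ≤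
            s * σ * (vn (a' e m) * vn (b' m j fun i => Z i ω)) :=
          not_lt.mp (show ¬ _ < _ from hω (m, j, e) (Finset.mem_univ _))
        rw [hb] at h1
        have h2 : vn (a' e m) = 1 := by
          have : a' e m = sg e • Pi.single m 1 := by
            ext i; simp [a', Pi.single_apply]
          rw [this, vn_smul, vn_single, mul_one]
          cases e <;> simp [sg]
        rw [h2, one_mul] at h1
        refine le_trans (le_of_eq ?_) h1
        rw [noiseRow_eq, ← hA', single_dotProduct]
        congr 1
        have e1 : (Qᵀ * A').row j = A'ᵀ *ᵥ Q.col j := by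
          rw [row_mul, ← Matrix.mulVec_transpose]
          rfl
        rw [e1, Matrix.mulVec_mulVec]
        rfl
      rw [abs_le]
      have h1 := hsgn true
      have h2 := hsgn false
      simp only [sg, if_true, Bool.false_eq_true, if_false] at h1 h2
      constructor <;> linarith
    rw [← vn_vecMul_mul_transpose hV.1, ← hQ]
    have h1 : vn (noiseRow T A m ᵥ* Q) ≤ s * σ * frobNorm (Qᵀ * A') := by
      refine le_of_sq_le_sq ?_ (mul_nonneg (by positivity) (frobNorm_nonneg _))
      rw [vn_sq_eq_sum, mul_pow, frobNorm_sq, Finset.mul_sum]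
      refine Finset.sum_le_sum fun j _ => ?_
      rw [← sq_abs, ← mul_pow]
      exact pow_le_pow_left₀ (abs_nonneg _) (hj j) 2
    refine h1.trans (mul_le_mul_of_nonneg_left ?_ (by positivity))
    have h2 : frobNorm Qᵀ ≤ √r := by
      rw [frobNorm_transpose, hQ]
      have h3 := frobNorm_mul_le V Vᵀ
      rw [norm_transpose] at h3
      have h4 : frobNorm V = √r := by
        rw [← Real.sqrt_sq (frobNorm_nonneg V), frobNorm_sq_of_orthonormal hV.1, Fintype.card_fin]
      rw [h4] at h3
      exact h3.trans (mul_le_of_le_one_right (Real.sqrt_nonneg _) (norm_le_one_of_orthonormal hV.1))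
    have h5 : ‖A'‖ ≤ ‖T + A‖ := by
      rw [hA', dropRow_eq_mul]
      exact norm_mul_le_of_norm_le_one (norm_dropDiagonal_le m) _
    exact (frobNorm_mul_le _ _).trans (mul_le_mul h2 h5 (norm_nonneg _) (Real.sqrt_nonneg _))

theorem pow_mul_exp_le {ℓ x : ℝ} (hℓ : 0 ≤ ℓ) (hx0 : 0 ≤ x) (hx : x ≤ 50) (k : ℕ) :
    x ^ k * Real.exp (-√(40 * (k + ℓ)) ^ 2 / 2) ≤ Real.exp (-20 * ℓ) := by
  rw [Real.sq_sqrt (by positivity)]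
  have h1 : x ^ k ≤ Real.exp (20 * k) := by
    have h2 : (50 : ℝ) ≤ Real.exp 20 := by
      have h3 := Real.add_one_le_exp (10 : ℝ)
      have h4 : Real.exp 20 = Real.exp 10 * Real.exp 10 := by rw [← Real.exp_add]; norm_num
      nlinarith
    calc x ^ k ≤ Real.exp 20 ^ k := pow_le_pow_left₀ hx0 (hx.trans h2) k
      _ = Real.exp (20 * k) := by rw [← Real.exp_nat_mul, mul_comm]
  calc x ^ k * Real.exp (-(40 * (k + ℓ)) / 2)
      ≤ Real.exp (20 * k) * Real.exp (-(40 * (k + ℓ)) / 2) := by gcongr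
    _ = Real.exp (-20 * ℓ) := by rw [← Real.exp_add]; ring_nf

/-- All the estimates on the noise of one mode hold together, outside an event of probability at
most `5 * exp (-20 * ℓ)`. The constants `40` and `44` absorb the cardinalities of the nets and of
the blocks, exponential in the dimension, and the `2 * n ^ 2` tail events of the leave-one-out
terms. -/
theorem exists_event (hσ : 0 < σ) (hmeas : ∀ i, Measurable (Z i))
    (hind : iIndepFun Z P) (hsub : ∀ i, HasSubgaussianMGF (Z i) (Real.toNNReal (σ ^ 2)) P)
    {ℓ : ℝ} (hℓ : 0 ≤ ℓ) (hn : (n : ℝ) ≤ Real.exp ℓ)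
    (T : Matrix (Fin n) c ℝ) {a b : ℝ} (hab : b < a) :
    ∃ B : Set Ω, P B ≤ ENNReal.ofReal (5 * Real.exp (-20 * ℓ)) ∧
      ∀ ω ∉ B, ‖toMat fun i => Z i ω‖ ≤ 4 * (√(40 * ((n + Fintype.card c : ℕ) + ℓ)) * σ) ∧
        ‖T * (toMat fun i => Z i ω)ᵀ‖ ≤ 4 * (√(40 * (n + ℓ)) * σ * ‖T‖) ∧
        ‖hollow ((toMat fun i => Z i ω) * (toMat fun i => Z i ω)ᵀ)‖ ≤
          16 * (√(40 * (n + ℓ)) * σ * ‖toMat fun i => Z i ω‖) ∧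
        ∀ (m : Fin n) (V : Matrix (Fin n) (Fin r) ℝ),
          IsGapEigenvectors (gram T (dropRow m (toMat fun i => Z i ω))) V a b →
          vn (noiseRow T (toMat fun i => Z i ω) m ᵥ* V) ≤
            √(44 * ℓ) * σ * (√r * ‖T + toMat fun i => Z i ω‖) := by
  obtain ⟨B, hB, hBV⟩ := exists_event_noiseRow (r := r) hσ hmeas hind hsub
    (Real.sqrt_nonneg (44 * ℓ)) T hab
  have h1 := measure_norm_noise_le hσ hmeas hind hsub
    (Real.sqrt_nonneg (40 * (((n + Fintype.card c : ℕ) : ℝ) + ℓ)))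
  have h2 := measure_norm_cross_le hσ hmeas hind hsub (Real.sqrt_nonneg (40 * ((n : ℝ) + ℓ))) T
  have h3 := measure_norm_hollow_le hσ hmeas hind hsub (Real.sqrt_nonneg (40 * ((n : ℝ) + ℓ)))
  set E := Real.exp (-20 * ℓ) with hE
  have hE0 : 0 < E := Real.exp_pos _
  have q1 := pow_mul_exp_le (x := 5) hℓ (by norm_num) (by norm_num) (n + Fintype.card c)
  have q2 := pow_mul_exp_le (x := 25) hℓ (by norm_num) (by norm_num) n
  have q3 := pow_mul_exp_le (x := 50) hℓ (by norm_num) (by norm_num) n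
  have e2 : (5 : ℝ) ^ (n + n) = 25 ^ n := by rw [pow_add, ← mul_pow]; norm_num
  have e3 : (5 : ℝ) ^ (n + n) * 2 ^ n = 50 ^ n := by rw [e2, ← mul_pow]; norm_num
  rw [e2] at h2
  rw [e3] at h3
  have q4 : 2 * (n : ℝ) ^ 2 * Real.exp (-√(44 * ℓ) ^ 2 / 2) ≤ 2 * E := by
    rw [Real.sq_sqrt (by positivity)]
    have : E = Real.exp ℓ ^ 2 * Real.exp (-(44 * ℓ) / 2) := by
      rw [hE, ← Real.exp_nat_mul, ← Real.exp_add]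
      congr 1; push_cast; ring
    rw [this, mul_assoc]
    gcongr
  refine ⟨{ω | 4 * (√(40 * ((n + Fintype.card c : ℕ) + ℓ)) * σ) < ‖toMat fun i => Z i ω‖} ∪
    ({ω | 4 * (√(40 * (n + ℓ)) * σ * ‖T‖) < ‖T * (toMat fun i => Z i ω)ᵀ‖} ∪
    ({ω | 16 * (√(40 * (n + ℓ)) * σ * ‖toMat fun i => Z i ω‖) <
      ‖hollow ((toMat fun i => Z i ω) * (toMat fun i => Z i ω)ᵀ)‖} ∪ B)), ?_, fun ω hω => ?_⟩
  rotate_left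
  · simp only [Set.mem_union, not_or] at hω
    exact ⟨not_lt.mp (show ¬ _ < _ from hω.1), not_lt.mp (show ¬ _ < _ from hω.2.1),
      not_lt.mp (show ¬ _ < _ from hω.2.2.1), hBV ω hω.2.2.2⟩
  · refine (measure_union_le _ _).trans (le_trans (add_le_add
      (h1.trans (ENNReal.ofReal_le_ofReal q1))
      ((measure_union_le _ _).trans (add_le_add (h2.trans (ENNReal.ofReal_le_ofReal q2))
      ((measure_union_le _ _).trans (add_le_add (h3.trans (ENNReal.ofReal_le_ofReal q3))
        (hB.trans (ENNReal.ofReal_le_ofReal q4))))))) ?_)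
    rw [← ENNReal.ofReal_add hE0.le (by positivity), ← ENNReal.ofReal_add hE0.le (by positivity),
      ← ENNReal.ofReal_add hE0.le (by positivity)]
    exact ENNReal.ofReal_le_ofReal (by linarith)

end LeaveOneOutEvent

/-! ### Singular vectors of the signal -/

section Signal

variable {n r : ℕ} {c : Type*} [Fintype c] [DecidableEq c] {T : Matrix (Fin n) c ℝ}
  {U : Matrix (Fin n) (Fin r) ℝ}

theorem finrank_range_toEuclideanLin (T : Matrix (Fin n) c ℝ) :
    Module.finrank ℝ (Matrix.toEuclideanLin T).range = T.rank := by
  rw [Matrix.rank_eq_finrank_range_toLin T (EuclideanSpace.basisFun (Fin n) ℝ).toBasis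
    (EuclideanSpace.basisFun c ℝ).toBasis]
  rw [Matrix.toEuclideanLin_eq_toLin_orthonormal]

theorem minSingularValue_pos (hr : 1 ≤ T.rank) : 0 < minSingularValue T := by
  rw [minSingularValue, LinearMap.singularValues_pos_iff_lt_finrank_range,
    finrank_range_toEuclideanLin]
  omega

/-- A nonzero eigenvalue of `T Tᵀ` is at least the square of the smallest nonzero singular value. -/
theorem sq_minSingularValue_le {d : ℝ} (hd : 0 < d) {x : Fin n → ℝ} (hx : x ≠ 0)
    (h : (T * Tᵀ) *ᵥ x = d • x) : minSingularValue T ^ 2 ≤ d := by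
  set F := Matrix.toEuclideanLin T with hF
  have hadj : LinearMap.adjoint F = Matrix.toEuclideanLin Tᵀ := by
    rw [hF, ← Matrix.toEuclideanLin_conjTranspose_eq_adjoint,
      Matrix.conjTranspose_eq_transpose_of_trivial]
  have hev : Module.End.HasEigenvalue (LinearMap.adjoint F ∘ₗ F) d := by
    refine Module.End.hasEigenvalue_of_hasEigenvector (x := WithLp.toLp 2 (Tᵀ *ᵥ x))
      (Module.End.hasEigenvector_iff.mpr ⟨Module.End.mem_eigenspace_iff.mpr ?_, ?_⟩)
    · rw [hadj]
      have : Tᵀ *ᵥ (T *ᵥ (Tᵀ *ᵥ x)) = d • (Tᵀ *ᵥ x) := by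
        rw [Matrix.mulVec_mulVec _ T, h, Matrix.mulVec_smul]
      exact congrArg (WithLp.toLp 2) this
    · intro h0
      have h1 : Tᵀ *ᵥ x = 0 := by simpa using h0
      rw [← Matrix.mulVec_mulVec, h1, Matrix.mulVec_zero] at h
      exact (smul_ne_zero hd.ne' hx) h.symm
  obtain ⟨j, hj⟩ := F.isSymmetric_adjoint_comp_self.exists_eigenvalues_eq rfl hev
  have hsq := F.sq_singularValues_fin rfl j
  have hj' : F.singularValues j ^ 2 = d := by rw [hsq]; exact hj
  have hpos : 0 < F.singularValues j := by
    rcases (F.singularValues_nonneg j).eq_or_lt with h0 | h0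
    · rw [← h0] at hj'; norm_num at hj'; exact absurd hj' hd.ne
    · exact h0
  have hlt := LinearMap.singularValues_pos_iff_lt_finrank_range _ |>.mp hpos
  rw [finrank_range_toEuclideanLin] at hlt
  rw [← hj', minSingularValue]
  exact pow_le_pow_left₀ (LinearMap.singularValues_nonneg _ _)
    (F.singularValues_antitone (by omega)) 2

theorem mulVec_col_of_mul_eq {M : Matrix (Fin n) (Fin n) ℝ} {d : Fin r → ℝ}
    (h : M * U = U * Matrix.diagonal d) (i : Fin r) : M *ᵥ U.col i = d i • U.col i := by
  ext k
  have := congrFun (congrFun h k) i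
  rw [Matrix.mul_diagonal] at this
  simp only [Pi.smul_apply, smul_eq_mul, Matrix.col_apply]
  rw [mul_comm, ← this]
  rfl

/-- If one of the `r` leading eigenvalues vanished, then `T` would have rank less than `r`. -/
theorem IsLeadingLeftSingular.eigenvalue_pos {d : Fin r → ℝ} (hU : Uᵀ * U = 1)
    (hd : T * Tᵀ * U = U * Matrix.diagonal d)
    (hlead : ∀ x : Fin n → ℝ, Uᵀ *ᵥ x = 0 → ∀ i, x ⬝ᵥ ((T * Tᵀ) *ᵥ x) ≤ d i * (x ⬝ᵥ x))
    (hrank : T.rank = r) (i : Fin r) : 0 < d i := by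
  have hform (x : Fin n → ℝ) : x ⬝ᵥ ((T * Tᵀ) *ᵥ x) = vn (Tᵀ *ᵥ x) ^ 2 := by
    rw [vn_sq, ← Matrix.mulVec_mulVec, Matrix.dotProduct_mulVec, ← Matrix.mulVec_transpose]
  have hnorm : U.col i ⬝ᵥ U.col i = 1 := by
    have := congrFun (congrFun hU i) i
    rw [Matrix.one_apply_eq] at this
    exact this
  have hdi : d i = vn (Tᵀ *ᵥ U.col i) ^ 2 := by
    rw [← hform, mulVec_col_of_mul_eq hd, dotProduct_smul, hnorm, smul_eq_mul, mul_one]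
  by_contra hcon
  have h0 : d i = 0 := le_antisymm (not_lt.mp hcon) (by rw [hdi]; positivity)
  have hz {x : Fin n → ℝ} (hx : vn (Tᵀ *ᵥ x) ^ 2 ≤ 0) : Tᵀ *ᵥ x = 0 := by
    by_contra hne
    have := pow_pos (vn_pos hne) 2
    linarith
  have hcol : Tᵀ *ᵥ U.col i = 0 := hz (by rw [← hdi, h0])
  have hperp (x : Fin n → ℝ) (hx : Uᵀ *ᵥ x = 0) : Tᵀ *ᵥ x = 0 := by
    have := hlead x hx i
    rw [hform, h0, zero_mul] at this
    exact hz this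
  -- `Tᵀ` then factors through the coordinates other than the `i`-th
  let U' : Matrix (Fin n) {j : Fin r // j ≠ i} ℝ := U.submatrix id Subtype.val
  have hfac : Tᵀ = Tᵀ * U' * U'ᵀ := by
    have h1 : Tᵀ = Tᵀ * U * Uᵀ := by
      apply Matrix.ext_of_mulVec_single
      intro k
      have h2 := hperp (Pi.single k 1 - U *ᵥ (Uᵀ *ᵥ Pi.single k 1)) (by
        rw [Matrix.mulVec_sub, Matrix.mulVec_mulVec _ Uᵀ U, hU, Matrix.one_mulVec, sub_self])
      rw [Matrix.mulVec_sub, sub_eq_zero] at h2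
      rw [h2, Matrix.mulVec_mulVec, Matrix.mulVec_mulVec, Matrix.mul_assoc]
    have h3 : Tᵀ * U * Uᵀ = Tᵀ * U' * U'ᵀ := by
      ext a b
      rw [Matrix.mul_apply, Matrix.mul_apply]
      have h4 : (Tᵀ * U) a i = 0 := congrFun hcol a
      rw [← Finset.add_sum_erase _ _ (Finset.mem_univ i), h4, zero_mul, zero_add]
      exact Finset.sum_subtype (p := fun j => j ≠ i) (Finset.univ.erase i) (by simp)
        (fun j => (Tᵀ * U) a j * Uᵀ j b)
    rw [← h3]; exact h1
  have h5 : T.rank ≤ Fintype.card {j : Fin r // j ≠ i} := by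
    rw [← Matrix.rank_transpose, hfac]
    exact (Matrix.rank_mul_le_right _ _).trans (Matrix.rank_le_card_height _)
  have h6 : Fintype.card {j : Fin r // j ≠ i} < Fintype.card (Fin r) :=
    Fintype.card_subtype_lt (x := i) (by simp)
  rw [Fintype.card_fin] at h6
  omega

theorem IsLeadingLeftSingular.isSignal (hU : IsLeadingLeftSingular T U) (hrank : T.rank = r) :
    IsSignal T U (minSingularValue T) := by
  obtain ⟨hUU, d, hd, hlead⟩ := hU
  have hpos := IsLeadingLeftSingular.eigenvalue_pos hUU hd hlead hrank
  have hne (i : Fin r) : U.col i ≠ 0 := by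
    intro h
    have := congrFun (congrFun hUU i) i
    rw [Matrix.one_apply_eq] at this
    have h2 : U.col i ⬝ᵥ U.col i = 1 := this
    rw [h, dotProduct_zero] at h2
    exact zero_ne_one h2
  refine ⟨hUU, ?_, fun z => ?_⟩
  · -- the columns of `U` lie in the column space of `T`, which has the same dimension
    have hUT : U = T * (Tᵀ * U * Matrix.diagonal fun i => (d i)⁻¹) := by
      have h1 : (fun i => d i * (d i)⁻¹) = fun _ => (1 : ℝ) := by
        funext i; exact mul_inv_cancel₀ (hpos i).ne'
      rw [← Matrix.mul_assoc, ← Matrix.mul_assoc, hd, Matrix.mul_assoc,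
        Matrix.diagonal_mul_diagonal, h1, Matrix.diagonal_one, Matrix.mul_one]
    have hle : U.mulVecLin.range ≤ T.mulVecLin.range := by
      rintro _ ⟨x, rfl⟩
      refine ⟨(Tᵀ * U * Matrix.diagonal fun i => (d i)⁻¹) *ᵥ x, ?_⟩
      rw [Matrix.mulVecLin_apply, Matrix.mulVecLin_apply, Matrix.mulVec_mulVec, ← hUT]
    have hrU : U.rank = r := by
      refine le_antisymm (by simpa using U.rank_le_card_width) ?_
      have h1 := Matrix.rank_mul_le_right Uᵀ U
      rwa [hUU, Matrix.rank_one, Fintype.card_fin] at h1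
    have heq : U.mulVecLin.range = T.mulVecLin.range :=
      Submodule.eq_of_le_of_finrank_eq hle (hrU.trans hrank.symm)
    apply Matrix.ext_of_mulVec_single
    intro k
    have hmem : T *ᵥ Pi.single k 1 ∈ U.mulVecLin.range := by
      rw [heq]; exact ⟨_, rfl⟩
    obtain ⟨y, hy⟩ := hmem
    rw [Matrix.mulVecLin_apply] at hy
    rw [← Matrix.mulVec_mulVec, ← Matrix.mulVec_mulVec, ← hy, Matrix.mulVec_mulVec _ Uᵀ U, hUU,
      Matrix.one_mulVec]
  · have e : (U *ᵥ z) ⬝ᵥ ((T * Tᵀ) *ᵥ (U *ᵥ z)) = ∑ i, d i * (z i * z i) := by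
      rw [Matrix.mulVec_mulVec, hd, ← Matrix.mulVec_mulVec, dotProduct_mulVec_orthonormal hUU,
        dotProduct]
      refine Finset.sum_congr rfl fun i _ => ?_
      rw [Matrix.mulVec_diagonal]; ring
    rw [e, dotProduct, Finset.mul_sum]
    exact Finset.sum_le_sum fun i _ => mul_le_mul_of_nonneg_right
      (sq_minSingularValue_le (hpos i) (hne i) (mulVec_col_of_mul_eq hd i)) (mul_self_nonneg _)

theorem IsSignal.le_norm {L : ℝ} (hT : IsSignal T U L) (hr : 1 ≤ r) : L ≤ ‖T‖ := by
  have h := hT.le_form (Pi.single ⟨0, hr⟩ 1)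
  set z : Fin r → ℝ := Pi.single ⟨0, hr⟩ 1
  have hz : z ⬝ᵥ z = 1 := by simp [z]
  have h1 : (U *ᵥ z) ⬝ᵥ ((T * Tᵀ) *ᵥ (U *ᵥ z)) = vn (Tᵀ *ᵥ (U *ᵥ z)) ^ 2 := by
    rw [vn_sq, ← Matrix.mulVec_mulVec, Matrix.dotProduct_mulVec, ← Matrix.mulVec_transpose]
  have h2 := vn_mulVec_le Tᵀ (U *ᵥ z)
  have h3 : vn (U *ᵥ z) = 1 := by
    rw [vn_mulVec_of_orthonormal hT.orthonormal]
    have := vn_sq z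
    rw [hz] at this
    exact (pow_eq_one_iff_of_nonneg (vn_nonneg _) two_ne_zero).mp this
  rw [norm_transpose, h3, mul_one] at h2
  rw [hz, mul_one, h1] at h
  refine le_of_sq_le_sq (h.trans ?_) (norm_nonneg _)
  exact pow_le_pow_left₀ (vn_nonneg _) h2 2

/-- The deleted diagonal is small by incoherence. -/
theorem IsSignal.norm_diagonal_le {L u : ℝ} (hT : IsSignal T U L) (hu : ∀ i, vn (U.row i) ≤ u) :
    ‖(Matrix.diagonal (T * Tᵀ).diag : Matrix (Fin n) (Fin n) ℝ)‖ ≤ (u * ‖T‖) ^ 2 := by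
  refine TensorInit.norm_diagonal_le (sq_nonneg _) fun i => ?_
  have e : (T * Tᵀ).diag i = vn (T.row i) ^ 2 := by
    rw [vn_sq]; rfl
  rw [e, abs_of_nonneg (sq_nonneg _)]
  refine pow_le_pow_left₀ (vn_nonneg _) ?_ 2
  have h1 : T.row i = U.row i ᵥ* (Uᵀ * T) := by
    rw [← row_mul, hT.proj_mul]
  rw [h1]
  refine (vn_vecMul_le _ _).trans (mul_le_mul (hu i) ?_ (norm_nonneg _)
    ((vn_nonneg _).trans (hu i)))
  exact norm_mul_le_of_norm_le_one
    (by rw [norm_transpose]; exact norm_le_one_of_orthonormal hT.orthonormal) _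

end Signal

/-! ### Arithmetic of the error terms -/

section Arithmetic

/-- The quantities in the error bound: `n` and `q` are the dimensions of the matricization, `ℓ` is
the logarithm of the largest dimension, and `ρ` is the signal-to-noise ratio. In units of the noise
level, `s₁` is the order of the spectral norm of the noise and `s₂` that of its product with a fixed
matrix of norm one and `n` rows. The last two fields say that the cross term and the hollowed Gram
matrix of the noise are small compared with the squared signal. -/
structure RateBounds (n q r ℓ μ κ ρ s₁ s₂ : ℝ) : Prop where
  one_le_n : 1 ≤ n
  q_nonneg : 0 ≤ q
  r_nonneg : 0 ≤ r
  one_le_ℓ : 1 ≤ ℓ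
  one_le_μ : 1 ≤ μ
  one_le_κ : 1 ≤ κ
  ρ_pos : 0 < ρ
  s₁_eq : s₁ = √(40 * (n + q + ℓ))
  s₂_eq : s₂ = √(40 * (n + ℓ))
  s₂_le : κ * s₂ / ρ ≤ 1 / 640
  s₁s₂_le : s₁ * s₂ / ρ ^ 2 ≤ 1 / 2560

variable {n q r ℓ μ κ ρ s₁ s₂ : ℝ}

theorem RateBounds.s₂_div_le (h : RateBounds n q r ℓ μ κ ρ s₁ s₂) : s₂ / ρ ≤ 1 := by
  have h0 : 0 ≤ s₂ := by rw [h.s₂_eq]; positivity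
  have h1 := h.s₂_le
  have hρ := h.ρ_pos
  have h2 : s₂ / ρ ≤ κ * s₂ / ρ := by
    gcongr
    exact le_mul_of_one_le_left h0 h.one_le_κ
  linarith

theorem RateBounds.s₁_le (h : RateBounds n q r ℓ μ κ ρ s₁ s₂) : s₁ ≤ s₂ + 7 * √q := by
  have h1 := h.one_le_n
  have h2 := h.q_nonneg
  have h3 := h.one_le_ℓ
  rw [h.s₁_eq, h.s₂_eq]
  refine Real.sqrt_le_iff.mpr ⟨by positivity, ?_⟩
  have e1 := Real.sq_sqrt (show 0 ≤ 40 * (n + ℓ) by positivity)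
  have e2 := Real.sq_sqrt h2
  have e3 : 0 ≤ √(40 * (n + ℓ)) * √q := by positivity
  nlinarith

theorem RateBounds.u_mul_s₂_le (h : RateBounds n q r ℓ μ κ ρ s₁ s₂) :
    μ * √(r / n) * s₂ ≤ 9 * (μ * √(r * ℓ)) := by
  have h1 := h.one_le_n
  have h3 := h.one_le_ℓ
  have hr := h.r_nonneg
  have hμ := h.one_le_μ
  rw [h.s₂_eq, mul_assoc, ← Real.sqrt_mul (by positivity)]
  have e : √(r / n * (40 * (n + ℓ))) ≤ 9 * √(r * ℓ) := by
    refine Real.sqrt_le_iff.mpr ⟨by positivity, ?_⟩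
    rw [mul_pow, Real.sq_sqrt (by positivity), div_mul_eq_mul_div, div_le_iff₀ (by linarith)]
    have : n + ℓ ≤ 2 * (n * ℓ) := by nlinarith
    nlinarith
  calc μ * √(r / n * (40 * (n + ℓ))) ≤ μ * (9 * √(r * ℓ)) := by gcongr
    _ = _ := by ring

theorem sqrt_mul_sqrt_le {r q ℓ : ℝ} (hr : 0 ≤ r) (hℓ : 1 ≤ ℓ) :
    √(r * ℓ) * √q ≤ √(r * q) * ℓ := by
  rw [Real.sqrt_mul hr, Real.sqrt_mul hr]
  have : √ℓ ≤ ℓ := by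
    refine Real.sqrt_le_iff.mpr ⟨by linarith, by nlinarith⟩
  calc √r * √ℓ * √q = √r * √q * √ℓ := by ring
    _ ≤ _ := by gcongr

/-- The contribution of `√(r ℓ) s₁ / ρ ^ 2`. -/
theorem RateBounds.mul_s₁_le (h : RateBounds n q r ℓ μ κ ρ s₁ s₂) :
    √(r * ℓ) * s₁ / ρ ^ 2 ≤ κ * √(r * ℓ) / ρ + 7 * (√(r * q) * ℓ / ρ ^ 2) := by
  have hρ := h.ρ_pos
  have h1 := h.s₂_div_le
  have h2 := h.s₁_le
  have h3 := sqrt_mul_sqrt_le (q := q) h.r_nonneg h.one_le_ℓ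
  have hκ := h.one_le_κ
  have h4 : √(r * ℓ) * s₁ / ρ ^ 2 ≤ √(r * ℓ) / ρ * (s₂ / ρ) + 7 * (√(r * ℓ) * √q / ρ ^ 2) := by
    have : √(r * ℓ) / ρ * (s₂ / ρ) + 7 * (√(r * ℓ) * √q / ρ ^ 2) =
        √(r * ℓ) * (s₂ + 7 * √q) / ρ ^ 2 := by field_simp
    rw [this]
    gcongr
  have h5 : √(r * ℓ) / ρ * (s₂ / ρ) ≤ κ * √(r * ℓ) / ρ := by
    calc √(r * ℓ) / ρ * (s₂ / ρ) ≤ √(r * ℓ) / ρ * 1 := by gcongr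
      _ = 1 * √(r * ℓ) / ρ := by ring
      _ ≤ κ * √(r * ℓ) / ρ := by gcongr
  have h6 : √(r * ℓ) * √q / ρ ^ 2 ≤ √(r * q) * ℓ / ρ ^ 2 := by gcongr
  linarith

/-- The noise terms carrying the incoherent factor `u`, relative to the squared signal. -/
theorem RateBounds.u_mul_le (h : RateBounds n q r ℓ μ κ ρ s₁ s₂) :
    μ * √(r / n) * (16 * (κ * s₂ / ρ) + 64 * (s₁ * s₂ / ρ ^ 2)) ≤
      720 * (κ * μ * √(r * ℓ) / ρ) + 4032 * (μ * √(r * q) * ℓ / ρ ^ 2) := by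
  have hρ := h.ρ_pos
  have h1 := h.u_mul_s₂_le
  have h2 := h.mul_s₁_le
  have hκ := h.one_le_κ
  have hμ := h.one_le_μ
  have hs₁ : 0 ≤ s₁ := by rw [h.s₁_eq]; positivity
  have e : μ * √(r / n) * (16 * (κ * s₂ / ρ) + 64 * (s₁ * s₂ / ρ ^ 2)) =
      (μ * √(r / n) * s₂) * (16 * (κ / ρ) + 64 * (s₁ / ρ ^ 2)) := by field_simp
  have e2 : 9 * (μ * √(r * ℓ)) * (16 * (κ / ρ) + 64 * (s₁ / ρ ^ 2)) =
      144 * (κ * μ * √(r * ℓ) / ρ) + 576 * (μ * (√(r * ℓ) * s₁ / ρ ^ 2)) := by field_simp; ring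
  have e3 : μ * (κ * √(r * ℓ) / ρ + 7 * (√(r * q) * ℓ / ρ ^ 2)) =
      κ * μ * √(r * ℓ) / ρ + 7 * (μ * √(r * q) * ℓ / ρ ^ 2) := by field_simp
  have h3 := mul_le_mul_of_nonneg_left h2 (by linarith : 0 ≤ μ)
  rw [e3] at h3
  rw [e]
  refine (mul_le_mul_of_nonneg_right h1 (by positivity)).trans ?_
  rw [e2]
  linarith

/-- The leave-one-out term, relative to the squared signal. -/
theorem RateBounds.w_le (h : RateBounds n q r ℓ μ κ ρ s₁ s₂) :
    √(44 * ℓ) * √r * (κ / ρ + 4 * (s₁ / ρ ^ 2)) ≤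
      35 * (κ * μ * √(r * ℓ) / ρ) + 196 * (μ * √(r * q) * ℓ / ρ ^ 2) := by
  have hρ := h.ρ_pos
  have h2 := h.mul_s₁_le
  have hκ := h.one_le_κ
  have hμ := h.one_le_μ
  have hℓ := h.one_le_ℓ
  have hs₁ : 0 ≤ s₁ := by rw [h.s₁_eq]; positivity
  have e1 : √(44 * ℓ) * √r ≤ 7 * √(r * ℓ) := by
    rw [← Real.sqrt_mul (by positivity)]
    refine Real.sqrt_le_iff.mpr ⟨by positivity, ?_⟩
    rw [mul_pow, Real.sq_sqrt (mul_nonneg h.r_nonneg (by positivity))]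
    nlinarith [mul_nonneg h.r_nonneg (show 0 ≤ ℓ by positivity)]
  have e2 : 7 * √(r * ℓ) * (κ / ρ + 4 * (s₁ / ρ ^ 2)) =
      7 * (κ * √(r * ℓ) / ρ) + 28 * (√(r * ℓ) * s₁ / ρ ^ 2) := by field_simp; ring
  have e3 : κ * √(r * ℓ) / ρ ≤ κ * μ * √(r * ℓ) / ρ := by
    gcongr
    exact le_mul_of_one_le_right (by positivity) hμ
  have e4 : √(r * q) * ℓ / ρ ^ 2 ≤ μ * √(r * q) * ℓ / ρ ^ 2 := by
    gcongr
    exact le_mul_of_one_le_left (by positivity) hμ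
  refine (mul_le_mul_of_nonneg_right e1 (by positivity)).trans ?_
  rw [e2]
  linarith

end Arithmetic

/-! ### Error bounds for one mode -/

section Mode

variable {n r : ℕ} {c : Type*} [Fintype c] [DecidableEq c] {T Z : Matrix (Fin n) c ℝ}
  {U : Matrix (Fin n) (Fin r) ℝ} {L σ q ℓ μ κ ρ s₁ s₂ : ℝ}

/-- The error bounds for one mode, for noise on which the estimates of `exists_event` hold; the
levels of the gap in `hw` are those left by a perturbation of size `L ^ 2 / 10`. -/
theorem IsSignal.error_bounds (hT : IsSignal T U L) (hL : 0 < L) (hσ : 0 < σ)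
    (hκ : ‖T‖ ≤ κ * L) (hu : ∀ i, vn (U.row i) ≤ μ * √(r / n))
    (hR : RateBounds n q r ℓ μ κ ρ s₁ s₂) (hρ : ρ * σ ≤ L)
    (hE : κ ^ 2 * μ ^ 2 * ((r : ℝ) / n) ≤ 1 / 40) (hr : r ≤ n)
    (hN : ‖Z‖ ≤ 4 * (s₁ * σ)) (hX : ‖T * Zᵀ‖ ≤ 4 * (s₂ * σ * ‖T‖))
    (hH : ‖hollow (Z * Zᵀ)‖ ≤ 16 * (s₂ * σ * ‖Z‖))
    (hw : ∀ (m : Fin n) (V : Matrix (Fin n) (Fin r) ℝ),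
      IsGapEigenvectors (gram T (dropRow m Z)) V (9 / 10 * L ^ 2) (L ^ 2 / 10) →
      vn (noiseRow T Z m ᵥ* V) ≤ √(44 * ℓ) * σ * (√r * ‖T + Z‖))
    {V : Matrix (Fin n) (Fin r) ℝ} (hV : IsLeadingEigenvectors (gram T Z) V) :
    (∃ W, IsAligning U V W ∧ ∀ m, vn ((V - U * W).row m) ≤
      10 ^ 5 * (κ * μ * √(r * ℓ) / ρ + μ * √(r * q) * ℓ / ρ ^ 2 + κ ^ 2 * μ ^ 2 * (r / n))) ∧
    ∀ (m : Fin n) (V' : Matrix (Fin n) (Fin r) ℝ),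
      IsLeadingEigenvectors (gram T (dropRow m Z)) V' →
      ‖V * Vᵀ - V' * V'ᵀ‖ ≤
        10 ^ 5 * (κ * μ * √(r * ℓ) / ρ + μ * √(r * q) * ℓ / ρ ^ 2) := by
  have hρ0 := hR.ρ_pos
  have hκ1 := hR.one_le_κ
  have hμ1 := hR.one_le_μ
  have hℓ1 := hR.one_le_ℓ
  have hq0 := hR.q_nonneg
  have hs₁ : 0 ≤ s₁ := by rw [hR.s₁_eq]; positivity
  have hs₂ : 0 ≤ s₂ := by rw [hR.s₂_eq]; positivity
  set A := κ * μ * √(r * ℓ) / ρ with hA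
  set B := μ * √(r * q) * ℓ / ρ ^ 2 with hB
  set E := κ ^ 2 * μ ^ 2 * ((r : ℝ) / n) with hEdef
  have hA0 : 0 ≤ A := by positivity
  have hB0 : 0 ≤ B := by positivity
  have hE0 : 0 ≤ E := by positivity
  set x := κ * s₂ / ρ with hx
  set y := s₁ * s₂ / ρ ^ 2 with hy
  have hx0 : 0 ≤ x := by positivity
  have hy0 : 0 ≤ y := by positivity
  have hx1 := hR.s₂_le
  have hy1 := hR.s₁s₂_le
  set u := μ * √(r / n) with hudef
  have hu0 : 0 ≤ u := by positivity
  -- all error terms are compared with `L ^ 2`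
  have hσL : σ ≤ L / ρ := by rw [le_div_iff₀ hρ0]; linarith
  have hσL2 : σ ^ 2 ≤ (L / ρ) ^ 2 := by gcongr
  set D := (u * ‖T‖) ^ 2 with hD
  set τ := 4 * (x * L ^ 2) with hτ
  set γ := 64 * (y * L ^ 2) with hγ
  have hτle : ‖T * Zᵀ‖ ≤ τ := by
    refine hX.trans ?_
    have : s₂ * σ * ‖T‖ ≤ s₂ * (L / ρ) * (κ * L) := by gcongr
    have e : s₂ * (L / ρ) * (κ * L) = x * L ^ 2 := by rw [hx]; field_simp
    rw [hτ]; linarith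
  have hγle : ‖hollow (Z * Zᵀ)‖ ≤ γ := by
    refine hH.trans ?_
    have h1 : s₂ * σ * ‖Z‖ ≤ s₂ * σ * (4 * (s₁ * σ)) := by gcongr
    have h2 : s₂ * s₁ * σ ^ 2 ≤ s₂ * s₁ * (L / ρ) ^ 2 := by gcongr
    have e : s₂ * s₁ * (L / ρ) ^ 2 = y * L ^ 2 := by rw [hy]; field_simp
    rw [hγ]; linarith
  have hDle : D ≤ E * L ^ 2 := by
    have h1 : (u * ‖T‖) ^ 2 ≤ (u * (κ * L)) ^ 2 := by gcongr
    have h2 : (u * (κ * L)) ^ 2 = E * L ^ 2 := by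
      have := Real.sq_sqrt (show 0 ≤ (r : ℝ) / n by positivity)
      rw [hudef, hEdef, mul_pow, mul_pow, mul_pow, this]; ring
    linarith
  have hS : SmallNoise T Z D τ γ := ⟨hT.norm_diagonal_le hu, hτle, hγle⟩
  have hL2 : 0 < L ^ 2 := by positivity
  have hsmall : D + 4 * τ + γ ≤ L ^ 2 / 10 := by
    have h1 : E * L ^ 2 ≤ 1 / 40 * L ^ 2 := by gcongr
    have h2 : x * L ^ 2 ≤ 1 / 640 * L ^ 2 := by gcongr
    have h3 : y * L ^ 2 ≤ 1 / 2560 * L ^ 2 := by gcongr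
    rw [hτ, hγ]; linarith
  have hloo {m : Fin n} {V' : Matrix (Fin n) (Fin r) ℝ}
      (hV' : IsLeadingEigenvectors (gram T (dropRow m Z)) V') :
      vn (noiseRow T Z m ᵥ* V') ≤ (35 * A + 196 * B) * L ^ 2 := by
    have hgap := hT.isGapEigenvectors (hS.dropRow m) hV'
    refine (hw m V' ((hgap.mono_left (by linarith)).mono_right hsmall)).trans ?_
    have h1 : ‖T + Z‖ ≤ κ * L + 4 * (s₁ * (L / ρ)) := by
      refine (norm_add_le _ _).trans (add_le_add hκ (hN.trans ?_))
      gcongr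
    have h2 : √(44 * ℓ) * σ * (√r * ‖T + Z‖) ≤
        √(44 * ℓ) * (L / ρ) * (√r * (κ * L + 4 * (s₁ * (L / ρ)))) := by gcongr
    have e : √(44 * ℓ) * (L / ρ) * (√r * (κ * L + 4 * (s₁ * (L / ρ)))) =
        √(44 * ℓ) * √r * (κ / ρ + 4 * (s₁ / ρ ^ 2)) * L ^ 2 := by field_simp
    rw [e] at h2
    exact h2.trans (mul_le_mul_of_nonneg_right hR.w_le hL2.le)
  have hrow (m : Fin n) : vn (U.row m) * (4 * τ + γ) ≤ (720 * A + 4032 * B) * L ^ 2 := by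
    have h1 : vn (U.row m) * (4 * τ + γ) ≤ u * (4 * τ + γ) := by
      gcongr
      exact hu m
    have h2 : u * (4 * τ + γ) = u * (16 * x + 64 * y) * L ^ 2 := by rw [hτ, hγ]; ring
    rw [h2] at h1
    exact h1.trans (mul_le_mul_of_nonneg_right hR.u_mul_le hL2.le)
  refine ⟨?_, fun m V' hV' => ?_⟩
  · have hcompl : ‖V - U * (Uᵀ * V)‖ < 1 := by
      have hgap := hT.isGapEigenvectors hS hV
      refine (hT.norm_compl_le hL hS (hgap.mono_left (by linarith))).trans_lt ?_
      rw [div_mul_eq_mul_div, div_lt_iff₀ hL2]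
      linarith
    obtain ⟨W, hW, hWle⟩ := exists_isAligning_norm_sub_le hT.orthonormal hV.1 hcompl
    refine ⟨W, hW, fun m => ?_⟩
    obtain ⟨V', hV'⟩ := exists_isLeadingEigenvectors (gram_transpose T (dropRow m Z)) hr
    refine (hT.vn_row_sub_le hL hS hsmall m hV hV' hWle).trans ?_
    rw [div_mul_eq_mul_div, div_le_iff₀ hL2]
    have := hloo hV'
    have := hrow m
    have : 0 ≤ A * L ^ 2 := by positivity
    have : 0 ≤ B * L ^ 2 := by positivity
    have : 0 ≤ E * L ^ 2 := by positivity
    linarith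
  · refine (hT.norm_sub_dropRow_le hL hS hsmall m hV hV').trans ?_
    rw [div_mul_eq_mul_div, div_le_iff₀ (by positivity)]
    have := hloo hV'
    have := hrow m
    have h1 : vn (U.row m) * (2 * τ + γ) ≤ vn (U.row m) * (4 * τ + γ) := by
      refine mul_le_mul_of_nonneg_left ?_ (vn_nonneg _)
      have : 0 ≤ τ := by positivity
      linarith
    have : 0 ≤ A * L ^ 2 := by positivity
    have : 0 ≤ B * L ^ 2 := by positivity
    linarith

end Mode

/-! ### Consequences of the signal strength and incoherence conditions -/

section Smallness

theorem rpow_quarter_pow_four {x : ℝ} (hx : 0 ≤ x) : (x ^ (1 / 4 : ℝ)) ^ 4 = x := by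
  rw [← Real.rpow_natCast, ← Real.rpow_mul hx]; norm_num

theorem rpow_quarter_sq {x : ℝ} (hx : 0 ≤ x) : (x ^ (1 / 4 : ℝ)) ^ 2 = x ^ (1 / 2 : ℝ) := by
  rw [← Real.rpow_natCast, ← Real.rpow_mul hx]; norm_num

/-- The signal strength condition makes the noise terms small once the logarithm of the largest
dimension exceeds a constant. -/
theorem RateBounds.of_snr {n q r ℓ p pm μ κ ρ C₁ : ℝ} (hn : 1 ≤ n) (hnp : n ≤ p) (hq : 0 ≤ q)
    (hqp : q ≤ p ^ 2) (hr : 0 ≤ r) (hℓ : 1 ≤ ℓ) (hℓp : ℓ ≤ p) (hμ : 1 ≤ μ) (hκ : 1 ≤ κ)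
    (hpm : 1 ≤ pm) (hpmp : pm ≤ p) (hρ : 0 < ρ) (hC₁ : 0 < C₁) (hℓC : 10 ^ 8 / C₁ ^ 2 ≤ ℓ)
    (hsnr : C₁ * (κ * √ℓ * p / pm ^ (1 / 4 : ℝ)) ≤ ρ) :
    RateBounds n q r ℓ μ κ ρ (√(40 * (n + q + ℓ))) (√(40 * (n + ℓ))) := by
  have hp : 1 ≤ p := hn.trans hnp
  set w := pm ^ (1 / 4 : ℝ) with hw
  have hw0 : 0 < w := by positivity
  have hw4 : w ^ 4 = pm := rpow_quarter_pow_four (by linarith)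
  set t := √p with ht
  have ht2 : t ^ 2 = p := Real.sq_sqrt (by linarith)
  have ht1 : 1 ≤ t := Real.one_le_sqrt.mpr hp
  have hwt : w ^ 2 ≤ t := Real.le_sqrt_of_sq_le (by rw [← pow_mul, hw4]; exact hpmp)
  have h1 : C₁ * κ * √ℓ * p ≤ ρ * w := by
    have : C₁ * (κ * √ℓ * p / w) = C₁ * κ * √ℓ * p / w := by ring
    rwa [this, div_le_iff₀ hw0] at hsnr
  have h2 : C₁ ^ 2 * κ ^ 2 * ℓ * p ^ 2 ≤ ρ ^ 2 * t := by
    have h3 : (C₁ * κ * √ℓ * p) ^ 2 ≤ (ρ * w) ^ 2 := by gcongr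
    have e := Real.sq_sqrt (show 0 ≤ ℓ by linarith)
    rw [mul_pow, mul_pow, mul_pow, mul_pow, e] at h3
    exact h3.trans (mul_le_mul_of_nonneg_left hwt (by positivity))
  have h3 : 10 ^ 8 * (κ ^ 2 * t ^ 3) ≤ ρ ^ 2 := by
    rw [div_le_iff₀ (by positivity)] at hℓC
    have h4 : 10 ^ 8 * (κ ^ 2 * p ^ 2) ≤ ℓ * C₁ ^ 2 * (κ ^ 2 * p ^ 2) := by gcongr
    have h5 : 10 ^ 8 * (κ ^ 2 * t ^ 3) * t ≤ ρ ^ 2 * t := by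
      have e : 10 ^ 8 * (κ ^ 2 * t ^ 3) * t = 10 ^ 8 * (κ ^ 2 * p ^ 2) := by rw [← ht2]; ring
      rw [e]; linarith
    exact le_of_mul_le_mul_right h5 (by positivity)
  have hs₂ : √(40 * (n + ℓ)) ≤ 9 * t := by
    refine Real.sqrt_le_iff.mpr ⟨by positivity, ?_⟩
    rw [mul_pow, ht2]; linarith
  have hs₁ : √(40 * (n + q + ℓ)) ≤ 11 * t ^ 2 := by
    refine Real.sqrt_le_iff.mpr ⟨by positivity, ?_⟩
    rw [mul_pow, ht2]; nlinarith
  refine ⟨hn, hq, hr, hℓ, hμ, hκ, hρ, rfl, rfl, ?_, ?_⟩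
  · rw [div_le_iff₀ hρ]
    have h4 : κ * √(40 * (n + ℓ)) ≤ κ * (9 * t) := by gcongr
    have h5 : κ * (9 * t) ≤ 1 / 640 * ρ := by
      refine le_of_sq_le_sq ?_ (by positivity)
      have h6 : t ^ 2 ≤ t ^ 3 := pow_le_pow_right₀ ht1 (by norm_num)
      have h7 : κ ^ 2 * t ^ 2 ≤ κ ^ 2 * t ^ 3 := by gcongr
      rw [mul_pow, mul_pow, mul_pow]
      have : 0 ≤ κ ^ 2 * t ^ 3 := by positivity
      linarith
    linarith
  · rw [div_le_iff₀ (by positivity)]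
    have h4 : √(40 * (n + q + ℓ)) * √(40 * (n + ℓ)) ≤ 11 * t ^ 2 * (9 * t) := by gcongr
    have h5 : t ^ 3 ≤ κ ^ 2 * t ^ 3 :=
      le_mul_of_one_le_left (by positivity) (one_le_pow₀ hκ)
    have : 0 ≤ t ^ 3 := by positivity
    nlinarith

/-- The deleted diagonal is negligible once the dimension exceeds a constant. -/
theorem incoherence_term_le {n r R pm μ κ C₂ C₃ : ℝ} (hn : 1 ≤ n) (hrR : r ≤ R)
    (hpm : 1 ≤ pm) (hpmn : pm ≤ n) (hC₂ : 0 < C₂)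
    (hμ : μ ^ 2 * R ≤ C₂ * pm ^ (1 / 2 : ℝ)) (hκ : κ ^ 2 ≤ C₃ * pm ^ (1 / 4 : ℝ))
    (hnC : 40 * (C₂ * C₃) ≤ n ^ (1 / 4 : ℝ)) : κ ^ 2 * μ ^ 2 * (r / n) ≤ 1 / 40 := by
  have hw4 : (pm ^ (1 / 4 : ℝ)) ^ 4 = pm := rpow_quarter_pow_four (by linarith)
  have hv4 : (n ^ (1 / 4 : ℝ)) ^ 4 = n := rpow_quarter_pow_four (by linarith)
  have hwv : pm ^ (1 / 4 : ℝ) ≤ n ^ (1 / 4 : ℝ) :=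
    Real.rpow_le_rpow (by linarith) hpmn (by norm_num)
  rw [← rpow_quarter_sq (by linarith)] at hμ
  have hw0 : 0 < pm ^ (1 / 4 : ℝ) := by positivity
  set w := pm ^ (1 / 4 : ℝ)
  set v := n ^ (1 / 4 : ℝ)
  rw [← mul_div_assoc, div_le_iff₀ (by linarith)]
  have h1 : μ ^ 2 * r ≤ C₂ * w ^ 2 := (mul_le_mul_of_nonneg_left hrR (sq_nonneg _)).trans hμ
  have h2 : κ ^ 2 * (μ ^ 2 * r) ≤ C₃ * w * (C₂ * w ^ 2) :=
    (mul_le_mul_of_nonneg_left h1 (sq_nonneg _)).trans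
      (mul_le_mul_of_nonneg_right hκ (by positivity))
  have h3 : 40 * (C₂ * C₃) * w ^ 3 ≤ v * v ^ 3 := by gcongr
  have h4 : v * v ^ 3 = n := by rw [← hv4]; ring
  nlinarith

/-- The dimension from which on the perturbation argument applies. -/
theorem exists_dimension_threshold {C₁ C₂ C₃ : ℝ} : ∃ P₀ : ℕ, 1 ≤ P₀ ∧ ∀ n : ℕ, P₀ ≤ n →
    1 ≤ Real.log n ∧ 10 ^ 8 / C₁ ^ 2 ≤ Real.log n ∧ 40 * (C₂ * C₃) ≤ (n : ℝ) ^ (1 / 4 : ℝ) := by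
  have hlog : Filter.Tendsto (fun n : ℕ => Real.log n) Filter.atTop Filter.atTop :=
    Real.tendsto_log_atTop.comp tendsto_natCast_atTop_atTop
  have hpow : Filter.Tendsto (fun n : ℕ => (n : ℝ) ^ (1 / 4 : ℝ)) Filter.atTop Filter.atTop :=
    (tendsto_rpow_atTop (by norm_num)).comp tendsto_natCast_atTop_atTop
  obtain ⟨N, hN⟩ := Filter.eventually_atTop.mp ((hlog.eventually_ge_atTop 1).and
    ((hlog.eventually_ge_atTop (10 ^ 8 / C₁ ^ 2)).and
      (hpow.eventually_ge_atTop (40 * (C₂ * C₃)))))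
  exact ⟨N + 1, by omega, fun n hn => hN n (by omega)⟩

end Smallness

/-! ### Matricizations and tensor parameters -/

section Matricization

variable {p r : Fin 3 → ℕ}

theorem card_colIdx (p : Fin 3 → ℕ) (k : Fin 3) : Fintype.card (ColIdx p k) = prodOther p k := by
  have h : (Finset.univ.erase k : Finset (Fin 3)) = Finset.univ.image k.succAbove := by
    rw [Fin.image_succAbove_univ]; ext; simp
  rw [prodOther, h, Finset.prod_image fun _ _ _ _ => @Fin.succAbove_right_injective _ k _ _]
  simp [ColIdx]

/-- The position in the tensor of an entry of the mode-`k` matricization. -/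
def entryIdx (k : Fin 3) (x : Fin (p k) × ColIdx p k) : (j : Fin 3) → Fin (p j) :=
  k.insertNth x.1 x.2

theorem entryIdx_injective (k : Fin 3) : Function.Injective (entryIdx (p := p) k) := by
  intro x y h
  exact Prod.ext_iff.mpr (Fin.insertNth_injective2 h)

theorem matricize_add (k : Fin 3) (T z : Tensor p) :
    matricize k (fun i => T i + z i) = matricize k T + toMat fun x => z (entryIdx k x) := rfl

theorem matricize_add_leaveOut (k : Fin 3) (m : Fin (p k)) (T z : Tensor p) :
    matricize k (fun i => T i + leaveOut k m z i) =
      matricize k T + dropRow m (toMat fun x => z (entryIdx k x)) := by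
  ext a b
  simp [matricize, leaveOut, dropRow, toMat, entryIdx]

theorem isDiagDeletion_add_iff {s : ℕ} (k : Fin 3) (T z : Tensor p)
    (V : Matrix (Fin (p k)) (Fin s) ℝ) : IsDiagDeletion k (fun i => T i + z i) V ↔
      IsLeadingEigenvectors (gram (matricize k T) (toMat fun x => z (entryIdx k x))) V := by
  rw [IsDiagDeletion, matricize_add, gram]

theorem isDiagDeletion_leaveOut_iff {s : ℕ} (k : Fin 3) (m : Fin (p k)) (T z : Tensor p)
    (V : Matrix (Fin (p k)) (Fin s) ℝ) : IsDiagDeletion k (fun i => T i + leaveOut k m z i) V ↔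
      IsLeadingEigenvectors
        (gram (matricize k T) (dropRow m (toMat fun x => z (entryIdx k x)))) V := by
  rw [IsDiagDeletion, matricize_add_leaveOut, gram]

end Matricization

section Parameters

theorem vn_row_le_twoInfNorm {m n : Type*} [Fintype m] [Fintype n] (M : Matrix m n ℝ) (i : m) :
    vn (M.row i) ≤ twoInfNorm M := by
  rw [vn_eq_sqrt]
  exact le_ciSup (f := fun i => √(∑ j, M i j ^ 2)) (Set.finite_range _).bddAbove i

theorem twoInfNorm_le {m n : Type*} [Fintype m] [Fintype n] [Nonempty m] {M : Matrix m n ℝ} {a : ℝ}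
    (h : ∀ i, vn (M.row i) ≤ a) : twoInfNorm M ≤ a := by
  refine ciSup_le fun i => ?_
  have := h i
  rwa [vn_eq_sqrt] at this

variable {p r : Fin 3 → ℕ} {T : Tensor p} {U : (k : Fin 3) → Matrix (Fin (p k)) (Fin (r k)) ℝ}

theorem rank_le_dim (hrank : ∀ k, (matricize k T).rank = r k) (k : Fin 3) : r k ≤ p k := by
  rw [← hrank k]
  simpa using (matricize k T).rank_le_card_height

theorem tensorLambda_le (T : Tensor p) (k : Fin 3) :
    tensorLambda T ≤ minSingularValue (matricize k T) :=
  ciInf_le (Set.finite_range _).bddBelow k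

theorem tensorLambda_pos (hr : ∀ k, 1 ≤ (matricize k T).rank) : 0 < tensorLambda T := by
  obtain ⟨k, hk⟩ := exists_eq_ciInf_of_finite (f := fun k => minSingularValue (matricize k T))
  rw [tensorLambda, ← hk]
  exact minSingularValue_pos (hr k)

theorem norm_le_tensorKappa_mul (k : Fin 3) (hr : 1 ≤ (matricize k T).rank) :
    ‖matricize k T‖ ≤ tensorKappa T * minSingularValue (matricize k T) := by
  rw [← div_le_iff₀ (minSingularValue_pos hr)]
  exact le_ciSup (f := fun k => specNorm (matricize k T) / minSingularValue (matricize k T))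
    (Set.finite_range _).bddAbove k

theorem one_le_tensorKappa (hr : ∀ k, 1 ≤ r k) (hrank : ∀ k, (matricize k T).rank = r k)
    (hU : ∀ k, IsLeadingLeftSingular (matricize k T) (U k)) : 1 ≤ tensorKappa T := by
  have h1 : 1 ≤ (matricize 0 T).rank := by rw [hrank]; exact hr 0
  have h2 := norm_le_tensorKappa_mul 0 h1
  have h3 := ((hU 0).isSignal (hrank 0)).le_norm (hr 0)
  have h4 := minSingularValue_pos h1
  by_contra! h
  nlinarith

theorem le_incoherence (U : (k : Fin 3) → Matrix (Fin (p k)) (Fin (r k)) ℝ) (k : Fin 3) :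
    √((p k : ℝ) / (r k : ℝ)) * twoInfNorm (U k) ≤ incoherence U :=
  le_ciSup (f := fun k => √((p k : ℝ) / (r k : ℝ)) * twoInfNorm (U k))
    (Set.finite_range _).bddAbove k

theorem vn_row_le_incoherence (k : Fin 3) (hr : 1 ≤ r k) (hp : 1 ≤ p k) (i : Fin (p k)) :
    vn ((U k).row i) ≤ incoherence U * √((r k : ℝ) / p k) := by
  have hr' : (0 : ℝ) < r k := by exact_mod_cast hr
  have hp' : (0 : ℝ) < p k := by exact_mod_cast hp
  have e : √((p k : ℝ) / r k) * √((r k : ℝ) / p k) = 1 := by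
    rw [← Real.sqrt_mul (by positivity), div_mul_div_cancel₀ hr'.ne', div_self hp'.ne',
      Real.sqrt_one]
  calc vn ((U k).row i) ≤ twoInfNorm (U k) := vn_row_le_twoInfNorm _ _
    _ = √((p k : ℝ) / r k) * twoInfNorm (U k) * √((r k : ℝ) / p k) := by
      rw [mul_right_comm, e, one_mul]
    _ ≤ _ := mul_le_mul_of_nonneg_right (le_incoherence U k) (Real.sqrt_nonneg _)

/-- The rows of `U k` have mean squared norm `r k / p k`. -/
theorem one_le_incoherence (k : Fin 3) (hr : 1 ≤ r k) (hp : 1 ≤ p k)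
    (hU : (U k)ᵀ * U k = 1) : 1 ≤ incoherence U := by
  have hr' : (0 : ℝ) < r k := by exact_mod_cast hr
  have hp' : (0 : ℝ) < p k := by exact_mod_cast hp
  have h1 := frobNorm_sq_of_orthonormal hU
  rw [frobNorm_sq, Fintype.card_fin] at h1
  have h0 : 0 ≤ incoherence U := by
    have := (vn_nonneg _).trans (vn_row_le_incoherence (U := U) k hr hp ⟨0, hp⟩)
    by_contra! h
    have : 0 < √((r k : ℝ) / p k) := by positivity
    nlinarith
  have h2 : (r k : ℝ) ≤ ∑ _i : Fin (p k), incoherence U ^ 2 * ((r k : ℝ) / p k) := by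
    refine h1.ge.trans (Finset.sum_le_sum fun i _ => ?_)
    have := pow_le_pow_left₀ (vn_nonneg _) (vn_row_le_incoherence (U := U) k hr hp i) 2
    rwa [mul_pow, Real.sq_sqrt (by positivity)] at this
  rw [Finset.sum_const, Finset.card_univ, Fintype.card_fin, nsmul_eq_mul] at h2
  have e : (p k : ℝ) * (incoherence U ^ 2 * ((r k : ℝ) / p k)) = incoherence U ^ 2 * r k := by
    field_simp
  rw [e] at h2
  have h3 : 1 ≤ incoherence U ^ 2 := by
    by_contra! h
    nlinarith
  exact (one_le_sq_iff₀ h0).mp h3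

theorem le_maxDim (p : Fin 3 → ℕ) (k : Fin 3) : p k ≤ maxDim p :=
  Finset.le_sup' p (Finset.mem_univ k)

theorem minDim_le (p : Fin 3 → ℕ) (k : Fin 3) : minDim p ≤ p k :=
  Finset.inf'_le p (Finset.mem_univ k)

theorem one_le_minDim (hp : ∀ k, 1 ≤ p k) : 1 ≤ minDim p :=
  (Finset.le_inf'_iff _ _).mpr fun k _ => hp k

theorem prodOther_le (p : Fin 3 → ℕ) (k : Fin 3) : prodOther p k ≤ maxDim p ^ 2 := by
  refine (Finset.prod_le_pow_card _ _ _ fun j _ => le_maxDim p j).trans_eq ?_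
  rw [Finset.card_erase_of_mem (Finset.mem_univ k)]
  simp

end Parameters

section Modes

/-- The bound used in low dimension. -/
theorem exists_isAligning_vn_row_le {n r : ℕ} {U V : Matrix (Fin n) (Fin r) ℝ}
    (hU : Uᵀ * U = 1) (hV : Vᵀ * V = 1) :
    ∃ W, IsAligning U V W ∧ ∀ m, vn ((V - U * W).row m) ≤ 2 := by
  obtain ⟨W, hW⟩ := exists_isAligning U V
  have hWW : Wᵀ * W = 1 :=
    (Matrix.mem_orthogonalGroup_iff' (Fin r) ℝ).mp hW.1
  have h2 : (U * W)ᵀ * (U * W) = 1 := by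
    rw [Matrix.transpose_mul, Matrix.mul_assoc, ← Matrix.mul_assoc Uᵀ, hU, Matrix.one_mul, hWW]
  refine ⟨W, hW, fun m => (vn_row_le_norm _ m).trans ((norm_sub_le _ _).trans ?_)⟩
  linarith [norm_le_one_of_orthonormal hV, norm_le_one_of_orthonormal h2]

variable {p r : Fin 3 → ℕ} {T : Tensor p} {U : (k : Fin 3) → Matrix (Fin (p k)) (Fin (r k)) ℝ}
  {σ C₁ C₂ C₃ : ℝ} {Ω : Type*} [MeasurableSpace Ω] {P : Measure Ω} [IsProbabilityMeasure P]
  {Z : ((k : Fin 3) → Fin (p k)) → Ω → ℝ}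

/-- The error bounds for the mode `k`, uniform over the choice of the leading eigenvectors, when
the noise tensor is `z`. -/
def ModeErrorBounds (T : Tensor p) (U : (k : Fin 3) → Matrix (Fin (p k)) (Fin (r k)) ℝ) (σ : ℝ)
    (k : Fin 3) (z : Tensor p) : Prop :=
  ∀ V : Matrix (Fin (p k)) (Fin (r k)) ℝ, IsDiagDeletion k (fun i => T i + z i) V →
  (∃ W, IsAligning (U k) V W ∧ ∀ m, vn ((V - U k * W).row m) ≤
    10 ^ 5 * (tensorKappa T * incoherence U * √((r k : ℝ) * Real.log (maxDim p)) /
        (tensorLambda T / σ) +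
      incoherence U * √((r k : ℝ) * (prodOther p k : ℝ)) * Real.log (maxDim p) /
        (tensorLambda T / σ) ^ 2 +
      tensorKappa T ^ 2 * incoherence U ^ 2 * ((r k : ℝ) / p k))) ∧
  ∀ (m : Fin (p k)) (V' : Matrix (Fin (p k)) (Fin (r k)) ℝ),
    IsDiagDeletion k (fun i => T i + leaveOut k m z i) V' →
    ‖V * Vᵀ - V' * V'ᵀ‖ ≤
      10 ^ 5 * (tensorKappa T * incoherence U * √((r k : ℝ) * Real.log (maxDim p)) /
          (tensorLambda T / σ) +
        incoherence U * √((r k : ℝ) * (prodOther p k : ℝ)) * Real.log (maxDim p) /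
          (tensorLambda T / σ) ^ 2)

/-- In a mode of large dimension the error bounds hold off an exceptional event. -/
theorem exists_mode_event (hr : ∀ k, 1 ≤ r k) (hrank : ∀ k, (matricize k T).rank = r k)
    (hU : ∀ k, IsLeadingLeftSingular (matricize k T) (U k)) (hσ : 0 < σ)
    (hmeas : ∀ i, Measurable (Z i)) (hind : iIndepFun Z P)
    (hsub : ∀ i, HasSubgaussianMGF (Z i) (Real.toNNReal (σ ^ 2)) P)
    (hC₁ : 0 < C₁) (hC₂ : 0 < C₂)
    (hsnr : C₁ * (tensorKappa T * √(Real.log (maxDim p)) * (maxDim p : ℝ) /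
      (minDim p : ℝ) ^ (1 / 4 : ℝ)) ≤ tensorLambda T / σ)
    (hμ : incoherence U ^ 2 * (maxDim r : ℝ) ≤ C₂ * (minDim p : ℝ) ^ (1 / 2 : ℝ))
    (hκ : tensorKappa T ^ 2 ≤ C₃ * (minDim p : ℝ) ^ (1 / 4 : ℝ))
    (k : Fin 3) (hlog : 1 ≤ Real.log (p k)) (hlogC : 10 ^ 8 / C₁ ^ 2 ≤ Real.log (p k))
    (hpC : 40 * (C₂ * C₃) ≤ (p k : ℝ) ^ (1 / 4 : ℝ)) :
    ∃ B : Set Ω, P B ≤ ENNReal.ofReal (5 / (maxDim p : ℝ) ^ 20) ∧ ∀ ω ∉ B,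
      ModeErrorBounds T U σ k fun i => Z i ω := by
  have hp (j : Fin 3) : 1 ≤ p j := (hr j).trans (rank_le_dim hrank j)
  have hrk (j : Fin 3) : 1 ≤ (matricize j T).rank := by rw [hrank]; exact hr j
  have hpk : (1 : ℝ) ≤ p k := by exact_mod_cast hp k
  have hpmax : (p k : ℝ) ≤ maxDim p := by exact_mod_cast le_maxDim p k
  have hmin : (1 : ℝ) ≤ minDim p := by exact_mod_cast one_le_minDim hp
  have hminle : (minDim p : ℝ) ≤ p k := by exact_mod_cast minDim_le p k
  have hloglog : Real.log (p k) ≤ Real.log (maxDim p) := Real.log_le_log (by linarith) hpmax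
  have hmax0 : (0 : ℝ) < maxDim p := by linarith
  have hlam := tensorLambda_pos hrk
  have hL := minSingularValue_pos (hrk k)
  have hsig := (hU k).isSignal (hrank k)
  have hR := RateBounds.of_snr (r := r k) (q := (prodOther p k : ℝ)) hpk hpmax (Nat.cast_nonneg _)
    (by exact_mod_cast prodOther_le p k) (Nat.cast_nonneg _) (hlog.trans hloglog)
    ((Real.log_le_sub_one_of_pos hmax0).trans (by linarith))
    (one_le_incoherence k (hr k) (hp k) (hU k).1) (one_le_tensorKappa hr hrank hU) hmin
    (hminle.trans hpmax) (div_pos hlam hσ) hC₁ (hlogC.trans hloglog) hsnr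
  have hE := incoherence_term_le (r := r k) hpk (by exact_mod_cast le_maxDim r k) hmin hminle hC₂
    hμ hκ hpC
  obtain ⟨B, hB, hBV⟩ := exists_event (r := r k) (Z := fun x => Z (entryIdx k x)) hσ
    (fun x => hmeas _) (hind.precomp (entryIdx_injective k)) (fun x => hsub _)
    (by linarith : 0 ≤ Real.log (maxDim p)) (by rwa [Real.exp_log hmax0]) (matricize k T)
    (a := 9 / 10 * minSingularValue (matricize k T) ^ 2)
    (b := minSingularValue (matricize k T) ^ 2 / 10) (by nlinarith)
  refine ⟨B, hB.trans (ENNReal.ofReal_le_ofReal (le_of_eq ?_)), fun ω hω V hV => ?_⟩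
  · rw [neg_mul, Real.exp_neg, mul_comm (20 : ℝ), Real.exp_mul, Real.exp_log hmax0, div_eq_mul_inv]
    norm_cast
  · obtain ⟨hN, hX, hH, hw⟩ := hBV ω hω
    rw [isDiagDeletion_add_iff] at hV
    rw [card_colIdx, Nat.cast_add] at hN
    obtain ⟨h1, h2⟩ := hsig.error_bounds hL hσ (norm_le_tensorKappa_mul k (hrk k))
      (vn_row_le_incoherence k (hr k) (hp k)) hR
      (by rw [div_mul_cancel₀ _ hσ.ne']; exact tensorLambda_le T k) hE (rank_le_dim hrank k)
      hN hX hH hw hV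
    refine ⟨h1, fun m V' hV' => h2 m V' ?_⟩
    rwa [isDiagDeletion_leaveOut_iff] at hV'

end Modes

end TensorInit

theorem mainTheorem6 (C₁ C₂ C₃ C₄ : ℝ) (hC₁ : 0 < C₁) (hC₂ : 0 < C₂) (hC₃ : 0 < C₃)
    (hC₄ : 0 < C₄) :
    ∃ C : ℝ, 0 < C ∧ ∃ P₀ : ℕ,
      ∀ (p r : Fin 3 → ℕ) (T : TensorInit.Tensor p)
        (U : (k : Fin 3) → Matrix (Fin (p k)) (Fin (r k)) ℝ) (σ lam κ μ₀ : ℝ)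
        {Ω : Type*} [MeasurableSpace Ω] (P : Measure Ω) [IsProbabilityMeasure P]
        (Z : ((k : Fin 3) → Fin (p k)) → Ω → ℝ),
        -- the signal tensor, its Tucker ranks, singular vectors and parameters
        (∀ k, 1 ≤ r k) →
        (∀ k, (TensorInit.matricize k T).rank = r k) →
        (∀ k, TensorInit.IsLeadingLeftSingular (TensorInit.matricize k T) (U k)) →
        lam = TensorInit.tensorLambda T →
        κ = TensorInit.tensorKappa T →
        μ₀ = TensorInit.incoherence U →
        -- the noise
        0 < σ →
        (∀ i, Measurable (Z i)) →
        iIndepFun Z P →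
        (∀ i, HasSubgaussianMGF (Z i) (Real.toNNReal (σ ^ 2)) P) →
        -- signal strength, incoherence, conditioning and rank conditions
        C₁ * (κ * Real.sqrt (Real.log (TensorInit.maxDim p)) * (TensorInit.maxDim p : ℝ) /
          (TensorInit.minDim p : ℝ) ^ (1 / 4 : ℝ)) ≤ lam / σ →
        μ₀ ^ 2 * (TensorInit.maxDim r : ℝ) ≤ C₂ * (TensorInit.minDim p : ℝ) ^ (1 / 2 : ℝ) →
        κ ^ 2 ≤ C₃ * (TensorInit.minDim p : ℝ) ^ (1 / 4 : ℝ) →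
        (TensorInit.maxDim r : ℝ) ≤ C₄ * (TensorInit.minDim r : ℝ) →
        -- the failure probability
        P {ω | ¬ ∀ (k : Fin 3) (Uhat : Matrix (Fin (p k)) (Fin (r k)) ℝ),
            TensorInit.IsDiagDeletion k (fun i => T i + Z i ω) Uhat →
            (∃ W : Matrix (Fin (r k)) (Fin (r k)) ℝ,
              TensorInit.IsAligning (U k) Uhat W ∧
              TensorInit.twoInfNorm (Uhat - U k * W) ≤
                C * (κ * μ₀ * Real.sqrt ((r k : ℝ) * Real.log (TensorInit.maxDim p)) / (lam / σ)
                  + μ₀ * Real.sqrt ((r k : ℝ) * (TensorInit.prodOther p k : ℝ)) *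
                      Real.log (TensorInit.maxDim p) / (lam / σ) ^ 2
                  + κ ^ 2 * μ₀ ^ 2 * ((r k : ℝ) / (p k : ℝ)))) ∧
            (P₀ ≤ p k →
              ∀ (m : Fin (p k)) (Utilde : Matrix (Fin (p k)) (Fin (r k)) ℝ),
                TensorInit.IsDiagDeletion k
                  (fun i => T i + TensorInit.leaveOut k m (fun j => Z j ω) i) Utilde →
                TensorInit.specNorm (Uhat * Uhat.transpose - Utilde * Utilde.transpose) ≤
                  C * (κ * μ₀ * Real.sqrt ((r k : ℝ) * Real.log (TensorInit.maxDim p)) / (lam / σ)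
                    + μ₀ * Real.sqrt ((r k : ℝ) * (TensorInit.prodOther p k : ℝ)) *
                        Real.log (TensorInit.maxDim p) / (lam / σ) ^ 2))} ≤
          ENNReal.ofReal (C / (TensorInit.maxDim p : ℝ) ^ 20) := by
  obtain ⟨P₀, hP₀, hthr⟩ := TensorInit.exists_dimension_threshold (C₁ := C₁) (C₂ := C₂) (C₃ := C₃)
  -- `10 ^ 5` serves the modes of large dimension, `2 * P₀` the others, and `15` the probability
  refine ⟨10 ^ 5 + 2 * P₀ + 15, by positivity, P₀, ?_⟩
  intro p r T U σ lam κ μ₀ Ω _ P _ Z hr hrank hU hlam hκ hμ hσ hmeas hind hsub hsnr hinc hcond _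
  subst hlam hκ hμ
  have hp (j : Fin 3) : 1 ≤ p j := (hr j).trans (TensorInit.rank_le_dim hrank j)
  have hmax : (1 : ℝ) ≤ TensorInit.maxDim p := by
    exact_mod_cast (hp 0).trans (TensorInit.le_maxDim p 0)
  have hκ1 := TensorInit.one_le_tensorKappa hr hrank hU
  have hμ1 := TensorInit.one_le_incoherence 0 (hr 0) (hp 0) (hU 0).1
  have hρ : 0 < TensorInit.tensorLambda T / σ :=
    div_pos (TensorInit.tensorLambda_pos fun j => by rw [hrank]; exact hr j) hσ
  have hℓ := Real.log_nonneg hmax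
  -- no exceptional event is needed in a mode of low dimension
  have hev (k : Fin 3) : ∃ B : Set Ω,
      P B ≤ ENNReal.ofReal (5 / (TensorInit.maxDim p : ℝ) ^ 20) ∧
      (P₀ ≤ p k → ∀ ω ∉ B, TensorInit.ModeErrorBounds T U σ k fun i => Z i ω) := by
    by_cases hk : P₀ ≤ p k
    · obtain ⟨h1, h2, h3⟩ := hthr (p k) hk
      obtain ⟨B, hB, hBV⟩ := TensorInit.exists_mode_event hr hrank hU hσ hmeas hind hsub hC₁ hC₂
        hsnr hinc hcond k h1 h2 h3
      exact ⟨B, hB, fun _ => hBV⟩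
    · exact ⟨∅, by simp, fun h => absurd h hk⟩
  choose B hB hBV using hev
  have hprob : ∀ s : Set Ω, s ⊆ ⋃ k, B k →
      P s ≤ ENNReal.ofReal ((10 ^ 5 + 2 * P₀ + 15) / (TensorInit.maxDim p : ℝ) ^ 20) := by
    intro s hs
    calc P s ≤ ∑ k : Fin 3, P (B k) := (measure_mono hs).trans (measure_iUnion_fintype_le P B)
      _ ≤ ∑ _k : Fin 3, ENNReal.ofReal (5 / (TensorInit.maxDim p : ℝ) ^ 20) :=
        Finset.sum_le_sum fun k _ => hB k
      _ = ENNReal.ofReal (∑ _k : Fin 3, 5 / (TensorInit.maxDim p : ℝ) ^ 20) :=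
        (ENNReal.ofReal_sum_of_nonneg fun _ _ => by positivity).symm
      _ ≤ _ := by
        refine ENNReal.ofReal_le_ofReal ?_
        rw [Finset.sum_const, Finset.card_univ, Fintype.card_fin, nsmul_eq_mul, ← mul_div_assoc]
        gcongr
        have : (0 : ℝ) ≤ P₀ := Nat.cast_nonneg _
        norm_num
        linarith
  refine hprob _ fun ω hω => ?_
  by_contra hω'
  rw [Set.mem_iUnion, not_exists] at hω'
  refine hω fun k V hV => ?_
  have : Nonempty (Fin (p k)) := ⟨⟨0, hp k⟩⟩
  have hpk : (0 : ℝ) < p k := by exact_mod_cast hp k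
  have hA : 0 ≤ TensorInit.tensorKappa T * TensorInit.incoherence U *
      √((r k : ℝ) * Real.log (TensorInit.maxDim p)) / (TensorInit.tensorLambda T / σ) := by
    positivity
  have hB' : 0 ≤ TensorInit.incoherence U * √((r k : ℝ) * (TensorInit.prodOther p k : ℝ)) *
      Real.log (TensorInit.maxDim p) / (TensorInit.tensorLambda T / σ) ^ 2 := by
    positivity
  have hP : (0 : ℝ) ≤ P₀ := Nat.cast_nonneg _
  by_cases hk : P₀ ≤ p k
  · obtain ⟨⟨W, hW, hWle⟩, h2⟩ := hBV k hk ω (hω' k) V hV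
    refine ⟨⟨W, hW, TensorInit.twoInfNorm_le fun m => (hWle m).trans ?_⟩,
      fun _ m V' hV' => (h2 m V' hV').trans ?_⟩
    · gcongr
      linarith
    · gcongr
      linarith
  · refine ⟨?_, fun h => absurd h hk⟩
    obtain ⟨W, hW, hWle⟩ := TensorInit.exists_isAligning_vn_row_le (hU k).1 hV.1
    refine ⟨W, hW, TensorInit.twoInfNorm_le fun m => (hWle m).trans ?_⟩
    -- the last term of the bound is at least `1 / P₀`, as `κ`, `μ₀` and `r k` are at least `1`
    have h1 : 1 ≤ (P₀ : ℝ) * ((r k : ℝ) / p k) := by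
      rw [← mul_div_assoc, le_div_iff₀ hpk, one_mul]
      have h3 : (p k : ℝ) ≤ P₀ := by exact_mod_cast (not_le.mp hk).le
      have h4 : (1 : ℝ) ≤ r k := by exact_mod_cast hr k
      nlinarith
    have h2 : (r k : ℝ) / p k ≤ TensorInit.tensorKappa T ^ 2 * TensorInit.incoherence U ^ 2 *
        ((r k : ℝ) / p k) := by
      refine le_mul_of_one_le_left (by positivity) ?_
      exact one_le_mul_of_one_le_of_one_le (one_le_pow₀ hκ1) (one_le_pow₀ hμ1)
    calc (2 : ℝ) ≤ 2 * P₀ * (TensorInit.tensorKappa T ^ 2 * TensorInit.incoherence U ^ 2 *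
          ((r k : ℝ) / p k)) := by nlinarith
      _ ≤ _ := by
        gcongr <;> linarith
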